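/- **Setting.** Let $K$ be one of the compact groups below, with Lie algebra $\mathfrak k$, complexification $\mathfrak g$, Cartan subalgebra $\mathfrak t$ and simple roots $\Pi$. For $S\subset\Pi$ let $\mathfrak k_S=\mathfrak t\oplus\bigoplus_\alpha(\mathfrak g_\alpha\oplus\mathfrak g_{-\alpha})\cap\mathfrak k$, the sum being over the positive roots $\alpha$ in the span of $S$. A set $\Phi\subset S$ is *noncompact* in $S$ if its members occur with total coefficient $0$ or $1$ in each positive root of $\mathfrak k_S$ (for $\Phi=\{\phi\}$: $\phi$ is a noncompact root of $\mathfrak k_S$); then $\rho_\Phi$ is the element of $\mathfrak t$ orthogonal to the centre of $\mathfrak k_S$ with $\phi(\rho_\Phi)=i$ for $\phi\in\Phi$ and $\alpha(\rho_\Phi)=0$ for $\alpha\in S\setminus\Phi$. A *Thimm chain* is a chain $\mathfrak k=\mathfrak k_{S_0}\supset\mathfrak k_{S_1}\supset\dots\supset\mathfrak k_{S_p}=\mathfrak t$, with $\mathfrak k_i=\mathfrak k_{S_i}$, $S_0=\Pi$, $S_p=\emptyset$ and each $\Phi_{i+1}=S_i\setminus S_{i+1}$ nonempty and noncompact in $S_i$.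 An irreducible $\mathfrak k_S$-module $W$ with highest weight $\Lambda$ is *$\Phi$-minimal* if $W=V_+\oplus V_-$, where $V_+$ and $V_-\neq0$ are the eigenspaces of $\rho_\Phi$ for $\Lambda(\rho_\Phi)$ and $\Lambda(\rho_\Phi)-i$, and $V_+$ is $\mathfrak k_{S\setminus\Phi}$-irreducible. An irreducible representation $V$ of $\mathfrak k$ is *minimal with respect to the chain* if, starting from $W^0_+=V$, each $W^i_+$ is $\Phi_{i+1}$-minimal with upper eigenspace $W^{i+1}_+$. Let $\phi$ be a noncompact root of $\mathfrak k$ (for $S=\Pi$), $\rho=\rho_{\{\phi\}}$, and $M_\phi=\{k\rho k^{-1}:k\in K\}$. Fix any nonzero real multiple $(\cdot,\cdot)$ of the trace form. The Kirillov–Kostant–Souriau form is $\omega([X,\mu],[Y,\mu])=(\mu,[X,Y])$. Let $r=i\sum_{\alpha>0}e_\alpha\wedge e_{-\alpha}$ with $(e_\alpha,e_{-\alpha})=1$ and $x\wedge y=x\otimes y-y\otimes x$. Let $\pi$ be the Bruhat–Poisson structure on $M_\phi=K/K_\phi$, the projection of $\pi_K(k)=l_k(r)-r_k(r)$, where $X\in\mathfrak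 k$ acts by $\mu\mapsto[X,\mu]$. Let $N=\pi\circ\omega$ (with $\pi(\beta)=\pi(\beta,\cdot)$, $\omega(v)=\omega(v,\cdot)$) and $d_Nf=N^t\,df$ for functions $f$. For a representation $R$ and a $\mathfrak k_i$-invariant subspace $W^i_+$, let $I^{(i)}_r(\mu)=\frac{i^r}{r}\operatorname{Tr}_{W^i_+}\big(R(\mathrm{pr}_{\mathfrak k_i}\mu)^r\big)$ on $M_\phi$, with $\mathrm{pr}_{\mathfrak k_i}$ the orthogonal projection (in the prefactor $i^r$, $i=\sqrt{-1}$). **Theorem.** * **AIII.** Let $K=SU(n)$, $1\le k<n$, $\phi=\alpha_k$, so $\rho=\frac in\operatorname{diag}((n-k)1_k,-k\,1_{n-k})$. The fundamental representation $\mathbb C^n$ is $\phi$-minimal, with $V_+$ and $V_-$ the spans of the first $k$ and of the last $n-k$ basis vectors and $\Lambda(\rho)=i\frac{n-k}n$. The chain $\mathfrak k_i=\mathfrak s(\mathfrak u(n-i)\oplus\mathfrak u(1)^i)$, $0\le i\le n-1$ ($\Phi_{i}=\{\alpha_{n-i}\}$) is a Thimm chain, and $\mathbb C^n$ is minimal with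 respect to it, with $W_+^i=\mathbb C^{n-i}$ the fundamental representation of $\mathfrak u(n-i)$. For all $r\ge1$ and $0\le i\le n-1$, $$d_NI_r^{(i)}=2\tfrac{n-k}{n}\,dI_r^{(i)}+2\,dI_{r+1}^{(i)}.$$ * **BDI.** Let $K=SO(N)$ with $N\ge3$, $N\ne4$, $m=\lfloor N/2\rfloor$, $\phi=\alpha_1$, $M_\phi=SO(N)/SO(N-2)\times SO(2)$. Let $S$ be the spin representation on $\Lambda\mathbb C^m$ if $N$ is odd, and either half-spin representation (even or odd part of $\Lambda\mathbb C^m$) if $N$ is even. Then $S$ is $\phi$-minimal with $\Lambda(\rho)=\frac i2$; here $V_+$ and $V_-$ are spanned by the basis forms of $S$ not containing, respectively containing, the distinguished generator of $\mathbb C^m$ attached to the $SO(2)$ factor. The chain $\mathfrak k_j=\mathfrak{so}(N-2j)\oplus\mathfrak{so}(2)^j$, $0\le j\le\lfloor (N-1)/2\rfloor$, is a Thimm chain; here $\Phi_{j+1}=\{\alpha_{j+1}\}$, i.e. the first simple root of $\mathfrak{so}(N-2j)$, except that for $N=2m$ the last step, from $\mathfrak{so}(4)\oplus\mathfrak{so}(2)^{m-2}$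 to $\mathfrak{so}(2)^m$, has $\Phi=\{\alpha_{m-1},\alpha_m\}$, one root from each simple ideal of $\mathfrak{so}(4)$. $S$ is minimal with respect to this chain, with $W_+^j$ spanned by the basis forms in $S$ that do not involve the first $j$ generators: a spin or half-spin representation of $\mathfrak{so}(N-2j)$. For all $r\ge1$ and $0\le j\le\lfloor (N-1)/2\rfloor$, $$d_NI_r^{(j)}=dI_r^{(j)}+2\,dI_{r+1}^{(j)}.$$ For even $N$ this formula also holds when $W^j_+$ is the sum of the two modules obtained from the two half-spin representations, i.e. for the full spin representation of $\mathfrak{so}(N-2j)$. * **DIII.** Let $K=SO(2n)$, $n\ge2$, $\phi=\alpha_n$, $M_\phi=SO(2n)/U(n)$. * **CI.** Let $K=Sp(2n)$ (the compact symplectic group), $n\ge1$, $\phi=\alpha_n$, $M_\phi=Sp(2n)/U(n)$. In both of the last two cases the fundamental representation $\mathbb C^{2n}$ is $\phi$-minimal with $V_+$ the fundamental representation $\mathbb C^n$ of $\mathfrak u(n)$, $V_-$ its dual, and $\Lambda(\rho)=\frac i2$. The chain $\mathfrak k_0=\mathfrak k$, $\mathfrak k_j=\mathfrak u(n+1-j)\oplus\mathfrak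 u(1)^{j-1}$ for $1\le j\le n$ ($\Phi_{j+1}=\{\alpha_{n-j}\}$) is a Thimm chain, and $\mathbb C^{2n}$ is minimal with respect to it, with $W^0_+=\mathbb C^{2n}$ and $W_+^j=\mathbb C^{n+1-j}$ the fundamental representation of $\mathfrak u(n+1-j)$ for $j\ge1$. For all $r\ge1$ and $0\le j\le n$, $$d_NI_r^{(j)}=dI_r^{(j)}+2\,dI_{r+1}^{(j)}.$$ -/

import Mathlib

open scoped Matrix

namespace HermSym

noncomputable section

/-- Complex square matrices of size `N`. -/
abbrev Mat (N : ℕ) : Type := Matrix (Fin N) (Fin N) ℂ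

/-! ### Matrix realisations of compact Lie algebras, roots and Levi subalgebras -/

/-- The complexified Cartan subalgebra: diagonal matrices in `g`. -/
abbrev cartanOf {N : ℕ} (g : Submodule ℂ (Mat N)) : Submodule ℂ (Mat N) :=
  g ⊓ LinearMap.range (Matrix.diagonalLinearMap (Fin N) ℂ ℂ)

/-- The data of a compact matrix group `K ⊆ U(N)`, the complexification `g` of its Lie algebra, the
simple roots (as functionals on the diagonal matrices of `g`, which form the Cartan subalgebra) and
root vectors `e p`, `p ∈ pos`, for the positive roots; the negative root vectors are the transposes
`(e p)ᵀ`. The only instances used are `typeA`, `typeBD` and `typeC` below; that their entries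
really are a system of simple roots and root vectors is `IsRootData`. -/
structure Datum (N l : ℕ) where
  /-- the complex Lie algebra (a space of matrices closed under commutators) -/
  g : Submodule ℂ (Mat N)
  /-- the compact group -/
  K : Set (Mat N)
  /-- the simple roots -/
  simple : Fin l → Module.Dual ℂ (cartanOf g)
  /-- index set of the positive roots -/
  pos : Finset (Fin N × Fin N)
  /-- positive root vectors -/
  e : Fin N × Fin N → Mat N

namespace Datum

variable {N l : ℕ} (D : Datum N l)

/-- The complexified Cartan subalgebra `𝔱_ℂ`. -/
abbrev cartan : Submodule ℂ (Mat N) := cartanOf D.g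

/-- The compact real form `𝔨`: the skew-Hermitian matrices in `g`. -/
def compact : Submodule ℝ (Mat N) :=
  D.g.restrictScalars ℝ ⊓ skewAdjoint.submodule ℝ (Mat N)

/-- The root space `g_α`. -/
def rootSpace (α : Module.Dual ℂ D.cartan) : Submodule ℂ (Mat N) where
  carrier := {x | x ∈ D.g ∧ ∀ H : D.cartan, (H : Mat N) * x - x * (H : Mat N) = α H • x}
  zero_mem' := ⟨D.g.zero_mem, fun H => by simp⟩
  add_mem' := by
    rintro x y ⟨hx, hx'⟩ ⟨hy, hy'⟩
    refine ⟨D.g.add_mem hx hy, fun H => ?_⟩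
    rw [smul_add, ← hx' H, ← hy' H, mul_add, add_mul]
    abel
  smul_mem' := by
    rintro c x ⟨hx, hx'⟩
    refine ⟨D.g.smul_mem c hx, fun H => ?_⟩
    rw [smul_comm, ← hx' H, smul_sub, mul_smul_comm, smul_mul_assoc]

/-- `α` is a root. -/
def IsRoot (α : Module.Dual ℂ D.cartan) : Prop := α ≠ 0 ∧ D.rootSpace α ≠ ⊥

/-- `α` is a positive root lying in the `ℕ`-span of the simple roots in `S`. -/
def IsPosRoot (S : Finset (Fin l)) (α : Module.Dual ℂ D.cartan) : Prop :=
  D.IsRoot α ∧ α ∈ AddSubmonoid.closure (D.simple '' (S : Set (Fin l)))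

/-- The diagonal matrices in `g` form a maximal abelian subalgebra, `simple` is a base of the root
system, and `e p`, `(e p)ᵀ` (`p ∈ pos`) are root vectors spanning the root spaces of the positive
and of the negative roots, each root occurring once. -/
def IsRootData : Prop :=
  (∀ X ∈ D.g, (∀ H : D.cartan, (H : Mat N) * X = X * (H : Mat N)) → X ∈ D.cartan) ∧
  LinearIndependent ℂ D.simple ∧
  (∀ i, D.IsRoot (D.simple i)) ∧
  (∀ α, D.IsRoot α → D.IsPosRoot Finset.univ α ∨ D.IsPosRoot Finset.univ (-α)) ∧
  (∀ p ∈ D.pos, ∃ α, D.IsPosRoot Finset.univ α ∧ D.rootSpace α = ℂ ∙ D.e p) ∧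
  (∀ α, D.IsPosRoot Finset.univ α → ∃! p, p ∈ D.pos ∧
    D.rootSpace α = ℂ ∙ D.e p ∧ D.rootSpace (-α) = ℂ ∙ (D.e p)ᵀ)

/-- For a set `S` of simple roots, the compact subalgebra
`𝔨_S = 𝔱 ⊕ ⨁ (g_α ⊕ g_{-α}) ∩ 𝔨`, the sum over the positive roots in the span of `S`. -/
def levi (S : Finset (Fin l)) : Submodule ℝ (Mat N) :=
  (D.cartan ⊔ ⨆ α ∈ {α | D.IsRoot α ∧
      α ∈ AddSubgroup.closure (D.simple '' (S : Set (Fin l)))},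
    D.rootSpace α).restrictScalars ℝ ⊓ skewAdjoint.submodule ℝ (Mat N)

/-- The simple roots in `S \ S'` are noncompact roots of `𝔨_S`: in every positive root of `𝔨_S`
they occur with total coefficient `0` or `1`. If `S \ S'` is a single simple root this is the usual
notion; in general it is one noncompact simple root in each of several simple ideals of `𝔨_S`. -/
def IsNoncompact (S S' : Finset (Fin l)) : Prop :=
  ∀ c : Fin l → ℕ, (∀ i ∉ S, c i = 0) → D.IsRoot (∑ i, c i • D.simple i) →
    ∑ i ∈ S \ S', c i ≤ 1

/-- `ρ` is the element of `𝔱` which lies in the semisimple part of `𝔨_S` (it is orthogonal to the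
centre of `𝔨_S`), generates the centre of the centraliser `𝔨_{S'}` there, and is normalised by
`φ(ρ) = i` for `φ ∈ S \ S'`. -/
def IsCentralGenerator (S S' : Finset (Fin l)) (ρ : D.cartan) : Prop :=
  (ρ : Mat N) ∈ D.compact ∧
  (∀ i ∈ S', D.simple i ρ = 0) ∧
  (∀ i ∈ S \ S', D.simple i ρ = Complex.I) ∧
  ∀ H : D.cartan, (∀ i ∈ S, D.simple i H = 0) → Matrix.trace ((ρ : Mat N) * (H : Mat N)) = 0

/-- The sequence of subalgebras `k 0 ⊇ k 1 ⊇ … ⊇ k n` is a Thimm chain `𝔨 = 𝔨_0 ⊃ … ⊃ 𝔨_n = 𝔱`: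
`k i` is the subalgebra attached to the set `S i` of simple roots, and `S (i + 1)` arises from
`S i` by removing noncompact simple roots. -/
def IsThimmChain (n : ℕ) (S : ℕ → Finset (Fin l)) (k : ℕ → Submodule ℝ (Mat N)) : Prop :=
  S 0 = Finset.univ ∧ k 0 = D.compact ∧ S n = ∅ ∧
  (∀ i ≤ n, k i = D.levi (S i)) ∧
  ∀ i < n, S (i + 1) ⊂ S i ∧ D.IsNoncompact (S i) (S (i + 1))

/-! ### Representations, minimality -/

variable {V : Type} [AddCommGroup V] [Module ℂ V]

/-- `R` restricts to a representation of `g`. -/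
def IsRep (R : Mat N →ₗ[ℂ] Module.End ℂ V) : Prop :=
  ∀ X ∈ D.g, ∀ Y ∈ D.g, R (X * Y - Y * X) = R X * R Y - R Y * R X

/-- `W` is a nonzero irreducible `L`-submodule. -/
def _root_.HermSym.IsIrred (R : Mat N →ₗ[ℂ] Module.End ℂ V) (L : Submodule ℝ (Mat N))
    (W : Submodule ℂ V) : Prop :=
  W ≠ ⊥ ∧ (∀ X ∈ L, ∀ v ∈ W, R X v ∈ W) ∧
  ∀ U : Submodule ℂ V, U ≤ W → (∀ X ∈ L, ∀ v ∈ U, R X v ∈ U) → U = ⊥ ∨ U = W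

/-- The irreducible `𝔨_S`-module `W`, with highest weight `Λ`, is minimal for the step from `S` to
`S'`: the eigenvalues of the central generator `ρ` of `𝔨_{S'}` on `W` are `lam = Λ(ρ)` and
`lam - i`, with eigenspaces `Vp` and `Vm`, and `Vp` is irreducible under `𝔨_{S'}`. -/
def IsMinimal (R : Mat N →ₗ[ℂ] Module.End ℂ V) (S S' : Finset (Fin l)) (ρ : Mat N) (lam : ℂ)
    (W Vp Vm : Submodule ℂ V) : Prop :=
  ∃ hρ : ρ ∈ D.cartan, D.IsCentralGenerator S S' ⟨ρ, hρ⟩ ∧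
  IsIrred R (D.levi S) W ∧
  (∃ Λ : Module.Dual ℂ D.cartan, Λ ⟨ρ, hρ⟩ = lam ∧
    ∃ v ∈ W, v ≠ 0 ∧ (∀ H : D.cartan, R (H : Mat N) v = Λ H • v) ∧
      ∀ α, D.IsPosRoot S α → ∀ x ∈ D.rootSpace α, R x v = 0) ∧
  Vp = W ⊓ Module.End.eigenspace (R ρ) lam ∧
  Vm = W ⊓ Module.End.eigenspace (R ρ) (lam - Complex.I) ∧
  W = Vp ⊔ Vm ∧ Vm ≠ ⊥ ∧
  IsIrred R (D.levi S') Vp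

/-- The irreducible representation on `W 0` is minimal with respect to the chain: at each step
`W i` (that is `V_+^i`) is minimal for the noncompact root removed at that step and
`W (i + 1) = V_+^{i+1}` is its upper eigenspace. -/
def IsMinimalForChain (R : Mat N →ₗ[ℂ] Module.End ℂ V) (n : ℕ) (S : ℕ → Finset (Fin l))
    (W : ℕ → Submodule ℂ V) : Prop :=
  ∀ i < n, ∃ (ρ : Mat N) (lam : ℂ) (Vm : Submodule ℂ V),
    D.IsMinimal R (S i) (S (i + 1)) ρ lam (W i) (W (i + 1)) Vm

/-! ### The Nijenhuis tensor on the adjoint orbit `M = K ρ K⁻¹` -/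

/-- The tangent space of the adjoint orbit at `μ`: the values `[X, μ]`, `X ∈ 𝔨`, of the
fundamental vector fields. -/
def tangent (μ : Mat N) : Set (Mat N) := {v | ∃ X ∈ D.compact, X * μ - μ * X = v}

/-- The invariant form `(X, Y) = c tr (X Y)`; the Killing form is of this kind. -/
def _root_.HermSym.form (c : ℝ) (X Y : Mat N) : ℂ := c * Matrix.trace (X * Y)

open Classical in
/-- The Kirillov–Kostant–Souriau form at `μ`, characterised by `ω([X, μ], [Y, μ]) = (μ, [X, Y])`,
that is `ω([X, μ], w) = (X, w)` for tangent vectors `w`. It is extended `ℂ`-linearly in `w`. -/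
def kks (c : ℝ) (μ v w : Mat N) : ℂ :=
  if h : ∃ X ∈ D.compact, X * μ - μ * X = v then form c h.choose w else 0

/-- For `a ∈ U(N)`, the bivector at `μ` induced by `Ad_a r`, applied to a covector `β`; here
`r = i ∑_{α > 0} e_α ∧ e_{-α}` with `(e_α, e_{-α}) = 1` (each summand below is divided by
`(e p, (e p)ᵀ)`), `x ∧ y = x ⊗ y - y ⊗ x`, and `X ∈ g` acts by the tangent vector `[X, μ]`. -/
def rSharp (c : ℝ) (a μ : Mat N) (β : Mat N → ℂ) : Mat N :=
  ∑ p ∈ D.pos,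
    let x := a * D.e p * star a * μ - μ * (a * D.e p * star a)
    let y := a * (D.e p)ᵀ * star a * μ - μ * (a * (D.e p)ᵀ * star a)
    (Complex.I / form c (D.e p) (D.e p)ᵀ) • (β x • y - β y • x)

/-- The Bruhat–Poisson bivector of `M` at the point `μ = k ρ k⁻¹`, applied to a covector `β`: the
projection to `M = K / K_ρ` of the Poisson–Lie bivector `π_K(k) = l_k(r) - r_k(r)`. -/
def bruhat (c : ℝ) (ρ k : Mat N) (β : Mat N → ℂ) : Mat N :=
  D.rSharp c k (k * ρ * star k) β - D.rSharp c 1 (k * ρ * star k) β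

/-- The Nijenhuis tensor `N = π ∘ ω` at the point `k ρ k⁻¹`. -/
def nijenhuis (c : ℝ) (ρ k v : Mat N) : Mat N :=
  D.bruhat c ρ k (D.kks c (k * ρ * star k) v)

/-- The differential at the point `k ρ k⁻¹` of (the restriction to `M` of) `f`, on a tangent
vector. -/
def dAt (ρ k : Mat N) (f : Mat N → ℂ) (v : Mat N) : ℂ := lineDeriv ℝ f (k * ρ * star k) v

/-- The differential `d_N f = Nᵗ df` of a function at the point `k ρ k⁻¹`, on a tangent vector. -/
def dNAt (c : ℝ) (ρ k : Mat N) (f : Mat N → ℂ) (v : Mat N) : ℂ :=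
  dAt ρ k f (D.nijenhuis c ρ k v)

end Datum

open Classical in
/-- The orthogonal projection to the subspace `L` of skew-Hermitian matrices with respect to the
trace form (equivalently, the Killing form). -/
def orthProj {N : ℕ} (L : Submodule ℝ (Mat N)) (X : Mat N) : Mat N :=
  if h : ∃ Y ∈ L, ∀ Z ∈ L, Matrix.trace ((X - Y) * Z) = 0 then h.choose else 0

open Classical in
/-- The trace of `A` on the `A`-invariant subspace `W`. -/
def traceOn {V : Type} [AddCommGroup V] [Module ℂ V] (W : Submodule ℂ V) (A : Module.End ℂ V) :
    ℂ :=
  if h : ∀ v ∈ W, A v ∈ W then LinearMap.trace ℂ W (A.restrict h) else 0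

/-- The pull-back to `𝔨` of the invariant polynomial `I_r(X) = (i^r / r) Tr_W (R(X)^r)` of the
subalgebra `L ⊆ 𝔨`. -/
def invPoly {N : ℕ} {V : Type} [AddCommGroup V] [Module ℂ V] (R : Mat N →ₗ[ℂ] Module.End ℂ V)
    (L : Submodule ℝ (Mat N)) (W : Submodule ℂ V) (r : ℕ) (X : Mat N) : ℂ :=
  Complex.I ^ r / r * traceOn W (R (orthProj L X) ^ r)

/-- `d_N I_r = a dI_r + 2 dI_{r+1}` for all `r ≥ 1`, as one-forms on the adjoint orbit of `ρ`, for
the polynomials `I_r` of the `L`-module `W`. -/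
def NijenhuisFormula {N l : ℕ} (D : Datum N l) (c : ℝ) (ρ : Mat N) {V : Type} [AddCommGroup V]
    [Module ℂ V] (R : Mat N →ₗ[ℂ] Module.End ℂ V) (L : Submodule ℝ (Mat N)) (W : Submodule ℂ V)
    (a : ℂ) : Prop :=
  ∀ r : ℕ, 1 ≤ r → ∀ k ∈ D.K, ∀ v ∈ D.tangent (k * ρ * star k),
    D.dNAt c ρ k (invPoly R L W r) v =
      a * Datum.dAt ρ k (invPoly R L W r) v + 2 * Datum.dAt ρ k (invPoly R L W (r + 1)) v

/-! ### The classical families -/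

/-- The functional `ε_a`, the `a`-th diagonal entry (rows are numbered from `0`). -/
def eps {N : ℕ} (g : Submodule ℂ (Mat N)) (a : ℕ) : Module.Dual ℂ (cartanOf g) :=
  if h : a < N then Matrix.entryLinearMap ℂ ℂ ⟨a, h⟩ ⟨a, h⟩ ∘ₗ (cartanOf g).subtype else 0

/-- `SU(n)`, `𝔰𝔩(n)`, simple roots `ε_j - ε_{j+1}`. -/
def typeA (n : ℕ) : Datum n (n - 1) where
  g := LinearMap.ker (Matrix.traceLinearMap (Fin n) ℂ ℂ)
  K := {U | U ∈ Matrix.specialUnitaryGroup (Fin n) ℂ}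
  simple j := eps _ (j : ℕ) - eps _ ((j : ℕ) + 1)
  pos := Finset.univ.filter fun p => p.1 < p.2
  e p := Matrix.single p.1 p.2 1

/-- The symmetric bilinear form `∑ x_a y_{N-1-a}` on `ℂ^N`. -/
def symForm (N : ℕ) : Mat N := Matrix.of fun a b => if b = a.rev then 1 else 0

/-- `SO(N)` and `𝔰𝔬(N)` (types `B_m` and `D_m`, `m = ⌊N/2⌋`). The symmetric form defining them is
written in a basis of `ℂ^N` for which the Cartan subalgebra is diagonal, so that the compact group
is the group of special unitary matrices preserving `symForm N`; simple roots `ε_j - ε_{j+1}` and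
the last one, which is `ε_{m-2} + ε_{m-1}` for even `N` and `ε_{m-1}` for odd `N`. -/
def typeBD (N : ℕ) : Datum N (N / 2) where
  g := skewAdjointMatricesSubmodule (symForm N)
  K := {U | U ∈ Matrix.specialUnitaryGroup (Fin N) ℂ ∧ Uᵀ * symForm N * U = symForm N}
  simple j :=
    if (j : ℕ) + 1 < N / 2 then eps _ (j : ℕ) - eps _ ((j : ℕ) + 1)
    else if Even N then eps _ ((j : ℕ) - 1) + eps _ (j : ℕ)
    else eps _ j
  pos := Finset.univ.filter fun p => p.1 < p.2 ∧ p.2 < p.1.rev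
  e p := Matrix.single p.1 p.2 1 - Matrix.single p.2.rev p.1.rev 1

/-- The sign `+1` on the first `n` and `-1` on the last `n` indices. -/
def halfSign (n : ℕ) (a : Fin (2 * n)) : ℂ := if (a : ℕ) < n then 1 else -1

/-- The symplectic form `∑_{a < n} (x_a y_{2n-1-a} - x_{2n-1-a} y_a)` on `ℂ^{2n}`. -/
def sympForm (n : ℕ) : Mat (2 * n) :=
  Matrix.of fun a b => if b = a.rev then halfSign n a else 0

/-- The compact symplectic group and `𝔰𝔭(2n)`, simple roots `ε_j - ε_{j+1}` and `2 ε_{n-1}`. -/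
def typeC (n : ℕ) : Datum (2 * n) n where
  g := skewAdjointMatricesSubmodule (sympForm n)
  K := {U | U ∈ Matrix.specialUnitaryGroup (Fin (2 * n)) ℂ ∧ Uᵀ * sympForm n * U = sympForm n}
  simple j := if (j : ℕ) + 1 < n then eps _ (j : ℕ) - eps _ ((j : ℕ) + 1) else (2 : ℂ) • eps _ j
  pos := Finset.univ.filter fun p => p.1 < p.2 ∧ p.2 ≤ p.1.rev
  e p := Matrix.single p.1 p.2 1 -
    (halfSign n p.1 * halfSign n p.2) • Matrix.single p.2.rev p.1.rev 1

/-- All simple roots except the one with (zero-based) number `j`. -/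
def allBut (l j : ℕ) : Finset (Fin l) := Finset.univ.filter fun i => (i : ℕ) ≠ j

/-- The matrices in `L` whose off-diagonal entries `(a, b)` vanish unless `P a b`. -/
def blockSub {N : ℕ} (L : Submodule ℝ (Mat N)) (P : Fin N → Fin N → Prop) :
    Submodule ℝ (Mat N) where
  carrier := {X | X ∈ L ∧ ∀ a b, a ≠ b → ¬ P a b → X a b = 0}
  zero_mem' := ⟨L.zero_mem, fun _ _ _ _ => rfl⟩
  add_mem' := by
    rintro X Y ⟨hX, hX'⟩ ⟨hY, hY'⟩
    exact ⟨L.add_mem hX hY, fun a b h h' => by simp [hX' a b h h', hY' a b h h']⟩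
  smul_mem' := by
    rintro c X ⟨hX, hX'⟩
    exact ⟨L.smul_mem c hX, fun a b h h' => by simp [hX' a b h h']⟩

/-- The functions vanishing outside `P`: the span of the basis vectors with index in `P`. -/
def coordSub {ι : Type} (P : ι → Prop) : Submodule ℂ (ι → ℂ) where
  carrier := {f | ∀ a, ¬ P a → f a = 0}
  zero_mem' := fun _ _ => rfl
  add_mem' := fun hf hg a h => by simp [hf a h, hg a h]
  smul_mem' := fun c f hf a h => by simp [hf a h]

/-- The fundamental representation on `ℂ^N`. -/
def fund (N : ℕ) : Mat N →ₗ[ℂ] Module.End ℂ (Fin N → ℂ) :=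
  (Matrix.toLin' : Mat N ≃ₗ[ℂ] ((Fin N → ℂ) →ₗ[ℂ] (Fin N → ℂ))).toLinearMap

/-! #### AIII -/

/-- `ρ = (i/n) diag ((n-k) 1_k, -k 1_{n-k})`. -/
def rhoA (n k : ℕ) : Mat n :=
  Matrix.diagonal fun a =>
    if (a : ℕ) < k then Complex.I * ((n : ℂ) - k) / n else -(Complex.I * k / n)

/-- Simple roots of `𝔰(𝔲(n-i) ⊕ 𝔲(1)^i)`. -/
def rootsA (n i : ℕ) : Finset (Fin (n - 1)) := Finset.univ.filter fun j => (j : ℕ) + 1 + i < n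

/-- `𝔰(𝔲(n-i) ⊕ 𝔲(1)^i)`. -/
def chainA (n i : ℕ) : Submodule ℝ (Mat n) :=
  blockSub (typeA n).compact fun a b => (a : ℕ) + i < n ∧ (b : ℕ) + i < n

/-- The fundamental representation of `𝔲(n-i)`, on the first `n-i` coordinates. -/
def wA (n i : ℕ) : Submodule ℂ (Fin n → ℂ) := coordSub fun a => (a : ℕ) + i < n

/-! #### DIII and CI -/

/-- `ρ = (i/2) diag (1_n, -1_n)`. -/
def rhoU (n : ℕ) : Mat (2 * n) :=
  Matrix.diagonal fun a => if (a : ℕ) < n then Complex.I / 2 else -(Complex.I / 2)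

/-- All simple roots for `j = 0`, and the simple roots of `𝔲(n+1-j) ⊕ 𝔲(1)^(j-1)` for `j ≥ 1`. -/
def rootsU {l : ℕ} (n j : ℕ) : Finset (Fin l) := Finset.univ.filter fun i => (i : ℕ) + j < n

/-- `𝔨` for `j = 0`, and `𝔲(n+1-j) ⊕ 𝔲(1)^(j-1)` for `j ≥ 1`. Here `A ∈ 𝔲(n)` sits in `𝔨` as the
block diagonal matrix whose upper left block is `A`. -/
def chainU (n : ℕ) (L : Submodule ℝ (Mat (2 * n))) (j : ℕ) : Submodule ℝ (Mat (2 * n)) :=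
  blockSub L fun a b => j = 0 ∨ ((a : ℕ) + j < n + 1 ∧ (b : ℕ) + j < n + 1) ∨
    ((a.rev : ℕ) + j < n + 1 ∧ (b.rev : ℕ) + j < n + 1)

/-- `ℂ^{2n}` for `j = 0`, and the fundamental representation of `𝔲(n+1-j)` for `j ≥ 1`. -/
def wU (n j : ℕ) : Submodule ℂ (Fin (2 * n) → ℂ) :=
  coordSub fun a => j = 0 ∨ (a : ℕ) + j < n + 1

/-! #### BDI -/

/-- The generator `diag (i, 0, …, 0, -i)` of `𝔰𝔬(2)`. -/
def rhoBD (N : ℕ) : Mat N :=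
  Matrix.diagonal fun a =>
    if (a : ℕ) = 0 then Complex.I else if (a.rev : ℕ) = 0 then -Complex.I else 0

/-- Simple roots of `𝔰𝔬(N-2j) ⊕ 𝔰𝔬(2)^j` (none if `N - 2j ≤ 2`). -/
def rootsBD (N j : ℕ) : Finset (Fin (N / 2)) :=
  Finset.univ.filter fun i => j ≤ (i : ℕ) ∧ 2 * j + 2 < N

/-- `𝔰𝔬(N-2j) ⊕ 𝔰𝔬(2)^j`. -/
def chainBD (N j : ℕ) : Submodule ℝ (Mat N) :=
  blockSub (typeBD N).compact fun a b =>
    (j ≤ (a : ℕ) ∧ (a : ℕ) + j < N) ∧ (j ≤ (b : ℕ) ∧ (b : ℕ) + j < N)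

/-- The exterior algebra `Λ ℂ^m`, in the basis `dz̄_A = dz̄_{a_1} ∧ … ∧ dz̄_{a_p}` indexed by the
subsets `A = {a_1 < … < a_p}` of `{0, …, m-1}`. -/
abbrev Fock (m : ℕ) : Type := Finset (Fin m) → ℂ

/-- The sign `(-1)^{#{j ∈ A : j < i}}`. -/
def fockSign {m : ℕ} (A : Finset (Fin m)) (i : Fin m) : ℂ :=
  (-1) ^ (A.filter fun j => j < i).card

/-- Contraction with `∂/∂z̄_i`. -/
def annih {m : ℕ} (i : Fin m) : Module.End ℂ (Fock m) where
  toFun f := fun A => if i ∈ A then 0 else fockSign A i * f (insert i A)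
  map_add' f g := by ext A; by_cases h : i ∈ A <;> simp [h, mul_add]
  map_smul' c f := by ext A; by_cases h : i ∈ A <;> simp [h]; ring

/-- Left exterior multiplication by `dz̄_i`. -/
def create {m : ℕ} (i : Fin m) : Module.End ℂ (Fock m) where
  toFun f := fun A => if i ∈ A then fockSign A i * f (A.erase i) else 0
  map_add' f g := by ext A; by_cases h : i ∈ A <;> simp [h, mul_add]
  map_smul' c f := by ext A; by_cases h : i ∈ A <;> simp [h]; ring

/-- The operator `(-1)^deg`. -/
def parityOp (m : ℕ) : Module.End ℂ (Fock m) where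
  toFun f := fun A => (-1) ^ A.card * f A
  map_add' f g := by ext A; simp [mul_add]
  map_smul' c f := by ext A; simp; ring

/-- The action on `Λ ℂ^m` of the basis vectors of `ℂ^N`, as elements of the Clifford algebra of
`symForm N`: they satisfy `ψ_a ψ_b + ψ_b ψ_a = 1` if `b = N-1-a`, and `= 0` otherwise. In terms of
gamma matrices with `Γ_a Γ_b + Γ_b Γ_a = 2 (e_a, e_b)` one has `Γ_a = √2 ψ_a`. -/
def psi (N : ℕ) (a : Fin N) : Module.End ℂ (Fock (N / 2)) :=
  if h : (a : ℕ) < N / 2 then annih ⟨a, h⟩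
  else if h' : (a.rev : ℕ) < N / 2 then create ⟨a.rev, h'⟩
  else ((Real.sqrt 2 : ℂ)⁻¹) • parityOp (N / 2)

/-- The spin representation of `𝔰𝔬(N)` on `Λ ℂ^m`, which is `X ↦ (1/8) ∑ X_{ij} [Γ_i, Γ_j]` in an
orthonormal basis. -/
def spin (N : ℕ) : Mat N →ₗ[ℂ] Module.End ℂ (Fock (N / 2)) :=
  ∑ a, ∑ b, (Matrix.entryLinearMap ℂ ℂ a b).smulRight
    ((1 / 4 : ℂ) • (psi N a * psi N b.rev - psi N b.rev * psi N a))

/-- The span of the `dz̄_A` with `A ⊆ {j, …, m-1}` and `P (deg dz̄_A)`. -/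
def wSpin (N : ℕ) (P : ℕ → Prop) (j : ℕ) : Submodule ℂ (Fock (N / 2)) :=
  coordSub fun A => P A.card ∧ ∀ i ∈ A, j ≤ (i : ℕ)

/-- The span of the `dz̄_A` with `0 ∈ A` and `P (deg dz̄_A)`. -/
def wSpinLow (N : ℕ) (P : ℕ → Prop) : Submodule ℂ (Fock (N / 2)) :=
  coordSub fun A => P A.card ∧ ∃ i ∈ A, (i : ℕ) = 0

/-- The parity conditions on the degree cutting out the irreducible spin representations of
`𝔰𝔬(N)`: none for odd `N`; even or odd degree (the two half-spin representations) for even `N`. -/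
def IsSpinParity (N : ℕ) (P : ℕ → Prop) : Prop :=
  (Odd N ∧ P = fun _ => True) ∨ (Even N ∧ (P = Even ∨ P = Odd))

end

end HermSym

open HermSym

/-! ### Root spaces of a matrix Lie algebra with diagonal Cartan subalgebra. -/

namespace HermSym

noncomputable section

/-! Write T for `repMat R`, μ for a point of the orbit, v = [X, μ] for a tangent vector, and u, d
for the strictly upper and strictly lower triangular parts of v. Contracting r with the covector (X,
·) amounts to cutting the matrix v into triangular parts, so the right-translated half of the Bruhat
bivector sends v to i[u − d, μ]. The left-translated half is the same expression carried back to the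
base point ρ; there the positive roots take only the values 0 and i, and the expression collapses to
v itself. Hence N v = v − i[u − d, μ] (`rSharp_form`, `tri_commutator_of_noncompact`,
`nijenhuis_eq`).

Minimality says that R(ρ) has only the eigenvalues λ and λ − i, so T(μ) satisfies a quadratic
equation. Its commutator with T(X) is the anticommutation rule T(v)T(μ) + T(μ)T(v) = (2λ − i)T(v).
Let Q be the coordinate projection to W. Upper triangular elements preserve W and lower triangular
ones preserve the span of the remaining basis vectors, so the off-diagonal blocks of T(u) and T(d)
that occur can be read off from T(v). It follows that QT([u − d, μ])Q is a commutator with QT(μ)Q,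
plus (2λ − i)QT(v)Q, minus the anticommutator of QT(v)Q and QT(μ)Q. Against a power of QT(μ)Q the
commutator has trace zero, and the anticommutator produces the differential of the next polynomial
(`trace_commutator_identity`). This is the recursion d_N I_r = a dI_r + 2 dI_{r+1} with a = −2iλ
(`nijenhuisFormula_of_quadratic`).

The rest checks the structure. `IsStandard` and `HasBlocks` isolate what the four families share:
root vectors indexed by pairs of matrix indices, and Levi subalgebras described by blocks.
Irreducibility (`isIrred_coordSub`) follows from weights of multiplicity one and from connectedness
of the graph of nonzero matrix entries; minimality (`isMinimal_coordSub`) adds a basis vector of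
largest weight. Types B, C and D are treated together as Lie algebras of an antidiagonal bilinear
form. For the spin representation the quadratic relation comes from the Clifford algebra of the
plane moved by ρ (`spin_quadratic`), and triangularity becomes combinatorics of subsets (`Hop`). -/

lemma eps_apply {N : ℕ} {g : Submodule ℂ (Mat N)} (a : Fin N) (H : cartanOf g) :
    eps g a H = (H : Mat N) a a := by
  simp [eps]

lemma mem_cartanOf_iff {N : ℕ} {g : Submodule ℂ (Mat N)} {X : Mat N} :
    X ∈ cartanOf g ↔ X ∈ g ∧ X = Matrix.diagonal X.diag := by
  simp only [Submodule.mem_inf, LinearMap.mem_range, Matrix.diagonalLinearMap_apply]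
  refine and_congr_right fun _ => ⟨?_, fun h => ⟨_, h.symm⟩⟩
  rintro ⟨d, rfl⟩
  simp

lemma diagonal_mem_cartanOf {N : ℕ} {g : Submodule ℂ (Mat N)} {d : Fin N → ℂ}
    (h : Matrix.diagonal d ∈ g) : Matrix.diagonal d ∈ cartanOf g :=
  mem_cartanOf_iff.2 ⟨h, by simp⟩

lemma apply_eq_zero_of_mem_cartanOf {N : ℕ} {g : Submodule ℂ (Mat N)} {X : Mat N}
    (hX : X ∈ cartanOf g) {a b : Fin N} (h : a ≠ b) : X a b = 0 := by
  rw [(mem_cartanOf_iff.1 hX).2, Matrix.diagonal_apply_ne _ h]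

lemma cartan_mul_sub_apply {N : ℕ} {g : Submodule ℂ (Mat N)} {H : Mat N} (hH : H ∈ cartanOf g)
    (X : Mat N) (a b : Fin N) : (H * X - X * H) a b = (H a a - H b b) * X a b := by
  rw [(mem_cartanOf_iff.1 hH).2]
  simp [Matrix.diagonal_mul, Matrix.mul_diagonal]
  ring

/-- `a - b` is a sum of consecutive differences. -/
lemma sub_mem_of_consecutive {A : Type*} [AddCommGroup A] (C : AddSubmonoid A) (f : ℕ → A)
    {a b : ℕ} (hab : a ≤ b) (h : ∀ i, a ≤ i → i < b → f i - f (i + 1) ∈ C) : f a - f b ∈ C := by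
  induction b, hab using Nat.le_induction with
  | base => simp
  | succ b hb ih =>
    have := C.add_mem (ih fun i h1 h2 => h i h1 (by omega)) (h b hb (by omega))
    simpa using this

/-- A family of vectors with a dual family of functionals is linearly independent. -/
lemma linearIndependent_of_apply {M : Type*} [AddCommGroup M] [Module ℂ M] {l : ℕ}
    (f : Fin l → Module.Dual ℂ M) (H : Fin l → M)
    (h : ∀ i j, f i (H j) = if i = j then 1 else 0) : LinearIndependent ℂ f := by
  rw [Fintype.linearIndependent_iff]
  intro g hg i
  have := congrArg (fun φ : Module.Dual ℂ M => φ (H i)) hg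
  simpa [h] using this

namespace Datum

variable {N l : ℕ}

/-- The structure common to the classical families: root spaces are spanned by the matrices `F a b`
with `(a, b)` a root pair, of root `ε_a - ε_b`, and positive root vectors are upper triangular. -/
structure IsStandard (D : Datum N l) (F : Fin N → Fin N → Mat N) (κ : ℂ)
    (rp : Fin N → Fin N → Prop) : Prop where
  ne : ∀ {a b}, rp a b → a ≠ b
  symm : ∀ {a b}, rp a b → rp b a
  of_entry : ∀ {X}, X ∈ D.g → ∀ {a b}, a ≠ b → X a b ≠ 0 → rp a b
  diag_mem : ∀ {X}, X ∈ D.g → Matrix.diagonal X.diag ∈ D.g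
  star_mem : ∀ {X}, X ∈ D.g → star X ∈ D.g
  comm_mem : ∀ {X Y}, X ∈ D.g → Y ∈ D.g → X * Y - Y * X ∈ D.g
  F_mem : ∀ {a b}, rp a b → F a b ∈ D.g
  F_self : ∀ {a b}, rp a b → F a b a b ≠ 0
  F_weight : ∀ {a b}, rp a b → ∀ {H}, H ∈ D.cartan → ∀ c d, F a b c d ≠ 0 →
    H c c - H d d = H a a - H b b
  -- The constant κ is 1 when each root has one index pair (type A) and 1/2 for the form algebras,
  -- where (a, b) and (rev b, rev a) give the same root.
  decomp : ∀ {X}, X ∈ D.g → X = Matrix.diagonal X.diag +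
    κ • ∑ a, ∑ b, (if a = b then 0 else X a b) • F a b
  sep : ∀ {a b}, rp a b → ∃ H ∈ D.cartan, H a a ≠ H b b
  uniq : ∀ {a b c d}, rp a b → rp c d → (∀ H ∈ D.cartan, H a a - H b b = H c c - H d d) →
    ∃ k : ℂ, k ≠ 0 ∧ F c d = k • F a b
  e_eq : ∀ {p}, p ∈ D.pos → D.e p = F p.1 p.2
  eT_eq : ∀ {p}, p ∈ D.pos → (D.e p)ᵀ = F p.2 p.1
  pos_rp : ∀ {p}, p ∈ D.pos → rp p.1 p.2
  pos_lt : ∀ {p}, p ∈ D.pos → p.1 < p.2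
  pos_ex : ∀ {a b}, rp a b → a < b → ∃ p ∈ D.pos, ∀ H ∈ D.cartan,
    H p.1 p.1 - H p.2 p.2 = H a a - H b b
  pos_uniq : ∀ {p q}, p ∈ D.pos → q ∈ D.pos → ∀ {k : ℂ}, F p.1 p.2 = k • F q.1 q.2 → p = q
  -- The left side is what a contraction with r produces; with `lower` it turns the sum over
  -- positive roots into a triangular truncation.
  upper : ∀ {X}, X ∈ D.g →
    ∑ p ∈ D.pos, (Matrix.trace (X * (D.e p)ᵀ) / Matrix.trace (D.e p * (D.e p)ᵀ)) • D.e p =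
      Matrix.of fun a b => if a < b then X a b else 0
  lower : ∀ {X}, X ∈ D.g →
    ∑ p ∈ D.pos, (Matrix.trace (X * D.e p) / Matrix.trace (D.e p * (D.e p)ᵀ)) • (D.e p)ᵀ =
      Matrix.of fun a b => if b < a then X a b else 0
  simple_ex : ∀ i, ∃ a b, a < b ∧ rp a b ∧ D.simple i = eps D.g (a : ℕ) - eps D.g (b : ℕ)
  simple_indep : LinearIndependent ℂ D.simple
  closure_mem : ∀ {a b}, rp a b → a < b → eps D.g (a : ℕ) - eps D.g (b : ℕ) ∈
    AddSubmonoid.closure (D.simple '' ((Finset.univ : Finset (Fin l)) : Set (Fin l)))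
  grading_mem : (Matrix.diagonal fun a : Fin N => ((N : ℂ) - 1) / 2 - (a : ℕ)) ∈ D.g

variable {D : Datum N l} {F : Fin N → Fin N → Mat N} {κ : ℂ} {rp : Fin N → Fin N → Prop}

/-- Diagonal matrices act on the entry (a, b) by the scalar ε_a − ε_b, so a single nonzero entry
determines the root. -/
lemma rootSpace_entry {α : Module.Dual ℂ D.cartan} {x : Mat N} (hx : x ∈ D.rootSpace α)
    {a b : Fin N} (h : x a b ≠ 0) : α = eps D.g (a : ℕ) - eps D.g (b : ℕ) := by
  ext H
  have h1 := congrFun (congrFun (hx.2 H) a) b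
  rw [cartan_mul_sub_apply H.2, Matrix.smul_apply, smul_eq_mul] at h1
  rw [LinearMap.sub_apply, eps_apply, eps_apply]
  exact (mul_right_cancel₀ h h1).symm

lemma rootSpace_diag {α : Module.Dual ℂ D.cartan} (hα : α ≠ 0) {x : Mat N}
    (hx : x ∈ D.rootSpace α) (a : Fin N) : x a a = 0 := by
  by_contra h
  exact hα (by rw [rootSpace_entry hx h, sub_self])

namespace IsStandard

variable (hD : D.IsStandard F κ rp)
include hD

lemma F_mem_rootSpace {a b : Fin N} (h : rp a b) :
    F a b ∈ D.rootSpace (eps D.g (a : ℕ) - eps D.g (b : ℕ)) := by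
  refine ⟨hD.F_mem h, fun H => ?_⟩
  ext c d
  rw [cartan_mul_sub_apply H.2, Matrix.smul_apply, smul_eq_mul, LinearMap.sub_apply, eps_apply,
    eps_apply]
  by_cases h0 : F a b c d = 0
  · simp [h0]
  · rw [hD.F_weight h H.2 c d h0]

lemma sub_ne_zero {a b : Fin N} (h : rp a b) : eps D.g (a : ℕ) - eps D.g (b : ℕ) ≠ 0 := by
  obtain ⟨H, hH, hne⟩ := hD.sep h
  intro h0
  have := LinearMap.congr_fun h0 ⟨H, hH⟩
  rw [LinearMap.sub_apply, eps_apply, eps_apply] at this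
  exact hne (sub_eq_zero.1 this)

lemma isRoot_sub {a b : Fin N} (h : rp a b) : D.IsRoot (eps D.g (a : ℕ) - eps D.g (b : ℕ)) := by
  refine ⟨hD.sub_ne_zero h, fun h0 => hD.F_self h ?_⟩
  have := hD.F_mem_rootSpace h
  rw [h0, Submodule.mem_bot] at this
  simp [this]

lemma exists_of_isRoot {α : Module.Dual ℂ D.cartan} (hα : D.IsRoot α) :
    ∃ a b, rp a b ∧ α = eps D.g (a : ℕ) - eps D.g (b : ℕ) := by
  obtain ⟨x, hx, hx0⟩ := (Submodule.ne_bot_iff _).1 hα.2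
  obtain ⟨a, b, hab⟩ : ∃ a b, x a b ≠ 0 := by
    by_contra! h
    exact hx0 (by ext a b; exact h a b)
  have hne : a ≠ b := by
    rintro rfl
    exact hab (rootSpace_diag hα.1 hx a)
  exact ⟨a, b, hD.of_entry hx.1 hne hab, rootSpace_entry hx hab⟩

/-- All nonzero off-diagonal entries of a root vector carry the same root, and `uniq` makes the
corresponding `F c d` proportional to `F a b`. -/
lemma rootSpace_eq {a b : Fin N} (h : rp a b) :
    D.rootSpace (eps D.g (a : ℕ) - eps D.g (b : ℕ)) = ℂ ∙ F a b := by
  refine le_antisymm (fun x hx => ?_) ?_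
  · have hdiag : Matrix.diagonal x.diag = 0 := by
      ext c d
      by_cases hcd : c = d
      · subst hcd
        simpa using rootSpace_diag (hD.sub_ne_zero h) hx c
      · simp [hcd]
    rw [hD.decomp hx.1, hdiag, zero_add]
    refine Submodule.smul_mem _ _ (Submodule.sum_mem _ fun c _ => Submodule.sum_mem _ fun d _ => ?_)
    by_cases hcd : c = d
    · simp [hcd]
    by_cases h0 : x c d = 0
    · simp [h0]
    have heq := rootSpace_entry hx h0
    obtain ⟨k, -, hk⟩ := hD.uniq h (hD.of_entry hx.1 hcd h0) (fun H hH => by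
      have := LinearMap.congr_fun heq ⟨H, hH⟩
      simpa only [LinearMap.sub_apply, eps_apply] using this)
    rw [hk]
    exact Submodule.smul_mem _ _ (Submodule.smul_mem _ _ (Submodule.mem_span_singleton_self _))
  · rw [Submodule.span_singleton_le_iff_mem]
    exact hD.F_mem_rootSpace h

/-- The grading element `diag ((N-1)/2 - a)`. -/
lemma grading_mem_cartan :
    (Matrix.diagonal fun a : Fin N => ((N : ℂ) - 1) / 2 - (a : ℕ)) ∈ D.cartan :=
  diagonal_mem_cartanOf hD.grading_mem

lemma grading_nonneg {S : Finset (Fin l)} {α : Module.Dual ℂ D.cartan}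
    (hα : α ∈ AddSubmonoid.closure (D.simple '' (S : Set (Fin l)))) :
    0 ≤ (α ⟨_, hD.grading_mem_cartan⟩).re := by
  induction hα using AddSubmonoid.closure_induction with
  | mem x hx =>
    obtain ⟨i, -, rfl⟩ := hx
    obtain ⟨a, b, hab, -, h⟩ := hD.simple_ex i
    rw [h, LinearMap.sub_apply, eps_apply, eps_apply]
    have : (a : ℕ) < b := hab
    simpa using this.le
  | zero => simp
  | add x y _ _ h1 h2 => simpa using add_nonneg h1 h2

/-- The grading element takes the value b − a on ε_a − ε_b and is nonnegative on sums of simple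
roots. Positivity in terms of simple roots therefore implies upper triangularity. -/
lemma lt_of_posRoot {S : Finset (Fin l)} {a b : Fin N} (hne : a ≠ b)
    (h : eps D.g (a : ℕ) - eps D.g (b : ℕ) ∈
      AddSubmonoid.closure (D.simple '' (S : Set (Fin l)))) : a < b := by
  have := hD.grading_nonneg h
  rw [LinearMap.sub_apply, eps_apply, eps_apply] at this
  have h2 : (a : ℕ) ≤ b := by simpa using this
  exact lt_of_le_of_ne h2 hne

lemma isPosRoot_sub {a b : Fin N} (h : rp a b) (hab : a < b) :
    D.IsPosRoot Finset.univ (eps D.g (a : ℕ) - eps D.g (b : ℕ)) :=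
  ⟨hD.isRoot_sub h, hD.closure_mem h hab⟩

theorem isRootData : D.IsRootData := by
  refine ⟨fun X hX hcomm => ?_, hD.simple_indep, fun i => ?_, fun α hα => ?_, fun p hp => ?_,
    fun α hα => ?_⟩
  · refine mem_cartanOf_iff.2 ⟨hX, ?_⟩
    ext a b
    by_cases hab : a = b
    · subst hab; simp
    rw [Matrix.diagonal_apply_ne _ hab]
    by_contra h0
    obtain ⟨H, hH, hne⟩ := hD.sep (hD.of_entry hX hab h0)
    have := cartan_mul_sub_apply hH X a b
    rw [hcomm ⟨H, hH⟩, sub_self] at this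
    exact mul_ne_zero (_root_.sub_ne_zero.2 hne) h0 this.symm
  · obtain ⟨a, b, -, h, h'⟩ := hD.simple_ex i
    rw [h']
    exact hD.isRoot_sub h
  · obtain ⟨a, b, h, rfl⟩ := hD.exists_of_isRoot hα
    rcases lt_or_gt_of_ne (hD.ne h) with hab | hab
    · exact Or.inl (hD.isPosRoot_sub h hab)
    · rw [neg_sub]
      exact Or.inr (hD.isPosRoot_sub (hD.symm h) hab)
  · exact ⟨_, hD.isPosRoot_sub (hD.pos_rp hp) (hD.pos_lt hp), by
      rw [hD.rootSpace_eq (hD.pos_rp hp), hD.e_eq hp]⟩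
  · obtain ⟨a, b, h, rfl⟩ := hD.exists_of_isRoot hα.1
    obtain ⟨p, hp, hpe⟩ := hD.pos_ex h (hD.lt_of_posRoot (hD.ne h) hα.2)
    -- The pair (a, b) need not lie in `pos`; it is replaced by the chosen representative p of the
    -- same root.
    have heq : eps D.g (a : ℕ) - eps D.g (b : ℕ) = eps D.g (p.1 : ℕ) - eps D.g (p.2 : ℕ) := by
      ext H
      simp only [LinearMap.sub_apply, eps_apply]
      exact (hpe H H.2).symm
    rw [heq, neg_sub, hD.rootSpace_eq (hD.pos_rp hp), hD.rootSpace_eq (hD.symm (hD.pos_rp hp))]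
    refine ⟨p, ⟨hp, by rw [hD.e_eq hp], by rw [hD.eT_eq hp]⟩, ?_⟩
    rintro q ⟨hq, hq1, -⟩
    have : D.e q ∈ ℂ ∙ F p.1 p.2 := by
      rw [hq1]; exact Submodule.mem_span_singleton_self _
    obtain ⟨k, hk⟩ := Submodule.mem_span_singleton.1 this
    rw [hD.e_eq hq] at hk
    exact hD.pos_uniq hq hp hk.symm

end IsStandard

/-! ### Levi subalgebras as block subalgebras. -/

/-- The Levi subalgebra of `S` consists of the matrices whose off-diagonal entries satisfy `P`. -/
structure HasBlocks (D : Datum N l) (rp : Fin N → Fin N → Prop) (S : Finset (Fin l))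
    (P : Fin N → Fin N → Prop) : Prop where
  symm : ∀ {a b}, P a b → P b a
  mem : ∀ {a b}, rp a b → a < b → P a b → eps D.g (a : ℕ) - eps D.g (b : ℕ) ∈
    AddSubgroup.closure (D.simple '' (S : Set (Fin l)))
  kill : ∀ {a b}, rp a b → ¬ P a b → ∃ H : D.cartan, (∀ i ∈ S, D.simple i H = 0) ∧
    (H : Mat N) a a ≠ (H : Mat N) b b

/-- The complexification of `levi`. -/
def leviC (D : Datum N l) (S : Finset (Fin l)) : Submodule ℂ (Mat N) :=
  D.cartan ⊔ ⨆ α ∈ {α | D.IsRoot α ∧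
      α ∈ AddSubgroup.closure (D.simple '' (S : Set (Fin l)))}, D.rootSpace α

lemma apply_eq_zero_of_mem_closure {S : Finset (Fin l)} {α : Module.Dual ℂ D.cartan}
    (hα : α ∈ AddSubgroup.closure (D.simple '' (S : Set (Fin l)))) {H : D.cartan}
    (hH : ∀ i ∈ S, D.simple i H = 0) : α H = 0 := by
  induction hα using AddSubgroup.closure_induction with
  | mem x hx => obtain ⟨i, hi, rfl⟩ := hx; exact hH i hi
  | zero => simp
  | add x y _ _ h1 h2 => simp [h1, h2]
  | neg x _ h => simp [h]

namespace HasBlocks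

variable {S : Finset (Fin l)} {P : Fin N → Fin N → Prop} (hB : D.HasBlocks rp S P)
include hB

/-- The Cartan element supplied by `kill` annihilates the whole span of S but not ε_a − ε_b, unless
(a, b) lies in a block. -/
lemma of_closure {a b : Fin N} (hrp : rp a b) (h : eps D.g (a : ℕ) - eps D.g (b : ℕ) ∈
    AddSubgroup.closure (D.simple '' (S : Set (Fin l)))) : P a b := by
  by_contra hP
  obtain ⟨H, hH, hne⟩ := hB.kill hrp hP
  have := apply_eq_zero_of_mem_closure h hH
  rw [LinearMap.sub_apply, eps_apply, eps_apply] at this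
  exact hne (sub_eq_zero.1 this)

variable (hD : D.IsStandard F κ rp)
include hD

lemma mem' {a b : Fin N} (h : rp a b) (hP : P a b) : eps D.g (a : ℕ) - eps D.g (b : ℕ) ∈
    AddSubgroup.closure (D.simple '' (S : Set (Fin l))) := by
  rcases lt_or_gt_of_ne (hD.ne h) with hab | hab
  · exact hB.mem h hab hP
  · rw [← neg_sub]
    exact neg_mem (hB.mem (hD.symm h) hab (hB.symm hP))

lemma mem_leviC_iff {X : Mat N} :
    X ∈ D.leviC S ↔ X ∈ D.g ∧ ∀ a b, a ≠ b → ¬ P a b → X a b = 0 := by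
  constructor
  · let B : Submodule ℂ (Mat N) :=
      { carrier := {X | X ∈ D.g ∧ ∀ a b, a ≠ b → ¬ P a b → X a b = 0}
        zero_mem' := ⟨D.g.zero_mem, fun _ _ _ _ => rfl⟩
        add_mem' := fun hX hY => ⟨D.g.add_mem hX.1 hY.1, fun a b h h' => by
          simp [hX.2 a b h h', hY.2 a b h h']⟩
        smul_mem' := fun c X hX => ⟨D.g.smul_mem c hX.1, fun a b h h' => by
          simp [hX.2 a b h h']⟩ }
    suffices D.leviC S ≤ B from fun h => this h
    refine sup_le (fun H hH => ⟨hH.1, fun a b h _ => apply_eq_zero_of_mem_cartanOf hH h⟩)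
      (iSup₂_le fun α hα x hx => ⟨hx.1, fun a b hab hP => ?_⟩)
    by_contra h0
    have := rootSpace_entry hx h0
    exact hP (hB.of_closure (hD.of_entry hx.1 hab h0) (this ▸ hα.2))
  · rintro ⟨hX, hP⟩
    rw [hD.decomp hX]
    refine Submodule.add_mem _ (Submodule.mem_sup_left (diagonal_mem_cartanOf (hD.diag_mem hX)))
      (Submodule.mem_sup_right (Submodule.smul_mem _ _ (Submodule.sum_mem _ fun a _ =>
        Submodule.sum_mem _ fun b _ => ?_)))
    by_cases hab : a = b
    · simp [hab]
    by_cases h0 : X a b = 0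
    · simp [h0]
    have hrp := hD.of_entry hX hab h0
    have hPab : P a b := by
      by_contra h
      exact h0 (hP a b hab h)
    exact Submodule.smul_mem _ _ (Submodule.mem_iSup_of_mem _ (Submodule.mem_iSup_of_mem
      ⟨hD.isRoot_sub hrp, hB.mem' hD hrp hPab⟩ (hD.F_mem_rootSpace hrp)))

lemma levi_eq : D.levi S = blockSub D.compact P := by
  ext X
  have h1 : X ∈ D.levi S ↔ X ∈ D.leviC S ∧ X ∈ skewAdjoint.submodule ℝ (Mat N) := Iff.rfl
  have h2 : X ∈ blockSub D.compact P ↔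
    (X ∈ D.g ∧ X ∈ skewAdjoint.submodule ℝ (Mat N)) ∧ ∀ a b, a ≠ b → ¬ P a b → X a b = 0 := Iff.rfl
  rw [h1, h2, hB.mem_leviC_iff hD]
  tauto

/-- A complex subspace invariant under `levi S` is invariant under its complexification. -/
lemma apply_mem_of_levi {V : Type} [AddCommGroup V] [Module ℂ V]
    {R : Mat N →ₗ[ℂ] Module.End ℂ V} {U : Submodule ℂ V}
    (hU : ∀ X ∈ D.levi S, ∀ v ∈ U, R X v ∈ U) {X : Mat N} (hX : X ∈ D.g)
    (hP : ∀ a b, a ≠ b → ¬ P a b → X a b = 0) {v : V} (hv : v ∈ U) : R X v ∈ U := by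
  rw [hB.levi_eq hD] at hU
  have hs := hD.star_mem hX
  have hPs : ∀ a b, a ≠ b → ¬ P a b → star X a b = 0 := fun a b hab h => by
    rw [Matrix.star_apply, hP b a hab.symm (fun h' => h (hB.symm h')), star_zero]
  -- Both X − X* and i(X + X*) are skew-Hermitian, and symmetry of P keeps them in the blocks; X is
  -- a complex combination of the two.
  have h1 : X - star X ∈ blockSub D.compact P := by
    refine ⟨⟨D.g.sub_mem hX hs, ?_⟩, fun a b hab h => by simp [hP a b hab h, hPs a b hab h,
      -Matrix.star_apply]⟩
    change X - star X ∈ skewAdjoint (Mat N)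
    rw [skewAdjoint.mem_iff]
    simp
  have h2 : Complex.I • (X + star X) ∈ blockSub D.compact P := by
    refine ⟨⟨D.g.smul_mem _ (D.g.add_mem hX hs), ?_⟩, fun a b hab h => by
      simp [hP a b hab h, hPs a b hab h, -Matrix.star_apply]⟩
    change Complex.I • (X + star X) ∈ skewAdjoint (Mat N)
    rw [skewAdjoint.mem_iff]
    simp [add_comm]
  have h3 : X = (1 / 2 : ℂ) • (X - star X) + (-Complex.I / 2) • (Complex.I • (X + star X)) := by
    rw [smul_smul, show -Complex.I / 2 * Complex.I = 1 / 2 by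
      linear_combination (-1 / 2 : ℂ) * Complex.I_mul_I, ← smul_add, sub_add_add_cancel,
      ← two_smul ℂ X, smul_smul]
    norm_num
  rw [h3, map_add, map_smul, map_smul]
  exact U.add_mem (U.smul_mem _ (hU _ h1 _ hv)) (U.smul_mem _ (hU _ h2 _ hv))

end HasBlocks

end Datum

end

end HermSym

/-! ### Traces on coordinate subspaces and the block trace identity. -/

namespace HermSym

noncomputable section

open Classical in
/-- The entries of `X` on the diagonal and in the blocks `P`. -/
def blk {N : ℕ} (P : Fin N → Fin N → Prop) (X : Mat N) : Mat N :=
  Matrix.of fun a b => if a = b ∨ P a b then X a b else 0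

/-- The strictly upper triangular part minus the strictly lower triangular part. -/
def tri {N : ℕ} (X : Mat N) : Mat N :=
  (Matrix.of fun a b => if a < b then X a b else 0) - Matrix.of fun a b => if b < a then X a b else 0

open Classical in
/-- The projection to `coordSub A` as a matrix. -/
def projMat {ι : Type} [DecidableEq ι] (A : ι → Prop) : Matrix ι ι ℂ :=
  Matrix.diagonal fun a => if A a then 1 else 0

/-- The matrix of the operator `R X`. -/
def repMat {N : ℕ} {ι : Type} [Fintype ι] [DecidableEq ι]
    (R : Mat N →ₗ[ℂ] Module.End ℂ (ι → ℂ)) : Mat N →ₗ[ℂ] Matrix ι ι ℂ :=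
  (LinearMap.toMatrix' : ((ι → ℂ) →ₗ[ℂ] (ι → ℂ)) ≃ₗ[ℂ] Matrix ι ι ℂ).toLinearMap ∘ₗ R

section Trace

variable {ι : Type} [Fintype ι] [DecidableEq ι]

lemma projMat_mul_self (A : ι → Prop) : projMat A * projMat A = projMat A := by
  simp [projMat]

lemma projMat_mul_mul_projMat_apply (A : ι → Prop) (M : Matrix ι ι ℂ) (a b : ι) [Decidable (A a)]
    [Decidable (A b)] :
    (projMat A * M * projMat A) a b = if A a ∧ A b then M a b else 0 := by
  classical
  simp only [projMat, Matrix.diagonal_mul, Matrix.mul_diagonal]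
  by_cases ha : A a <;> by_cases hb : A b <;> simp [ha, hb]

lemma mul_projMat_of_invariant {A : ι → Prop} {M : Matrix ι ι ℂ}
    (h : ∀ a b, A a → ¬ A b → M b a = 0) : M * projMat A = projMat A * M * projMat A := by
  classical
  ext a b
  rw [projMat_mul_mul_projMat_apply]
  simp only [projMat, Matrix.mul_diagonal]
  by_cases ha : A a <;> by_cases hb : A b <;> simp [ha, hb]
  exact h b a hb ha

lemma projMat_mul_of_invariant {A : ι → Prop} {M : Matrix ι ι ℂ}
    (h : ∀ a b, ¬ A a → A b → M b a = 0) : projMat A * M = projMat A * M * projMat A := by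
  classical
  ext a b
  rw [projMat_mul_mul_projMat_apply]
  simp only [projMat, Matrix.diagonal_mul]
  by_cases ha : A a <;> by_cases hb : A b <;> simp [ha, hb]
  exact h b a hb ha

lemma toMatrix'_mulVec_apply (E : Module.End ℂ (ι → ℂ)) (f : ι → ℂ) :
    E f = (LinearMap.toMatrix' E).mulVec f := by
  rw [← Matrix.toLin'_apply, Matrix.toLin'_toMatrix']

lemma coordSub_invariant {A : ι → Prop} {E : Module.End ℂ (ι → ℂ)}
    (h : ∀ a b, A a → ¬ A b → LinearMap.toMatrix' E b a = 0) :
    ∀ v ∈ coordSub A, E v ∈ coordSub A := by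
  intro v hv b hb
  rw [toMatrix'_mulVec_apply, Matrix.mulVec, dotProduct]
  refine Finset.sum_eq_zero fun a _ => ?_
  by_cases ha : A a
  · rw [h a b ha hb, zero_mul]
  · rw [hv a ha, mul_zero]

/-- The restriction of E factors as retraction after E after inclusion. Cyclicity of the trace moves
the retraction to the right, where it combines with the inclusion to the projection matrix. -/
lemma traceOn_coordSub {A : ι → Prop} {E : Module.End ℂ (ι → ℂ)}
    (h : ∀ v ∈ coordSub A, E v ∈ coordSub A) :
    traceOn (coordSub A) E = Matrix.trace (LinearMap.toMatrix' E * projMat A) := by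
  classical
  rw [traceOn, dif_pos h]
  let q : (ι → ℂ) →ₗ[ℂ] coordSub A :=
    LinearMap.codRestrict (coordSub A) (Matrix.toLin' (projMat A)) (fun f a ha => by
      simp [projMat, Matrix.mulVec_diagonal, ha])
  have hq : q ∘ₗ (coordSub A).subtype = LinearMap.id := by
    ext f a
    by_cases ha : A a
    · simp [q, projMat, Matrix.mulVec_diagonal, ha]
    · simp [q, projMat, Matrix.mulVec_diagonal, ha, f.2 a ha]
  have hq' : (coordSub A).subtype ∘ₗ q = Matrix.toLin' (projMat A) := rfl
  have h1 : E.restrict h = q ∘ₗ (E ∘ₗ (coordSub A).subtype) := by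
    have : E ∘ₗ (coordSub A).subtype = (coordSub A).subtype ∘ₗ E.restrict h := rfl
    rw [this, ← LinearMap.comp_assoc, hq, LinearMap.id_comp]
  rw [h1, LinearMap.trace_comp_comm', LinearMap.comp_assoc, hq',
    LinearMap.trace_eq_matrix_trace ℂ (Pi.basisFun ℂ ι)]
  change Matrix.trace (LinearMap.toMatrix' (E ∘ₗ Matrix.toLin' (projMat A))) = _
  rw [LinearMap.toMatrix'_comp, LinearMap.toMatrix'_toLin']

/-- Lets the trace of a power on an invariant subspace be computed from the compression QMQ. The
exponent must be positive, since for r = 0 the two sides are Q and 1. -/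
lemma pow_mul_projMat {Q M : Matrix ι ι ℂ} (hQ : Q * Q = Q) (h : M * Q = Q * M * Q) {r : ℕ}
    (hr : 1 ≤ r) : M ^ r * Q = (Q * M * Q) ^ r := by
  induction r, hr using Nat.le_induction with
  | base => rw [pow_one, pow_one, h]
  | succ r hr ih =>
    rw [pow_succ, pow_succ, ← ih, mul_assoc, h]
    simp only [mul_assoc]
    rw [← mul_assoc Q Q, hQ]

-- The derivative of a noncommutative power is a sum of r words with B in different places; the
-- trace makes all of them equal. The norm on matrices serves only to differentiate.
attribute [local instance] Matrix.linftyOpNormedRing Matrix.linftyOpNormedAlgebra in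
lemma hasDerivAt_trace_pow (M B : Matrix ι ι ℂ) (r : ℕ) :
    HasDerivAt (fun t : ℝ => Matrix.trace ((M + (t : ℂ) • B) ^ r))
      (r * Matrix.trace (M ^ (r - 1) * B)) 0 := by
  have h1 : HasDerivAt (fun t : ℝ => M + (t : ℂ) • B) B 0 := by
    have : HasDerivAt (fun t : ℝ => (t : ℂ) • B) ((1 : ℂ) • B) 0 :=
      (Complex.ofRealCLM.hasDerivAt (x := (0 : ℝ))).smul_const B
    rw [one_smul] at this
    exact this.const_add M
  have h2 := h1.fun_pow' r
  let L : Matrix ι ι ℂ →L[ℝ] ℂ :=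
    LinearMap.toContinuousLinearMap ((Matrix.traceLinearMap ι ℂ ℂ).restrictScalars ℝ)
  have h3 := L.hasFDerivAt.comp_hasDerivAt (0 : ℝ) h2
  refine h3.congr_deriv ?_
  change Matrix.trace _ = _
  rw [Matrix.trace_sum]
  have : ∀ i ∈ Finset.range r, Matrix.trace ((M + ((0 : ℝ) : ℂ) • B) ^ (r.pred - i) * B *
      (M + ((0 : ℝ) : ℂ) • B) ^ i) = Matrix.trace (M ^ (r - 1) * B) := by
    intro i hi
    rw [Complex.ofReal_zero, zero_smul, add_zero, Matrix.trace_mul_comm, ← mul_assoc, ← pow_add]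
    congr 3
    have := Finset.mem_range.1 hi
    simp only [Nat.pred_eq_sub_one]
    omega
  rw [Finset.sum_congr rfl this]
  simp

lemma trace_pow_mul_comm (M x : Matrix ι ι ℂ) (s : ℕ) :
    Matrix.trace (M ^ s * (x * M - M * x)) = 0 := by
  rw [mul_sub, Matrix.trace_sub, ← mul_assoc, Matrix.trace_mul_comm, ← mul_assoc, ← mul_assoc,
    ← pow_succ', ← pow_succ, sub_self]

/-- The trace identity behind the Nijenhuis formula. -/
lemma trace_commutator_identity {Q h u d V m : Matrix ι ι ℂ} {t : ℂ} (hQ : Q * Q = Q)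
    (hu : (h + u) * Q = Q * (h + u) * Q) (hd : Q * (h + d) = Q * (h + d) * Q)
    (hh : h * Q = Q * h * Q) (hh' : Q * h = Q * h * Q) (hV : V = h + u + d)
    (hm : V * m + m * V = t • V) (s : ℕ) :
    Matrix.trace ((Q * m * Q) ^ s * (Q * ((u - d) * m - m * (u - d)) * Q)) =
      t * Matrix.trace ((Q * m * Q) ^ s * (Q * V * Q)) -
        2 * Matrix.trace ((Q * m * Q) ^ (s + 1) * (Q * V * Q)) := by
  have hu' : u * Q = Q * u * Q := by
    rw [add_mul, mul_add, add_mul, ← hh] at hu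
    exact add_left_cancel hu
  have hd' : Q * d = Q * d * Q := by
    rw [mul_add, add_mul, ← hh'] at hd
    exact add_left_cancel hd
  -- In the row Q the diagonal part and d are already compressed, so the off-diagonal block of u
  -- there is that of V. Dually, `e2` recovers the off-diagonal block of d in the column Q.
  have e1 : Q * u = Q * V - Q * V * Q + Q * u * Q := by
    rw [hV]
    simp only [mul_add, add_mul]
    rw [← hh', ← hd']
    abel
  have e2 : d * Q = V * Q - Q * V * Q + Q * d * Q := by
    rw [hV]
    simp only [mul_add, add_mul]
    rw [← hh, ← hu']
    abel
  -- The off-diagonal contributions of u and d add up, despite the sign, to Q(Vm + mV)Q minus its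
  -- compressed counterpart; `hm` turns the first into a multiple of QVQ.
  have key : Q * ((u - d) * m - m * (u - d)) * Q =
      ((Q * (u - d) * Q) * (Q * m * Q) - (Q * m * Q) * (Q * (u - d) * Q)) + t • (Q * V * Q) -
        (Q * V * Q * (Q * m * Q) + Q * m * Q * (Q * V * Q)) := by
    have hQQ : ∀ x : Matrix ι ι ℂ, Q * (Q * x) = Q * x := fun x => by rw [← mul_assoc, hQ]
    have l : Q * ((u - d) * m - m * (u - d)) * Q =
        (Q * u) * m * Q - (Q * d) * m * Q - Q * m * (u * Q) + Q * m * (d * Q) := by noncomm_ring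
    have ht : t • (Q * V * Q) = Q * V * m * Q + Q * m * (V * Q) := by
      rw [← smul_mul_assoc, ← mul_smul_comm, ← hm]; noncomm_ring
    rw [l, e1, e2, hd', hu', ht]
    simp only [mul_add, add_mul, mul_sub, sub_mul, mul_assoc, hQ, hQQ]
    abel
  rw [key, mul_sub, mul_add, Matrix.trace_sub, Matrix.trace_add, trace_pow_mul_comm, mul_add,
    Matrix.trace_add, ← mul_assoc _ (Q * V * Q) (Q * m * Q), Matrix.trace_mul_comm _ (Q * m * Q),
    ← mul_assoc _ (Q * m * Q) (Q * V * Q), ← mul_assoc _ _ (Q * V * Q), ← pow_succ', ← pow_succ,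
    mul_smul_comm, Matrix.trace_smul, smul_eq_mul]
  ring

end Trace

section Compact

variable {N : ℕ}

open scoped ComplexOrder in
-- For skew-Hermitian Y, tr(YY) = −tr(Y*Y), so definiteness applies. This yields uniqueness of the
-- orthogonal projection below.
lemma eq_zero_of_skew_trace {Y : Mat N} (hY : star Y = -Y) (h : Matrix.trace (Y * Y) = 0) :
    Y = 0 := by
  rw [← Matrix.trace_conjTranspose_mul_self_eq_zero_iff]
  rw [Matrix.star_eq_conjTranspose] at hY
  rw [hY, neg_mul, Matrix.trace_neg, h, neg_zero]

end Compact

/-! ### The Nijenhuis tensor and the recursion for trace polynomials. -/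

namespace Datum

variable {N l : ℕ} {D : Datum N l} {F : Fin N → Fin N → Mat N} {κ : ℂ}
  {rp : Fin N → Fin N → Prop}

lemma mem_compact {X : Mat N} : X ∈ D.compact ↔ X ∈ D.g ∧ star X = -X := Iff.rfl

lemma mem_blockSub {P : Fin N → Fin N → Prop} {X : Mat N} {L : Submodule ℝ (Mat N)} :
    X ∈ blockSub L P ↔ X ∈ L ∧ ∀ a b, a ≠ b → ¬ P a b → X a b = 0 := Iff.rfl

lemma comm_mem_compact (hD : D.IsStandard F κ rp) {X Y : Mat N} (hX : X ∈ D.compact)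
    (hY : Y ∈ D.compact) : X * Y - Y * X ∈ D.compact := by
  refine mem_compact.2 ⟨hD.comm_mem hX.1 hY.1, ?_⟩
  rw [star_sub, star_mul, star_mul, (mem_compact.1 hX).2, (mem_compact.1 hY).2]
  noncomm_ring

/-- Truncation to the blocks satisfies the defining orthogonality. The projection is defined by a
choice, and two candidates differ by a skew-Hermitian matrix orthogonal to itself, hence agree. -/
lemma orthProj_eq {P : Fin N → Fin N → Prop} (hP : ∀ {a b}, P a b → P b a)
    (hPg : ∀ X ∈ D.g, blk P X ∈ D.g) {X : Mat N} (hX : X ∈ D.compact) :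
    orthProj (blockSub D.compact P) X = blk P X := by
  have hmem : blk P X ∈ blockSub D.compact P := by
    refine mem_blockSub.2 ⟨mem_compact.2 ⟨hPg X hX.1, ?_⟩, fun a b hab h => by simp [blk, hab, h]⟩
    ext a b
    have := congrFun (congrFun (mem_compact.1 hX).2 a) b
    rw [Matrix.star_apply, Matrix.neg_apply] at this
    by_cases hab : a = b
    · subst hab; simp [blk, this]
    · by_cases h : P a b
      · simp [blk, h, hP h, this]
      · simp [blk, h, mt hP h, hab, Ne.symm hab]
  have horth : ∀ Z ∈ blockSub D.compact P, Matrix.trace ((X - blk P X) * Z) = 0 := by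
    intro Z hZ
    rw [Matrix.trace]
    refine Finset.sum_eq_zero fun a _ => ?_
    rw [Matrix.diag_apply, Matrix.mul_apply]
    refine Finset.sum_eq_zero fun b _ => ?_
    by_cases hab : a = b ∨ P a b
    · simp [blk, hab]
    · push Not at hab
      rw [(mem_blockSub.1 hZ).2 b a hab.1.symm (fun h => hab.2 (hP h)), mul_zero]
  have hex : ∃ Y ∈ blockSub D.compact P, ∀ Z ∈ blockSub D.compact P,
    Matrix.trace ((X - Y) * Z) = 0 := ⟨_, hmem, horth⟩
  rw [orthProj, dif_pos hex]
  obtain ⟨h1, h2⟩ := hex.choose_spec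
  have hd := (blockSub D.compact P).sub_mem hmem h1
  refine (sub_eq_zero.1 (eq_zero_of_skew_trace (mem_compact.1 hd.1).2 ?_)).symm
  have h3 := h2 _ hd
  have h4 := horth _ hd
  rw [show blk P X - hex.choose = (X - hex.choose) - (X - blk P X) by abel, sub_mul,
    Matrix.trace_sub]
  rw [show (X - hex.choose) - (X - blk P X) = blk P X - hex.choose by abel, h3, h4, sub_zero]

section Nijenhuis

variable (hD : D.IsStandard F κ rp)
include hD

lemma e_mem {p : Fin N × Fin N} (hp : p ∈ D.pos) : D.e p ∈ D.g := by
  rw [hD.e_eq hp]; exact hD.F_mem (hD.pos_rp hp)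

lemma eT_mem {p : Fin N × Fin N} (hp : p ∈ D.pos) : (D.e p)ᵀ ∈ D.g := by
  rw [hD.eT_eq hp]; exact hD.F_mem (hD.symm (hD.pos_rp hp))

lemma upper_mem {X : Mat N} (hX : X ∈ D.g) :
    (Matrix.of fun a b => if a < b then X a b else 0) ∈ D.g := by
  rw [← hD.upper hX]
  exact Submodule.sum_mem _ fun p hp => Submodule.smul_mem _ _ (e_mem hD hp)

lemma lower_mem {X : Mat N} (hX : X ∈ D.g) :
    (Matrix.of fun a b => if b < a then X a b else 0) ∈ D.g := by
  rw [← hD.lower hX]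
  exact Submodule.sum_mem _ fun p hp => Submodule.smul_mem _ _ (eT_mem hD hp)

/-- Taking adjoints exchanges the two triangular parts and conjugates i; the two signs combine to
skewness. This keeps N v inside the compact algebra. -/
lemma I_smul_tri_mem {X : Mat N} (hX : X ∈ D.compact) : Complex.I • tri X ∈ D.compact := by
  refine mem_compact.2 ⟨D.g.smul_mem _ (D.g.sub_mem (upper_mem hD hX.1) (lower_mem hD hX.1)), ?_⟩
  ext a b
  have := congrFun (congrFun (mem_compact.1 hX).2 a) b
  rw [Matrix.star_apply, Matrix.neg_apply] at this
  simp only [tri, Matrix.star_apply, Matrix.smul_apply, Matrix.sub_apply, Matrix.of_apply,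
    Matrix.neg_apply, smul_eq_mul, star_mul', star_sub, apply_ite star, star_zero, this]
  rcases lt_trichotomy a b with h | h | h
  · simp [h, h.not_gt]
  · simp [h]
  · simp [h, h.not_gt]

/-- After conjugation by a, the coefficients are trace pairings of a*[X, μ]a with the root vectors,
so `upper` and `lower` reassemble them into `tri`. The result depends on X only through [X, μ]. -/
lemma rSharp_form {c : ℝ} (hc : c ≠ 0) {a μ X : Mat N} (ha' : a * star a = 1)
    (hv : star a * (X * μ - μ * X) * a ∈ D.g) :
    D.rSharp c a μ (form c X) =
      a * (Complex.I • (tri (star a * (X * μ - μ * X) * a) * (star a * μ * a) -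
        (star a * μ * a) * tri (star a * (X * μ - μ * X) * a))) * star a := by
  set v := X * μ - μ * X with hvdef
  -- Invariance of the trace form moves the bracket with μ from the root vector to X, at the price
  -- of a sign.
  have hβ : ∀ E : Mat N, form c X (a * E * star a * μ - μ * (a * E * star a)) =
      -(c * Matrix.trace (star a * v * a * E)) := by
    intro E
    have h1 : Matrix.trace (X * (a * E * star a * μ - μ * (a * E * star a))) =
        -Matrix.trace (v * (a * E * star a)) := by
      rw [hvdef, mul_sub, sub_mul, Matrix.trace_sub, Matrix.trace_sub, ← mul_assoc X _ μ,
        Matrix.trace_mul_comm (X * (a * E * star a)) μ]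
      simp only [mul_assoc]
      ring
    have h2 : Matrix.trace (star a * v * a * E) = Matrix.trace (v * (a * E * star a)) := by
      rw [mul_assoc (star a * v), mul_assoc (star a), Matrix.trace_mul_comm (star a)]
      simp only [mul_assoc]
    rw [form, h1, h2]
    ring
  have hx : ∀ E : Mat N, a * E * star a * μ - μ * (a * E * star a) =
      a * (E * (star a * μ * a) - (star a * μ * a) * E) * star a := by
    intro E
    have h1 : a * (E * (star a * μ * a) - (star a * μ * a) * E) * star a =
      a * E * star a * μ * (a * star a) - (a * star a) * μ * (a * E * star a) := by noncomm_ring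
    rw [h1, ha', mul_one, one_mul]
  rw [rSharp]
  simp only [hβ]
  simp only [hx]
  rw [tri, ← hD.upper hv, ← hD.lower hv]
  set v' := star a * v * a
  set μ' := star a * μ * a
  rw [← Finset.sum_sub_distrib]
  simp only [Finset.sum_mul, Finset.mul_sum]
  rw [← Finset.sum_sub_distrib, Finset.smul_sum, Finset.mul_sum, Finset.sum_mul]
  refine Finset.sum_congr rfl fun p hp => ?_
  have hc' : (c : ℂ) ≠ 0 := by exact_mod_cast hc
  simp only [form]
  -- The normalisation c of the invariant form cancels between r and ω. For t = 0 both sides are 0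
  -- by the convention for division.
  have k1 : ∀ t T : ℂ, Complex.I / (c * t) * (c * T) = Complex.I * (T / t) := by
    intro t T
    by_cases ht : t = 0
    · simp [ht]
    · field_simp
  rw [smul_sub, smul_smul, smul_smul, mul_neg, mul_neg, k1, k1]
  simp only [sub_mul, mul_sub, smul_mul_assoc, mul_smul_comm, smul_sub, neg_smul, smul_smul]
  abel

/-- Bracketing with ρ multiplies the entry (a, b) by ρ_b − ρ_a, which is 0 or −i above the diagonal
and 0 or i below it. The sign in `tri` and the prefactor i compensate exactly where the factor is
nonzero, and where it vanishes so does the entry of [X, ρ]. -/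
lemma tri_commutator_of_noncompact {ρ X : Mat N} (hρ : ρ ∈ D.cartan)
    (hroot : ∀ a b, rp a b → a < b → ρ a a - ρ b b = 0 ∨ ρ a a - ρ b b = Complex.I)
    (hX : X ∈ D.g) :
    Complex.I • (tri (X * ρ - ρ * X) * ρ - ρ * tri (X * ρ - ρ * X)) = X * ρ - ρ * X := by
  ext a b
  have h1 : ∀ Y : Mat N, ∀ a b, (Y * ρ - ρ * Y) a b = (ρ b b - ρ a a) * Y a b := by
    intro Y a b
    have := cartan_mul_sub_apply hρ Y a b
    rw [← neg_sub, Matrix.neg_apply, this]; ring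
  rw [Matrix.smul_apply, h1, h1, smul_eq_mul, tri, Matrix.sub_apply, Matrix.of_apply,
    Matrix.of_apply, h1]
  by_cases h0 : X a b = 0
  · simp [h0]
  rcases lt_trichotomy a b with h | h | h
  · simp only [h, if_true, h.not_gt, if_false, sub_zero]
    rcases hroot a b (hD.of_entry hX h.ne h0) h with h2 | h2
    · rw [show ρ b b - ρ a a = 0 by linear_combination -h2]; ring
    · rw [show ρ b b - ρ a a = -Complex.I by linear_combination -h2]
      linear_combination (Complex.I * X a b) * Complex.I_mul_I
  · subst h; simp
  · simp only [h, if_true, h.not_gt, if_false, zero_sub]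
    rcases hroot b a (hD.symm (hD.of_entry hX h.ne' h0)) h with h2 | h2
    · rw [h2]; ring
    · rw [h2]
      linear_combination (-Complex.I * X a b) * (Complex.I_mul_I)

/-- The left-translated half of the bivector, seen at ρ, is the identity by
`tri_commutator_of_noncompact`; only the right-translated half sees the triangular structure at μ.
-/
theorem nijenhuis_eq {c : ℝ} (hc : c ≠ 0) {ρ : Mat N} (hρ : ρ ∈ D.cartan) (hρc : ρ ∈ D.compact)
    (hroot : ∀ a b, rp a b → a < b → ρ a a - ρ b b = 0 ∨ ρ a a - ρ b b = Complex.I)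
    {k : Mat N} (hk : star k * k = 1) (hk' : k * star k = 1)
    (hkg : ∀ X ∈ D.g, k * X * star k ∈ D.g) (hkg' : ∀ X ∈ D.g, star k * X * k ∈ D.g)
    {v : Mat N} (hv : v ∈ D.tangent (k * ρ * star k)) :
    D.nijenhuis c ρ k v =
      v - Complex.I • (tri v * (k * ρ * star k) - (k * ρ * star k) * tri v) := by
  set μ := k * ρ * star k with hμ
  have hμg : μ ∈ D.g := hkg _ hρc.1
  -- The form ω is defined through some X with [X, μ] = v; the choice is harmless because only v
  -- survives in `rSharp_form`.
  have hex : ∃ X ∈ D.compact, X * μ - μ * X = v := hv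
  obtain ⟨hX, hXv⟩ := hex.choose_spec
  have hkks : D.kks c μ v = form c hex.choose := by
    funext w
    rw [kks, dif_pos hex]
  set X := hex.choose
  have hρk : star k * μ * k = ρ := by
    rw [hμ, show star k * (k * ρ * star k) * k = (star k * k) * ρ * (star k * k) by noncomm_ring,
      hk, one_mul, mul_one]
  have hvk : star k * v * k = (star k * X * k) * ρ - ρ * (star k * X * k) := by
    rw [← hXv, ← hρk, show star k * X * k * (star k * μ * k) - star k * μ * k * (star k * X * k) =
      star k * X * (k * star k) * μ * k - star k * μ * (k * star k) * X * k by noncomm_ring, hk']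
    noncomm_ring
  have hvg : v ∈ D.g := by rw [← hXv]; exact hD.comm_mem hX.1 hμg
  rw [nijenhuis, bruhat, hkks, rSharp_form hD hc hk' (by rw [hXv]; exact hkg' _ hvg),
    rSharp_form hD hc (by simp) (by rw [hXv]; simpa using hvg), hXv, hρk, hvk,
    tri_commutator_of_noncompact hD hρ hroot (hkg' _ hX.1), ← hvk,
    show k * (star k * v * k) * star k = (k * star k) * v * (k * star k) by noncomm_ring, hk']
  simp only [one_mul, mul_one, star_one, ← hμ]

/-- The common source of all four recursions. The relation `hquad` expresses the two eigenvalues λ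
and λ − i; `hinv` and `hcomp` replace the projection to the subalgebra by a compression to W; `hup`
and `hlow` are the block triangularity required by `trace_commutator_identity`. -/
theorem nijenhuisFormula_of_quadratic {c : ℝ} (hc : c ≠ 0) {ρ : Mat N} (hρ : ρ ∈ D.cartan)
    (hρc : ρ ∈ D.compact)
    (hroot : ∀ a b, rp a b → a < b → ρ a a - ρ b b = 0 ∨ ρ a a - ρ b b = Complex.I)
    (hK : ∀ k ∈ D.K, star k * k = 1 ∧ k * star k = 1 ∧ (∀ X ∈ D.g, k * X * star k ∈ D.g) ∧
      ∀ X ∈ D.g, star k * X * k ∈ D.g)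
    {ι : Type} [Fintype ι] [DecidableEq ι] {R : Mat N →ₗ[ℂ] Module.End ℂ (ι → ℂ)}
    (hR : D.IsRep R) {lam : ℂ}
    (hquad : ∀ k ∈ D.K, repMat R (k * ρ * star k) * repMat R (k * ρ * star k) =
      (2 * lam - Complex.I) • repMat R (k * ρ * star k) - (lam * (lam - Complex.I)) • 1)
    {P : Fin N → Fin N → Prop} (hP : ∀ {a b}, P a b → P b a) (hPg : ∀ X ∈ D.g, blk P X ∈ D.g)
    {A : ι → Prop} (hinv : ∀ X ∈ D.g, ∀ x y, A x → ¬ A y → repMat R (blk P X) y x = 0)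
    (hcomp : ∀ X ∈ D.g, ∀ x y, A x → A y → repMat R (blk P X) y x = repMat R X y x)
    (hup : ∀ X ∈ D.g, (∀ a b, b < a → X a b = 0) → ∀ x y, A x → ¬ A y → repMat R X y x = 0)
    (hlow : ∀ X ∈ D.g, (∀ a b, a < b → X a b = 0) → ∀ x y, ¬ A x → A y → repMat R X y x = 0) :
    NijenhuisFormula D c ρ R (blockSub D.compact P) (coordSub A) (-2 * Complex.I * lam) := by
  intro r hr k hk v hv
  obtain ⟨hk1, hk2, hkg, hkg'⟩ := hK k hk
  set μ := k * ρ * star k with hμ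
  have hμc : μ ∈ D.compact := by
    refine mem_compact.2 ⟨hkg _ hρc.1, ?_⟩
    rw [hμ, star_mul, star_mul, star_star, (mem_compact.1 hρc).2]
    noncomm_ring
  obtain ⟨X, hX, hXv⟩ : ∃ X ∈ D.compact, X * μ - μ * X = v := hv
  have hvc : v ∈ D.compact := hXv ▸ comm_mem_compact hD hX hμc
  set T := repMat R with hT
  have hTmul : ∀ X ∈ D.g, ∀ Y ∈ D.g, T (X * Y - Y * X) = T X * T Y - T Y * T X := by
    intro X hX Y hY
    change LinearMap.toMatrix' (R _) = LinearMap.toMatrix' (R X) * LinearMap.toMatrix' (R Y) -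
      LinearMap.toMatrix' (R Y) * LinearMap.toMatrix' (R X)
    rw [hR X hX Y hY, map_sub, LinearMap.toMatrix'_mul, LinearMap.toMatrix'_mul]
  set Q := projMat A with hQdef
  have hQ : Q * Q = Q := projMat_mul_self A
  -- The projection to the subalgebra disappears: the polynomial depends only on the compression of
  -- T(X) itself, which is linear in X and easy to differentiate.
  have hf : ∀ s : ℕ, 1 ≤ s → ∀ X ∈ D.compact,
      invPoly R (blockSub D.compact P) (coordSub A) s X =
        Complex.I ^ s / s * Matrix.trace ((Q * T X * Q) ^ s) := by
    intro s hs X hX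
    have h1 : ∀ x y, A x → ¬ A y → LinearMap.toMatrix' (R (blk P X)) y x = 0 := hinv X hX.1
    have h2 := coordSub_invariant h1
    have h3 : ∀ v ∈ coordSub A, (R (blk P X) ^ s) v ∈ coordSub A := by
      intro v hv
      clear hs
      induction s generalizing v with
      | zero => simpa using hv
      | succ s ih => rw [pow_succ]; exact ih _ (h2 v hv)
    rw [invPoly, orthProj_eq hP hPg hX, traceOn_coordSub h3,
      show LinearMap.toMatrix' (R (blk P X) ^ s) = LinearMap.toMatrix' (R (blk P X)) ^ s from
        map_pow LinearMap.toMatrixAlgEquiv' _ _,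
      pow_mul_projMat hQ (mul_projMat_of_invariant h1) hs]
    congr 3
    classical
    ext x y
    rw [projMat_mul_mul_projMat_apply, projMat_mul_mul_projMat_apply]
    split_ifs with hxy
    · exact hcomp X hX.1 y x hxy.2 hxy.1
    · rfl
  have hd : ∀ s : ℕ, 1 ≤ s → ∀ w ∈ D.compact,
      dAt ρ k (invPoly R (blockSub D.compact P) (coordSub A) s) w =
        Complex.I ^ s * Matrix.trace ((Q * T μ * Q) ^ (s - 1) * (Q * T w * Q)) := by
    intro s hs w hw
    have h1 : ∀ t : ℝ, invPoly R (blockSub D.compact P) (coordSub A) s (μ + t • w) =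
        Complex.I ^ s / s * Matrix.trace ((Q * T μ * Q + (t : ℂ) • (Q * T w * Q)) ^ s) := by
      intro t
      rw [hf s hs _ (D.compact.add_mem hμc (D.compact.smul_mem t hw)), ← Complex.coe_smul t w,
        map_add, map_smul, mul_add, add_mul, mul_smul_comm, smul_mul_assoc]
    rw [dAt, lineDeriv]
    simp only [← hμ, h1]
    rw [((hasDerivAt_trace_pow (Q * T μ * Q) (Q * T w * Q) s).const_mul _).deriv]
    have : (s : ℂ) ≠ 0 := by exact_mod_cast (by omega : s ≠ 0)
    field_simp
  have hN := nijenhuis_eq hD hc hρ hρc hroot hk1 hk2 hkg hkg' (v := v) ⟨X, hX, hXv⟩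
  rw [← hμ] at hN
  have hNc : v - Complex.I • (tri v * μ - μ * tri v) ∈ D.compact := by
    have := comm_mem_compact hD (I_smul_tri_mem hD hvc) hμc
    rw [smul_mul_assoc, mul_smul_comm, ← smul_sub] at this
    exact D.compact.sub_mem hvc this
  rw [dNAt, hN, hd r hr _ hNc, hd r hr _ hvc, hd (r + 1) (by omega) _ hvc, Nat.add_sub_cancel]
  -- the three triangular parts of `v`
  set h := Matrix.diagonal v.diag with hh
  set u : Mat N := Matrix.of fun a b => if a < b then v a b else 0 with hu
  set d : Mat N := Matrix.of fun a b => if b < a then v a b else 0 with hdd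
  have hhg : h ∈ D.g := hD.diag_mem hvc.1
  have hug : u ∈ D.g := upper_mem hD hvc.1
  have hdg : d ∈ D.g := lower_mem hD hvc.1
  have hsum : v = h + u + d := by
    ext a b
    rcases lt_trichotomy a b with hab | hab | hab
    · simp [h, u, d, hab, hab.not_gt, hab.ne]
    · simp [h, u, d, hab]
    · simp [h, u, d, hab, hab.not_gt, hab.ne']
  have hdiag : ∀ a b, a ≠ b → h a b = 0 := fun a b hab => Matrix.diagonal_apply_ne _ hab
  have hTv : T v = T X * T μ - T μ * T X := by rw [← hXv, hTmul X hX.1 μ hμc.1]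
  -- The commutator of T(X) with the quadratic equation of T(μ); the scalar term drops out.
  have hanti : T v * T μ + T μ * T v = (2 * lam - Complex.I) • T v := by
    have e : T v * T μ + T μ * T v = T X * (T μ * T μ) - (T μ * T μ) * T X := by
      rw [hTv]; noncomm_ring
    rw [e, hquad k hk, hTv, mul_sub, sub_mul, mul_smul_comm, mul_smul_comm, smul_mul_assoc,
      smul_mul_assoc, mul_one, one_mul, smul_sub]
    abel
  have hid := trace_commutator_identity (Q := Q) (h := T h) (u := T u) (d := T d) (V := T v)
    (m := T μ) (t := 2 * lam - Complex.I) hQ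
    (by rw [← map_add]
        exact mul_projMat_of_invariant (hup _ (D.g.add_mem hhg hug) fun a b hab => by
          rw [Matrix.add_apply, hdiag a b hab.ne']; simp [u, hab.not_gt]))
    (by rw [← map_add]
        exact projMat_mul_of_invariant (hlow _ (D.g.add_mem hhg hdg) fun a b hab => by
          rw [Matrix.add_apply, hdiag a b hab.ne]; simp [d, hab.not_gt]))
    (mul_projMat_of_invariant (hup _ hhg fun a b hab => hdiag a b hab.ne'))
    (projMat_mul_of_invariant (hlow _ hhg fun a b hab => hdiag a b hab.ne))
    (by rw [← map_add, ← map_add, ← hsum]) hanti (r - 1)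
  have htri : T (tri v * μ - μ * tri v) = (T u - T d) * T μ - T μ * (T u - T d) := by
    change T ((u - d) * μ - μ * (u - d)) = _
    rw [hTmul _ (D.g.sub_mem hug hdg) _ hμc.1]
    rw [map_sub]
  rw [map_sub, map_smul, htri, mul_sub, sub_mul, mul_smul_comm, smul_mul_assoc, mul_sub,
    Matrix.trace_sub, mul_smul_comm, Matrix.trace_smul, smul_eq_mul, hid, Nat.sub_add_cancel hr,
    pow_succ]
  -- The coefficients are 1 − i(2λ − i) = −2iλ for dI_r, and 2i · i^r = 2 i^(r+1) for the next
  -- differential.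
  linear_combination (Complex.I ^ r *
    Matrix.trace ((Q * T μ * Q) ^ (r - 1) * (Q * T v * Q))) * Complex.I_mul_I

end Nijenhuis

end Datum

end

end HermSym

/-! ### Noncompactness, irreducibility and minimality in a weight basis. -/

namespace HermSym

noncomputable section

namespace Datum

variable {N l : ℕ} {D : Datum N l} {F : Fin N → Fin N → Mat N} {κ : ℂ}
  {rp : Fin N → Fin N → Prop} {S S' : Finset (Fin l)} {P : Fin N → Fin N → Prop}

/-- Noncompactness is read off from the eigenvalues of the central generator. -/
theorem isNoncompact_of_rho (hD : D.IsStandard F κ rp) (hB : D.HasBlocks rp S P) {ρ : D.cartan}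
    (h0 : ∀ i ∈ S', D.simple i ρ = 0) (h1 : ∀ i ∈ S \ S', D.simple i ρ = Complex.I)
    (hroot : ∀ a b, rp a b → P a b → (ρ : Mat N) a a - (ρ : Mat N) b b = 0 ∨
      (ρ : Mat N) a a - (ρ : Mat N) b b = Complex.I ∨
      (ρ : Mat N) a a - (ρ : Mat N) b b = -Complex.I) : D.IsNoncompact S S' := by
  intro c hc hr
  obtain ⟨a, b, hab, heq⟩ := hD.exists_of_isRoot hr
  have hmem : ∑ i, c i • D.simple i ∈
      AddSubgroup.closure (D.simple '' (S : Set (Fin l))) := by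
    refine sum_mem fun i _ => ?_
    by_cases hi : i ∈ S
    · exact nsmul_mem (AddSubgroup.subset_closure (Set.mem_image_of_mem _ hi)) _
    · rw [hc i hi, zero_smul]; exact zero_mem _
  have hP := hB.of_closure hab (heq ▸ hmem)
  -- Evaluation at ρ counts the total coefficient of the removed roots, in units of i; the values
  -- allowed by `hroot` then exclude a count of 2 or more.
  have h2 : (∑ i, c i • D.simple i) ρ = ((∑ i ∈ S \ S', c i : ℕ) : ℂ) * Complex.I := by
    rw [LinearMap.sum_apply, Nat.cast_sum, Finset.sum_mul]
    refine (Finset.sum_subset (Finset.subset_univ (S \ S')) fun i _ hi => ?_).symm.trans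
      (Finset.sum_congr rfl fun i hi => ?_)
    · by_cases hS : i ∈ S
      · have : i ∈ S' := by
          by_contra h
          exact hi (Finset.mem_sdiff.2 ⟨hS, h⟩)
        simp [h0 i this]
      · simp [hc i hS]
    · simp [h1 i hi]
  rw [heq, LinearMap.sub_apply, eps_apply, eps_apply] at h2
  have h3 := hroot a b hab hP
  rw [h2] at h3
  by_contra! hlt
  generalize (∑ i ∈ S \ S', c i) = n at *
  have h4 : (2 : ℝ) ≤ n := by exact_mod_cast hlt
  rcases h3 with h | h | h
  · have := congrArg Complex.im h; simp at this; linarith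
  · have := congrArg Complex.im h; simp at this; linarith
  · have := congrArg Complex.im h; simp at this; linarith

lemma single_mem_coordSub {ι : Type} [DecidableEq ι] {A : ι → Prop} {x : ι} (hx : A x) : (Pi.single x 1 : ι → ℂ) ∈ coordSub A :=
  fun y hy => Pi.single_eq_of_ne (fun h : y = x => hy (h ▸ hx)) _

section Irreducible

variable {ι : Type} [Fintype ι] [DecidableEq ι] {R : Mat N →ₗ[ℂ] Module.End ℂ (ι → ℂ)}
  {wt : Mat N → ι → ℂ} {A : ι → Prop}

lemma apply_eq_repMat (X : Mat N) (f : ι → ℂ) : R X f = (repMat R X).mulVec f :=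
  toMatrix'_mulVec_apply (R X) f

lemma apply_single (X : Mat N) (x y : ι) : R X (Pi.single x 1) y = repMat R X y x := by
  rw [apply_eq_repMat, Matrix.mulVec_single_one, Matrix.col_apply]

lemma apply_of_weight (hwt : ∀ H ∈ D.cartan, repMat R H = Matrix.diagonal (wt H)) {H : Mat N}
    (hH : H ∈ D.cartan) (f : ι → ℂ) (x : ι) : R H f x = wt H x * f x := by
  rw [apply_eq_repMat, hwt H hH, Matrix.mulVec_diagonal]

/-- The entry from `x` to `y` of some block matrix is nonzero. -/
def Edge (D : Datum N l) (P : Fin N → Fin N → Prop) (R : Mat N →ₗ[ℂ] Module.End ℂ (ι → ℂ))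
    (x y : ι) : Prop :=
  ∃ X ∈ D.g, (∀ a b, a ≠ b → ¬ P a b → X a b = 0) ∧ repMat R X y x ≠ 0

/-- By `hsep` all weights on W are distinct, so a nonzero submodule contains a basis vector. By
`hconn` every basis vector leads to a0 and a0 leads to every other, through nonzero matrix entries.
-/
theorem isIrred_coordSub (hD : D.IsStandard F κ rp) (hB : D.HasBlocks rp S P)
    (hwt : ∀ H ∈ D.cartan, repMat R H = Matrix.diagonal (wt H)) {a0 : ι} (ha0 : A a0)
    (hinv : ∀ X ∈ D.g, (∀ a b, a ≠ b → ¬ P a b → X a b = 0) → ∀ x y, A x → ¬ A y →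
      repMat R X y x = 0)
    (hsep : ∀ x y, A x → A y → x ≠ y → ∃ H ∈ D.cartan, wt H x ≠ wt H y)
    (hconn : ∀ x, A x → Relation.ReflTransGen (D.Edge P R) a0 x ∧
      Relation.ReflTransGen (D.Edge P R) x a0) :
    IsIrred R (D.levi S) (coordSub A) := by
  refine ⟨?_, ?_, ?_⟩
  · refine (Submodule.ne_bot_iff _).2 ⟨Pi.single a0 1, single_mem_coordSub ha0, by simp⟩
  · intro X hX
    rw [hB.levi_eq hD] at hX
    exact coordSub_invariant (hinv X hX.1.1 hX.2)
  · intro U hU hinvU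
    by_cases hbot : U = ⊥
    · exact Or.inl hbot
    refine Or.inr (le_antisymm hU ?_)
    have hR : ∀ X ∈ D.g, (∀ a b, a ≠ b → ¬ P a b → X a b = 0) → ∀ v ∈ U, R X v ∈ U :=
      fun X hX hP v hv => hB.apply_mem_of_levi hD hinvU hX hP hv
    have hsingle : ∀ u ∈ U, ∀ x, u x ≠ 0 → Pi.single x 1 ∈ U := by
      intro u hu x hx
      have hAx : A x := by
        by_contra h
        exact hx (hU hu x h)
      -- Coordinates are removed one at a time: (H − wt_y)/(wt_x − wt_y) kills the coordinate y,
      -- keeps the coordinate x, and creates no new ones.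
      have : ∀ s : Finset ι, ∃ u' ∈ U, u' x = u x ∧ ∀ y ∈ s, y ≠ x → u' y = 0 := by
        intro s
        induction s using Finset.induction_on with
        | empty => exact ⟨u, hu, rfl, by simp⟩
        | insert y s _ ih =>
          obtain ⟨u', hu', h1, h2⟩ := ih
          by_cases hyx : y = x
          · refine ⟨u', hu', h1, fun z hz hzx => ?_⟩
            rcases Finset.mem_insert.1 hz with rfl | hz
            · exact absurd hyx hzx
            · exact h2 z hz hzx
          by_cases hAy : A y
          · obtain ⟨H, hH, hne⟩ := hsep x y hAx hAy (Ne.symm hyx)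
            have hne' := sub_ne_zero.2 hne
            refine ⟨(wt H x - wt H y)⁻¹ • (R H u' - wt H y • u'), U.smul_mem _ (U.sub_mem
              (hR H hH.1 (fun a b hab _ => apply_eq_zero_of_mem_cartanOf hH hab) u' hu')
              (U.smul_mem _ hu')), ?_, fun z hz hzx => ?_⟩
            · rw [Pi.smul_apply, Pi.sub_apply, apply_of_weight hwt hH, Pi.smul_apply, smul_eq_mul,
                smul_eq_mul, ← sub_mul, inv_mul_cancel_left₀ hne', h1]
            · rw [Pi.smul_apply, Pi.sub_apply, apply_of_weight hwt hH, Pi.smul_apply, smul_eq_mul,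
                smul_eq_mul, ← sub_mul]
              rcases Finset.mem_insert.1 hz with rfl | hz
              · simp
              · simp [h2 z hz hzx]
          · refine ⟨u', hu', h1, fun z hz hzx => ?_⟩
            rcases Finset.mem_insert.1 hz with rfl | hz
            · exact hU hu' _ hAy
            · exact h2 z hz hzx
      obtain ⟨u', hu', h1, h2⟩ := this Finset.univ
      have : Pi.single x 1 = (u x)⁻¹ • u' := by
        ext y
        by_cases hy : y = x
        · subst hy; simp [h1, hx]
        · simp [hy, h2 y (Finset.mem_univ _) hy]
      rw [this]
      exact U.smul_mem _ hu'
    have hedge : ∀ x y, Relation.ReflTransGen (D.Edge P R) x y → Pi.single x 1 ∈ U →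
        Pi.single y (1 : ℂ) ∈ U := by
      intro x y hxy hx
      induction hxy with
      | refl => exact hx
      | tail _ h ih =>
        obtain ⟨X, hX, hP, hne⟩ := h
        refine hsingle _ (hR X hX hP _ ih) _ ?_
        rwa [apply_single]
    obtain ⟨u, hu, hu0⟩ := (Submodule.ne_bot_iff _).1 hbot
    obtain ⟨x, hx⟩ := Function.ne_iff.1 hu0
    have hAx : A x := by
      by_contra h
      exact hx (hU hu x h)
    have ha : Pi.single a0 (1 : ℂ) ∈ U := hedge _ _ (hconn x hAx).2 (hsingle u hu x hx)
    intro f hf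
    rw [pi_eq_sum_univ' f]
    refine Submodule.sum_mem _ fun z _ => ?_
    by_cases hz : A z
    · refine U.smul_mem _ ?_
      have := hedge _ _ (hconn z hz).1 ha
      convert this using 1
    · rw [hf z hz, zero_smul]; exact U.zero_mem

/-- Since `wt ρ` takes the values λ and λ − i on `Ap` and `Am`, the eigenspaces are coordinate
subspaces. The basis vector at a0 is a highest weight vector because its grading weight is maximal
on W. -/
theorem isMinimal_coordSub (hD : D.IsStandard F κ rp) (hB : D.HasBlocks rp S P)
    (hR : D.IsRep R) (hwt : ∀ H ∈ D.cartan, repMat R H = Matrix.diagonal (wt H)) {ρ : Mat N}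
    (hρ : ρ ∈ D.cartan) (hgen : D.IsCentralGenerator S S' ⟨ρ, hρ⟩) {Ap Am : ι → Prop} {lam : ℂ}
    (hW : IsIrred R (D.levi S) (coordSub A)) (hVp : IsIrred R (D.levi S') (coordSub Ap))
    (hsplit : ∀ x, A x ↔ Ap x ∨ Am x) (hp : ∀ x, Ap x → wt ρ x = lam)
    (hm : ∀ x, Am x → wt ρ x = lam - Complex.I) (hne : ∃ x, Am x) {a0 : ι} (ha0 : A a0)
    (ha0' : wt ρ a0 = lam)
    (hmax : ∀ x, A x →
      (wt (Matrix.diagonal fun a : Fin N => ((N : ℂ) - 1) / 2 - (a : ℕ)) x).re ≤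
      (wt (Matrix.diagonal fun a : Fin N => ((N : ℂ) - 1) / 2 - (a : ℕ)) a0).re) :
    D.IsMinimal R S S' ρ lam (coordSub A) (coordSub Ap) (coordSub Am) := by
  have hpm : ∀ x, Ap x → Am x → False := fun x h1 h2 => by
    have := (hp x h1).symm.trans (hm x h2)
    exact Complex.I_ne_zero (by linear_combination this)
  have heig : ∀ (f : ι → ℂ) (t : ℂ), f ∈ Module.End.eigenspace (R ρ) t ↔
      ∀ x, (wt ρ x - t) * f x = 0 := by
    intro f t
    rw [Module.End.mem_eigenspace_iff, funext_iff]
    refine forall_congr' fun x => ?_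
    rw [apply_of_weight hwt hρ, Pi.smul_apply, smul_eq_mul, sub_mul, sub_eq_zero]
  refine ⟨hρ, hgen, hW, ?_, ?_, ?_, ?_, ?_, hVp⟩
  -- Since `wt` is only a function, Λ is built as a composite of linear maps: the a0-coordinate of
  -- R(H) applied to the basis vector.
  · refine ⟨LinearMap.proj a0 ∘ₗ LinearMap.applyₗ (Pi.single a0 1) ∘ₗ R ∘ₗ D.cartan.subtype,
      ?_, Pi.single a0 1, single_mem_coordSub ha0, by simp, ?_, ?_⟩
    · change R ρ (Pi.single a0 1) a0 = lam
      rw [apply_of_weight hwt hρ, ha0', Pi.single_eq_same, mul_one]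
    · intro H
      ext x
      change _ = R (H : Mat N) (Pi.single a0 1) a0 * _
      rw [apply_of_weight hwt H.2, apply_of_weight hwt H.2]
      by_cases hx : x = a0
      · subst hx; simp
      · simp [hx]
    · intro α hα x hx
      obtain ⟨a, b, hab, rfl⟩ := hD.exists_of_isRoot hα.1
      have hlt := hD.lt_of_posRoot (hD.ne hab) hα.2
      have hle : AddSubmonoid.closure (D.simple '' (S : Set (Fin l))) ≤
          (AddSubgroup.closure (D.simple '' (S : Set (Fin l)))).toAddSubmonoid :=
        AddSubmonoid.closure_le.2 AddSubgroup.subset_closure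
      have hxl : x ∈ D.leviC S := Submodule.mem_sup_right (Submodule.mem_iSup_of_mem _
        (Submodule.mem_iSup_of_mem ⟨hα.1, hle hα.2⟩ hx))
      obtain ⟨hxg, hxP⟩ := (hB.mem_leviC_iff hD).1 hxl
      have hmem : R x (Pi.single a0 1) ∈ coordSub A := hB.apply_mem_of_levi hD hW.2.1 hxg hxP
        (single_mem_coordSub ha0)
      -- A positive root vector raises the grading by b − a > 0, so a nonzero coordinate y of its
      -- image would exceed the maximum at a0.
      set H0 : Mat N := Matrix.diagonal fun a : Fin N => ((N : ℂ) - 1) / 2 - (a : ℕ) with hH0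
      have hH := hD.grading_mem_cartan
      have h1 := hx.2 ⟨H0, hH⟩
      have h2 : R (H0 * x - x * H0) = R H0 * R x - R x * R H0 := hR _ hH.1 _ hxg
      rw [h1, LinearMap.sub_apply, eps_apply, eps_apply, map_smul] at h2
      ext y
      by_contra hy
      have hAy : A y := by
        by_contra h
        exact hy (hmem y h)
      have h3 := congrFun (LinearMap.congr_fun h2 (Pi.single a0 1)) y
      rw [LinearMap.smul_apply, Pi.smul_apply, LinearMap.sub_apply, Pi.sub_apply,
        Module.End.mul_apply, Module.End.mul_apply, apply_of_weight hwt hH,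
        show R H0 (Pi.single a0 1) = wt H0 a0 • Pi.single a0 1 by
          ext z
          rw [apply_of_weight hwt hH]
          by_cases hz : z = a0
          · subst hz; simp [← hH0]
          · simp [hz],
        map_smul, Pi.smul_apply, smul_eq_mul, smul_eq_mul, ← sub_mul] at h3
      have h4 := congrArg Complex.re (mul_right_cancel₀ hy h3)
      have h5 := hmax y hAy
      have h6 : (a : ℝ) < b := by exact_mod_cast hlt
      simp only [hH0, Matrix.diagonal_apply_eq, Complex.sub_re, Complex.natCast_re] at h4 h5
      linarith
  · ext f
    rw [Submodule.mem_inf, heig]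
    refine ⟨fun hf => ⟨fun x hx => hf x fun h => hx ((hsplit x).2 (Or.inl h)), fun x => ?_⟩,
      fun ⟨h1, h2⟩ x hx => ?_⟩
    · by_cases hx : Ap x
      · rw [hp x hx, sub_self, zero_mul]
      · rw [hf x hx, mul_zero]
    · by_cases hAx : A x
      · have hxm := ((hsplit x).1 hAx).resolve_left hx
        have := h2 x
        rw [hm x hxm, sub_sub_cancel_left] at this
        simpa using this
      · exact h1 x hAx
  · ext f
    rw [Submodule.mem_inf, heig]
    refine ⟨fun hf => ⟨fun x hx => hf x fun h => hx ((hsplit x).2 (Or.inr h)), fun x => ?_⟩,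
      fun ⟨h1, h2⟩ x hx => ?_⟩
    · by_cases hx : Am x
      · rw [hm x hx, sub_self, zero_mul]
      · rw [hf x hx, mul_zero]
    · by_cases hAx : A x
      · have hxm := ((hsplit x).1 hAx).resolve_right hx
        have := h2 x
        rw [hp x hxm, sub_sub_cancel] at this
        simpa using this
      · exact h1 x hAx
  · classical
    ext f
    rw [Submodule.mem_sup]
    constructor
    · intro hf
      refine ⟨fun x => if Ap x then f x else 0, fun x hx => if_neg hx,
        fun x => if Ap x then 0 else f x, fun x hx => ?_, ?_⟩
      · by_cases h : Ap x
        · exact if_pos h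
        · exact (if_neg h).trans (hf x fun hA => ((hsplit x).1 hA).elim h hx)
      · ext x
        by_cases h : Ap x <;> simp [h]
    · rintro ⟨f1, h1, f2, h2, rfl⟩ x hx
      rw [Pi.add_apply, h1 x fun h => hx ((hsplit x).2 (Or.inl h)),
        h2 x fun h => hx ((hsplit x).2 (Or.inr h)), add_zero]
  · obtain ⟨x, hx⟩ := hne
    exact (Submodule.ne_bot_iff _).2 ⟨Pi.single x 1, single_mem_coordSub hx, by simp⟩

end Irreducible

/-! ### The fundamental representation. -/

section Fundamental

variable {A : Fin N → Prop}

@[simp] lemma repMat_fund (X : Mat N) : repMat (fund N) X = X := by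
  simp [repMat, fund]

lemma isRep_fund : D.IsRep (fund N) := by
  intro X _ Y _
  simp [fund, Matrix.toLin'_mul, Module.End.mul_eq_comp]

lemma fund_weight : ∀ H ∈ D.cartan, repMat (fund N) H = Matrix.diagonal H.diag := fun H hH => by
  rw [repMat_fund]
  exact (mem_cartanOf_iff.1 hH).2

lemma HasBlocks.edge_fund (hD : D.IsStandard F κ rp) (hB : D.HasBlocks rp S P) {a b : Fin N}
    (h : rp b a) (hP : P b a) : D.Edge P (fund N) a b := by
  have hmem : F b a ∈ D.leviC S := Submodule.mem_sup_right (Submodule.mem_iSup_of_mem _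
    (Submodule.mem_iSup_of_mem ⟨hD.isRoot_sub h, hB.mem' hD h hP⟩ (hD.F_mem_rootSpace h)))
  refine ⟨F b a, hD.F_mem h, ((hB.mem_leviC_iff hD).1 hmem).2, ?_⟩
  rw [repMat_fund]
  exact hD.F_self h

lemma isIrred_fund (hD : D.IsStandard F κ rp) (hB : D.HasBlocks rp S P) {a0 : Fin N} (ha0 : A a0)
    (hinv : ∀ x y, P y x → A x → A y)
    (hconn : ∀ x, A x → Relation.ReflTransGen (D.Edge P (fund N)) a0 x ∧
      Relation.ReflTransGen (D.Edge P (fund N)) x a0) :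
    IsIrred (fund N) (D.levi S) (coordSub A) := by
  refine isIrred_coordSub hD hB fund_weight ha0 (fun X _ hP x y hx hy => ?_)
    (fun x y _ _ hxy => ⟨_, hD.grading_mem_cartan, ?_⟩) hconn
  · rw [repMat_fund]
    exact hP y x (fun h => hy (h ▸ hx)) fun h => hy (hinv x y h hx)
  · intro h
    simp only [Matrix.diag_diagonal] at h
    have : ((x : ℕ) : ℂ) = (y : ℕ) := by linear_combination -h
    exact hxy (Fin.ext (by exact_mod_cast this))

lemma isIrred_fund_of_complete (hD : D.IsStandard F κ rp) (hB : D.HasBlocks rp S P) {a0 : Fin N}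
    (ha0 : A a0) (hinv : ∀ x y, P y x → A x → A y)
    (hc : ∀ x y, A x → A y → x ≠ y → rp x y ∧ P x y) :
    IsIrred (fund N) (D.levi S) (coordSub A) := by
  refine isIrred_fund hD hB ha0 hinv fun x hx => ?_
  by_cases h : x = a0
  · subst h; exact ⟨Relation.ReflTransGen.refl, Relation.ReflTransGen.refl⟩
  · have h1 := hc x a0 hx ha0 h
    have h2 := hc a0 x ha0 hx (Ne.symm h)
    exact ⟨Relation.ReflTransGen.single (hB.edge_fund hD h1.1 h1.2),
      Relation.ReflTransGen.single (hB.edge_fund hD h2.1 h2.2)⟩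

lemma isMinimal_fund (hD : D.IsStandard F κ rp) (hB : D.HasBlocks rp S P) {ρ : Mat N}
    (hρ : ρ ∈ D.cartan) (hgen : D.IsCentralGenerator S S' ⟨ρ, hρ⟩) {Ap Am : Fin N → Prop} {lam : ℂ}
    (hW : IsIrred (fund N) (D.levi S) (coordSub A))
    (hVp : IsIrred (fund N) (D.levi S') (coordSub Ap))
    (hsplit : ∀ x, A x ↔ Ap x ∨ Am x) (hp : ∀ x, Ap x → ρ x x = lam)
    (hm : ∀ x, Am x → ρ x x = lam - Complex.I) (hne : ∃ x, Am x) {a0 : Fin N} (ha0 : Ap a0)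
    (hmax : (a0 : ℕ) = 0) :
    D.IsMinimal (fund N) S S' ρ lam (coordSub A) (coordSub Ap) (coordSub Am) := by
  refine isMinimal_coordSub hD hB isRep_fund fund_weight hρ hgen hW hVp hsplit hp hm hne
    ((hsplit a0).2 (Or.inl ha0)) (hp a0 ha0) fun x _ => ?_
  simp [hmax]

/-- The index set A is an initial segment by `hinit`, which is why upper triangular matrices
preserve its span. The two diagonal values of ρ give the quadratic relation, and it survives
conjugation by K. -/
lemma nijenhuisFormula_fund (hD : D.IsStandard F κ rp) {c : ℝ} (hc : c ≠ 0) {ρ : Mat N}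
    (hρ : ρ ∈ D.cartan) (hρc : ρ ∈ D.compact)
    (hroot : ∀ a b, rp a b → a < b → ρ a a - ρ b b = 0 ∨ ρ a a - ρ b b = Complex.I)
    (hK : ∀ k ∈ D.K, star k * k = 1 ∧ k * star k = 1 ∧ (∀ X ∈ D.g, k * X * star k ∈ D.g) ∧
      ∀ X ∈ D.g, star k * X * k ∈ D.g) {lam : ℂ}
    (hquad : ∀ a, ρ a a = lam ∨ ρ a a = lam - Complex.I)
    (hP : ∀ {a b}, P a b → P b a) (hPg : ∀ X ∈ D.g, blk P X ∈ D.g)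
    (hinv : ∀ x y, P y x → A x → A y) (hfull : ∀ x y, A x → A y → x ≠ y → P y x)
    (hinit : ∀ x y, y < x → A x → A y) :
    NijenhuisFormula D c ρ (fund N) (blockSub D.compact P) (coordSub A) (-2 * Complex.I * lam) := by
  refine nijenhuisFormula_of_quadratic hD hc hρ hρc hroot hK isRep_fund (fun k hk => ?_) hP hPg
    (fun X _ x y hx hy => ?_) (fun X _ x y hx hy => ?_) (fun X _ h x y hx hy => ?_)
    (fun X _ h x y hx hy => ?_)
  · obtain ⟨h1, h2, -⟩ := hK k hk
    have hsq : ρ * ρ = (2 * lam - Complex.I) • ρ - (lam * (lam - Complex.I)) • 1 := by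
      rw [(mem_cartanOf_iff.1 hρ).2, Matrix.diagonal_mul_diagonal]
      ext a b
      by_cases hab : a = b
      · subst hab
        simp only [Matrix.diagonal_apply_eq, Matrix.diag_apply, Matrix.sub_apply,
          Matrix.smul_apply, smul_eq_mul, Matrix.one_apply_eq]
        rcases hquad a with h | h <;> rw [h] <;> ring
      · simp [hab]
    rw [repMat_fund, show k * ρ * star k * (k * ρ * star k) = k * ρ * (star k * k) * ρ * star k by
      noncomm_ring, h1, mul_one, mul_assoc k, hsq, mul_sub, sub_mul, mul_smul_comm, mul_smul_comm,
      smul_mul_assoc, smul_mul_assoc, mul_one, h2]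
  · rw [repMat_fund]
    have : ¬ (y = x ∨ P y x) := fun h => h.elim (fun h => hy (h ▸ hx)) fun h => hy (hinv x y h hx)
    simp [blk, this]
  · rw [repMat_fund, repMat_fund]
    by_cases hxy : x = y
    · simp [blk, hxy]
    · simp [blk, hfull x y hx hy hxy]
  · rw [repMat_fund]
    rcases lt_trichotomy x y with hxy | hxy | hxy
    · exact h y x hxy
    · exact absurd (hxy ▸ hx) hy
    · exact absurd (hinit x y hxy hx) hy
  · rw [repMat_fund]
    rcases lt_trichotomy x y with hxy | hxy | hxy
    · exact absurd (hinit y x hxy hy) hx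
    · exact absurd (hxy ▸ hy) hx
    · exact h y x hxy

end Fundamental

end Datum

end

end HermSym

/-! ### Type A: SU(n) and the Gelfand–Tsetlin chain. -/

namespace HermSym

noncomputable section

lemma eps_nat {N : ℕ} {g : Submodule ℂ (Mat N)} {a : ℕ} (h : a < N) (H : cartanOf g) :
    eps g a H = (H : Mat N) ⟨a, h⟩ ⟨a, h⟩ := by
  simp [eps, h]

lemma grading_rev {N : ℕ} (a : Fin N) :
    ((N : ℂ) - 1) / 2 - (a.rev : ℕ) = -(((N : ℂ) - 1) / 2 - (a : ℕ)) := by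
  have : ((a.rev : ℕ) : ℂ) + (a : ℕ) + 1 = N := by
    have h : (a.rev : ℕ) + a + 1 = N := by rw [Fin.val_rev]; omega
    exact_mod_cast h
  linear_combination -this

lemma sum_val_lt {n s : ℕ} (h : s ≤ n) (x : ℂ) :
    ∑ a : Fin n, (if (a : ℕ) < s then x else 0) = s * x := by
  rw [← Finset.sum_filter, Finset.sum_const, Fin.card_filter_val_lt, min_eq_right h, nsmul_eq_mul]

lemma trace_diagonal_mul {N : ℕ} (d : Fin N → ℂ) (H : Mat N) :
    Matrix.trace (Matrix.diagonal d * H) = ∑ a, d a * H a a := by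
  simp [Matrix.trace, Matrix.diagonal_mul]

lemma const_of_consecutive {f : ℕ → ℂ} {s : ℕ} (h : ∀ j, j + 1 < s → f j = f (j + 1)) :
    ∀ a, a < s → f a = f 0 := by
  intro a
  induction a with
  | zero => intro _; rfl
  | succ a ih => intro ha; rw [← h a ha, ih (by omega)]

lemma star_diagonal_of_skew {N : ℕ} {d : Fin N → ℂ} (h : ∀ a, star (d a) = -d a) :
    star (Matrix.diagonal d : Mat N) = -Matrix.diagonal d := by
  ext a b
  by_cases hab : a = b
  · subst hab
    simpa using h a
  · simp [hab, Ne.symm hab]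

namespace Datum

variable {N l : ℕ} {D : Datum N l} {F : Fin N → Fin N → Mat N} {κ : ℂ}
  {rp : Fin N → Fin N → Prop}

theorem isThimmChain_of_blocks (hD : D.IsStandard F κ rp) {n : ℕ} {S : ℕ → Finset (Fin l)}
    {k : ℕ → Submodule ℝ (Mat N)} {P : ℕ → Fin N → Fin N → Prop} (h0 : S 0 = Finset.univ)
    (hk0 : k 0 = D.compact) (hn : S n = ∅) (hB : ∀ i ≤ n, D.HasBlocks rp (S i) (P i))
    (hk : ∀ i ≤ n, k i = blockSub D.compact (P i))
    (hstep : ∀ i < n, S (i + 1) ⊂ S i ∧ D.IsNoncompact (S i) (S (i + 1))) :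
    D.IsThimmChain n S k :=
  ⟨h0, hk0, hn, fun i hi => by rw [hk i hi, (hB i hi).levi_eq hD], hstep⟩

lemma blockSub_eq_self {L : Submodule ℝ (Mat N)} {P : Fin N → Fin N → Prop} (h : ∀ a b, P a b) :
    blockSub L P = L := by
  ext X
  rw [mem_blockSub]
  exact ⟨And.left, fun hX => ⟨hX, fun a b _ hP => absurd (h a b) hP⟩⟩

lemma coordSub_eq_top {ι : Type} {A : ι → Prop} (h : ∀ a, A a) : coordSub A = ⊤ :=
  eq_top_iff.2 fun _ _ a ha => absurd (h a) ha

end Datum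

open Datum

section TypeA

variable {n : ℕ}

lemma mem_typeA {X : Mat n} : X ∈ (typeA n).g ↔ Matrix.trace X = 0 := Iff.rfl

lemma typeA_single_sub_mem (a b : Fin n) :
    Matrix.single a a (1 : ℂ) - Matrix.single b b 1 ∈ (typeA n).cartan := by
  refine mem_cartanOf_iff.2 ⟨mem_typeA.2 (by simp [Matrix.trace_single_eq_same]), ?_⟩
  ext c d
  by_cases h : c = d
  · subst h; rw [Matrix.diagonal_apply_eq, Matrix.diag_apply]
  · rw [Matrix.diagonal_apply_ne _ h, Matrix.sub_apply, Matrix.single_apply, Matrix.single_apply]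
    grind

lemma typeA_diagonal_mem {d : Fin n → ℂ} (h : ∑ a, d a = 0) :
    Matrix.diagonal d ∈ (typeA n).cartan :=
  diagonal_mem_cartanOf (mem_typeA.2 (by simpa [Matrix.trace_diagonal] using h))

lemma typeA_simple_apply (i : Fin (n - 1)) (H : (typeA n).cartan) :
    (typeA n).simple i H = (H : Mat n) ⟨i, by omega⟩ ⟨i, by omega⟩ -
      (H : Mat n) ⟨i + 1, by omega⟩ ⟨i + 1, by omega⟩ := by
  change (eps (typeA n).g (i : ℕ) - eps (typeA n).g ((i : ℕ) + 1)) H = _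
  rw [LinearMap.sub_apply, eps_nat (by omega), eps_nat (by omega)]

lemma typeA_consecutive {a b : Fin n} (hab : a < b)
    (C : AddSubmonoid (Module.Dual ℂ (typeA n).cartan))
    (h : ∀ j : Fin (n - 1), (a : ℕ) ≤ j → (j : ℕ) < b → (typeA n).simple j ∈ C) :
    eps (typeA n).g (a : ℕ) - eps (typeA n).g (b : ℕ) ∈ C := by
  have : (a : ℕ) < b := hab
  exact sub_mem_of_consecutive C (fun j => eps (typeA n).g j) this.le
    fun j h1 h2 => h ⟨j, by omega⟩ h1 h2

theorem typeA_isStandard : (typeA n).IsStandard (fun a b => Matrix.single a b 1) 1 (· ≠ ·) where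
  ne h := h
  symm h := Ne.symm h
  of_entry _ _ _ h _ := h
  diag_mem hX := mem_typeA.2 (by rw [Matrix.trace_diagonal]; exact mem_typeA.1 hX)
  star_mem hX := mem_typeA.2 (by
    rw [Matrix.star_eq_conjTranspose, Matrix.trace_conjTranspose, mem_typeA.1 hX, star_zero])
  comm_mem _ _ := mem_typeA.2 (by rw [Matrix.trace_sub, Matrix.trace_mul_comm, sub_self])
  F_mem h := mem_typeA.2 (Matrix.trace_single_eq_of_ne _ _ _ h)
  F_self _ := by simp
  F_weight _ _ _ c d h := by
    rw [Matrix.single_apply] at h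
    obtain ⟨rfl, rfl⟩ : _ ∧ _ := by by_contra h'; exact h (if_neg h')
    rfl
  decomp {X} _ := by
    rw [one_smul]
    ext c d
    simp only [Matrix.add_apply, Matrix.sum_apply, Matrix.smul_apply, Matrix.single_apply,
      smul_eq_mul, mul_ite, mul_one, mul_zero]
    rw [Finset.sum_eq_single c, Finset.sum_eq_single d]
    · by_cases h : c = d
      · subst h; simp
      · simp [h]
    · intro b _ hb; simp [hb]
    · simp
    · intro a _ ha; simp [ha]
    · simp
  sep {a b} h := ⟨_, typeA_single_sub_mem a b, by
    simp [Ne.symm h, h]; norm_num⟩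
  uniq {a b c d} hab hcd h := by
    have := h _ (typeA_single_sub_mem a b)
    simp only [Matrix.sub_apply, Matrix.single_apply] at this
    have hac : a = c := by
      by_contra h1
      simp [h1, hab, Ne.symm hab] at this
      split_ifs at this <;> norm_num at this
    subst hac
    have hbd : b = d := by
      by_contra h1
      simp [hab, hcd, h1, Ne.symm hab] at this
    subst hbd
    exact ⟨1, one_ne_zero, by simp⟩
  e_eq _ := rfl
  eT_eq _ := Matrix.transpose_single _ _ _
  pos_rp hp := (Finset.mem_filter.1 hp).2.ne
  pos_lt hp := (Finset.mem_filter.1 hp).2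
  pos_ex {a b} _ hab := ⟨(a, b), Finset.mem_filter.2 ⟨Finset.mem_univ _, hab⟩, fun _ _ => rfl⟩
  pos_uniq {p q} _ _ k h := by
    have := congrFun (congrFun h p.1) p.2
    simp only [Matrix.single_apply, Matrix.smul_apply] at this
    by_contra hne
    have h' : ¬ (q.1 = p.1 ∧ q.2 = p.2) := fun h => hne (Prod.ext h.1.symm h.2.symm)
    simp [h'] at this
  upper {X} _ := by
    ext c d
    have he : ∀ p, (typeA n).e p = Matrix.single p.1 p.2 1 := fun _ => rfl
    simp only [Matrix.sum_apply, Matrix.smul_apply, he, Matrix.transpose_single, Matrix.of_apply,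
      Matrix.single_mul_single_same, Matrix.trace_single_eq_same, Matrix.trace_mul_single,
      smul_eq_mul]
    change ∑ p ∈ Finset.univ.filter (fun p : Fin n × Fin n => p.1 < p.2), _ = _
    rw [Finset.sum_filter, Finset.sum_eq_single (c, d)]
    · by_cases h : c < d <;> simp [h]
    · intro p _ hp
      have h' : ¬ (p.1 = c ∧ p.2 = d) := fun h => hp (Prod.ext h.1 h.2)
      simp [h']
    · simp
  lower {X} _ := by
    ext c d
    have he : ∀ p, (typeA n).e p = Matrix.single p.1 p.2 1 := fun _ => rfl
    simp only [Matrix.sum_apply, Matrix.smul_apply, he, Matrix.transpose_single, Matrix.of_apply,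
      Matrix.single_mul_single_same, Matrix.trace_single_eq_same, Matrix.trace_mul_single,
      smul_eq_mul]
    change ∑ p ∈ Finset.univ.filter (fun p : Fin n × Fin n => p.1 < p.2), _ = _
    rw [Finset.sum_filter, Finset.sum_eq_single (d, c)]
    · by_cases h : d < c <;> simp [h]
    · intro p _ hp
      have h' : ¬ (p.2 = c ∧ p.1 = d) := fun h => hp (Prod.ext h.2 h.1)
      simp [h']
    · simp
  simple_ex i := ⟨⟨i, by omega⟩, ⟨i + 1, by omega⟩, by simp [Fin.lt_def], by simp, rfl⟩
  simple_indep := by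
    -- The dual family consists of the fundamental coweights: the indicator of the first j + 1
    -- indices, made traceless.
    have hsum : ∀ j : Fin (n - 1),
        ∑ a : Fin n, ((if (a : ℕ) < j + 1 then (1 : ℂ) else 0) - ((j : ℕ) + 1) / n) = 0 := by
      intro j
      have hj : (j : ℕ) + 1 ≤ n := by omega
      rw [Finset.sum_sub_distrib, sum_val_lt hj]
      have : (n : ℂ) ≠ 0 := by exact_mod_cast (by omega : n ≠ 0)
      simp
      field_simp
      simp
    refine linearIndependent_of_apply _ (fun j => ⟨_, typeA_diagonal_mem (hsum j)⟩) fun i j => ?_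
    rw [typeA_simple_apply]
    simp only [Matrix.diagonal_apply_eq, Fin.ext_iff]
    by_cases h1 : (i : ℕ) < j
    · simp [h1, h1.ne, (by omega : (i : ℕ) < j + 1)]
    · by_cases h2 : (i : ℕ) = j
      · simp [h2]
      · simp [h1, h2]
        omega
  closure_mem {a b} _ hab := typeA_consecutive hab _ fun j _ _ =>
    AddSubmonoid.subset_closure ⟨j, by simp, rfl⟩
  grading_mem := mem_typeA.2 (by
    rw [Matrix.trace_diagonal]
    have h := Equiv.sum_comp (Fin.revPerm (n := n)) fun a : Fin n => ((n : ℂ) - 1) / 2 - (a : ℕ)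
    simp only [Fin.revPerm_apply, grading_rev, Finset.sum_neg_distrib] at h
    linear_combination (-1 / 2 : ℂ) * h)

lemma typeA_conj : ∀ k ∈ (typeA n).K, star k * k = 1 ∧ k * star k = 1 ∧
    (∀ X ∈ (typeA n).g, k * X * star k ∈ (typeA n).g) ∧
    ∀ X ∈ (typeA n).g, star k * X * k ∈ (typeA n).g := by
  intro k hk
  have hu := (Matrix.mem_specialUnitaryGroup_iff.1 hk).1
  have h1 := Matrix.mem_unitaryGroup_iff'.1 hu
  have h2 := Matrix.mem_unitaryGroup_iff.1 hu
  refine ⟨h1, h2, fun X hX => mem_typeA.2 ?_, fun X hX => mem_typeA.2 ?_⟩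
  · rw [Matrix.trace_mul_comm, ← mul_assoc, h1, one_mul, mem_typeA.1 hX]
  · rw [Matrix.trace_mul_comm, ← mul_assoc, h2, one_mul, mem_typeA.1 hX]

lemma typeA_blk_mem (P : Fin n → Fin n → Prop) : ∀ X ∈ (typeA n).g, blk P X ∈ (typeA n).g :=
  fun X hX => mem_typeA.2 (by rw [← mem_typeA.1 hX]; simp [Matrix.trace, blk])

/-- The blocks of `𝔰(𝔲(n-i) ⊕ 𝔲(1)^i)`. -/
lemma typeA_hasBlocks_chain (i : ℕ) : (typeA n).HasBlocks (· ≠ ·) (rootsA n i)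
    fun a b => (a : ℕ) + i < n ∧ (b : ℕ) + i < n where
  symm h := ⟨h.2, h.1⟩
  mem {a b} _ hab hP := typeA_consecutive hab
    (AddSubgroup.closure ((typeA n).simple '' (rootsA n i : Set (Fin (n - 1))))).toAddSubmonoid
    fun j _ _ => AddSubgroup.subset_closure ⟨j, by
      simp [rootsA]; omega, rfl⟩
  kill {a b} hab hP := by
    -- For an index c outside the large block, the traceless version of E_cc is constant on that
    -- block and separates c from every other index.
    have key : ∀ c : Fin n, n ≤ c + i → ∃ H : (typeA n).cartan,
        (∀ j ∈ rootsA n i, (typeA n).simple j H = 0) ∧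
        ∀ d, d ≠ c → (H : Mat n) c c ≠ (H : Mat n) d d := by
      intro c hc
      have hn : (n : ℂ) ≠ 0 := by exact_mod_cast (by have := c.2; omega : n ≠ 0)
      refine ⟨⟨_, typeA_diagonal_mem (d := fun a => (if a = c then 1 else 0) - 1 / (n : ℂ)) ?_⟩,
        fun j hj => ?_, fun d hd => ?_⟩
      · simp [hn]
      · have hj' : (j : ℕ) + 1 + i < n := by simpa [rootsA] using hj
        rw [typeA_simple_apply]
        simp only [Matrix.diagonal_apply_eq, Fin.ext_iff]
        rw [if_neg (by omega), if_neg (by omega), sub_self]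
      · simp [hd]
    by_cases ha : (a : ℕ) + i < n
    · obtain ⟨H, h1, h2⟩ := key b (by
        by_contra h
        exact hP ⟨ha, by omega⟩)
      exact ⟨H, h1, (h2 a hab).symm⟩
    · obtain ⟨H, h1, h2⟩ := key a (by omega)
      exact ⟨H, h1, h2 b hab.symm⟩

lemma sum_val_succ_eq {s : ℕ} (h0 : 0 < s) (h : s ≤ n) (f : Fin n → ℂ) :
    ∑ a : Fin n, (if (a : ℕ) + 1 = s then f a else 0) = f ⟨s - 1, by omega⟩ := by
  rw [Finset.sum_eq_single (⟨s - 1, by omega⟩ : Fin n)]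
  · rw [if_pos]; simp; omega
  · intro b _ hb
    exact if_neg fun h => hb (Fin.ext (by simp; omega))
  · simp

/-- The entries of the step generator on the first s places sum to zero, so it is orthogonal to
diagonals constant there. With f = 1 this says that its trace vanishes; with f the diagonal of a
central element it is the orthogonality required of ρ. -/
lemma sum_step_mul {s : ℕ} (h0 : 0 < s) (h : s ≤ n) {f : Fin n → ℂ} {x : ℂ}
    (hf : ∀ a : Fin n, (a : ℕ) < s → f a = x) :
    ∑ a : Fin n, ((if (a : ℕ) < s then Complex.I / s else 0) -
      if (a : ℕ) + 1 = s then Complex.I else 0) * f a = 0 := by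
  have hs : (s : ℂ) ≠ 0 := by exact_mod_cast h0.ne'
  have h2 : ∀ a : Fin n, (if (a : ℕ) < s then Complex.I / s * f a else 0) =
      if (a : ℕ) < s then Complex.I / s * x else 0 := by
    intro a
    by_cases ha : (a : ℕ) < s
    · simp only [ha, if_true, hf a ha]
    · simp only [ha, if_false]
  simp only [sub_mul, Finset.sum_sub_distrib, ite_mul, zero_mul, h2]
  rw [sum_val_succ_eq h0 h fun a => Complex.I * f a, sum_val_lt h,
    hf ⟨s - 1, by omega⟩ (by simp; omega)]
  field_simp
  ring

/-- The generator of the centre in the step from `𝔲(s)` to `𝔲(s-1) ⊕ 𝔲(1)`. -/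
def rhoStepA (n s : ℕ) : Mat n :=
  Matrix.diagonal fun a => (if (a : ℕ) < s then Complex.I / s else 0) -
    if (a : ℕ) + 1 = s then Complex.I else 0

lemma star_ite_I_div (p : Prop) [Decidable p] (s : ℕ) :
    star (if p then Complex.I / s else (0 : ℂ)) = -if p then Complex.I / s else 0 := by
  split_ifs <;> simp [neg_div]

lemma star_ite_I (p : Prop) [Decidable p] :
    star (if p then Complex.I else (0 : ℂ)) = -if p then Complex.I else 0 := by
  split_ifs <;> simp

lemma rhoStepA_star (s : ℕ) : star (rhoStepA n s) = -rhoStepA n s :=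
  star_diagonal_of_skew fun a => by rw [star_sub, star_ite_I_div, star_ite_I]; ring

lemma rhoStepA_mem {s : ℕ} (h0 : 0 < s) (h : s ≤ n) : rhoStepA n s ∈ (typeA n).cartan := by
  refine typeA_diagonal_mem ?_
  simpa using sum_step_mul h0 h (f := fun _ => 1) fun _ _ => rfl

lemma rhoStepA_gen {i : ℕ} (hi : i < n - 1) : (typeA n).IsCentralGenerator (rootsA n i)
    (rootsA n (i + 1)) ⟨rhoStepA n (n - i), rhoStepA_mem (by omega) (by omega)⟩ := by
  refine ⟨mem_compact.2 ⟨(rhoStepA_mem (by omega) (by omega)).1, rhoStepA_star _⟩, fun j hj => ?_,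
    fun j hj => ?_, fun H hH => ?_⟩
  · have hj' : (j : ℕ) + 1 + (i + 1) < n := by simpa [rootsA] using hj
    rw [typeA_simple_apply]
    simp only [rhoStepA, Matrix.diagonal_apply_eq]
    rw [if_pos (by omega), if_neg (by omega), if_pos (by omega), if_neg (by omega), sub_self]
  · have hj' : (j : ℕ) + 1 + i < n ∧ n ≤ (j : ℕ) + 1 + (i + 1) := by simpa [rootsA] using hj
    rw [typeA_simple_apply]
    simp only [rhoStepA, Matrix.diagonal_apply_eq]
    rw [if_pos (by omega), if_neg (by omega), if_pos (by omega), if_pos (by omega)]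
    ring
  -- An element killed by the simple roots in S has equal entries on the large block.
  · have hc := const_of_consecutive (s := n - i)
      (f := fun a => if h : a < n then (H : Mat n) ⟨a, h⟩ ⟨a, h⟩ else 0) fun j hj => by
        have := hH ⟨j, by omega⟩ (by simp [rootsA]; omega)
        rw [typeA_simple_apply] at this
        simp only [show j < n by omega, show j + 1 < n by omega, dif_pos]
        exact sub_eq_zero.1 this
    change Matrix.trace (rhoStepA n (n - i) * _) = 0
    rw [rhoStepA, trace_diagonal_mul]
    have hpos : 0 < n := by omega
    refine sum_step_mul (by omega) (by omega) (x := (H : Mat n) ⟨0, hpos⟩ ⟨0, hpos⟩) fun a ha => ?_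
    have := hc a ha
    simpa [hpos] using this

lemma rootsA_zero : rootsA n 0 = Finset.univ := by
  ext j
  simp [rootsA]
  omega

lemma isIrred_wA {i : ℕ} (hi : i < n) :
    IsIrred (fund n) ((typeA n).levi (rootsA n i)) (wA n i) :=
  isIrred_fund_of_complete typeA_isStandard (typeA_hasBlocks_chain i)
    (a0 := ⟨0, by omega⟩) (by simpa using hi) (fun _ _ h _ => h.1) fun _ _ h1 h2 hne => ⟨hne, h1, h2⟩

lemma typeA_isMinimal_step {i : ℕ} (hi : i < n - 1) :
    (typeA n).IsMinimal (fund n) (rootsA n i) (rootsA n (i + 1)) (rhoStepA n (n - i))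
      (Complex.I / ((n - i : ℕ) : ℂ)) (wA n i) (wA n (i + 1))
      (coordSub fun a : Fin n => (a : ℕ) + 1 = n - i) := by
  refine isMinimal_fund typeA_isStandard (typeA_hasBlocks_chain i) _ (rhoStepA_gen hi)
    (isIrred_wA (by omega)) (isIrred_wA (by omega)) (fun x => by omega) (fun x hx => ?_)
    (fun x hx => ?_) ⟨⟨n - i - 1, by omega⟩, by simp; omega⟩ (a0 := ⟨0, by omega⟩) (by simp; omega)
    rfl
  · simp only [rhoStepA, Matrix.diagonal_apply_eq]
    rw [if_pos (by omega), if_neg (by omega), sub_zero]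
  · simp only [rhoStepA, Matrix.diagonal_apply_eq]
    rw [if_pos (by omega), if_pos (by omega)]

lemma typeA_isNoncompact_step {i : ℕ} (hi : i < n - 1) :
    (typeA n).IsNoncompact (rootsA n i) (rootsA n (i + 1)) := by
  obtain ⟨-, h0, h1, -⟩ := rhoStepA_gen hi
  refine isNoncompact_of_rho typeA_isStandard (typeA_hasBlocks_chain i) h0 h1 fun a b _ hP => ?_
  have h : ∀ x : Fin n, (x : ℕ) + i < n → rhoStepA n (n - i) x x =
      Complex.I / ((n - i : ℕ) : ℂ) - if (x : ℕ) + 1 = n - i then Complex.I else 0 := by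
    intro x hx
    simp only [rhoStepA, Matrix.diagonal_apply_eq]
    rw [if_pos (by omega)]
  dsimp only
  rw [h a hP.1, h b hP.2, sub_sub_sub_cancel_left]
  split_ifs <;> simp

theorem typeA_isThimmChain :
    (typeA n).IsThimmChain (n - 1) (rootsA n) (chainA n) := by
  refine isThimmChain_of_blocks typeA_isStandard rootsA_zero (blockSub_eq_self fun a b => by omega)
    ?_ (fun i _ => typeA_hasBlocks_chain i) (fun _ _ => rfl)
    fun i hi => ⟨?_, typeA_isNoncompact_step hi⟩
  · ext j; simp [rootsA]; omega
  · refine Finset.ssubset_iff_subset_ne.2 ⟨fun j => by simp [rootsA]; omega, fun h => ?_⟩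
    have : (⟨n - 2 - i, by omega⟩ : Fin (n - 1)) ∈ rootsA n (i + 1) := by
      rw [h]; simp [rootsA]; omega
    simp [rootsA] at this
    omega

lemma typeA_hasBlocks_allBut {k : ℕ} (hk : 1 ≤ k) (hkn : k < n) (hρ : rhoA n k ∈ (typeA n).cartan) :
    (typeA n).HasBlocks (· ≠ ·) (allBut (n - 1) (k - 1))
      fun a b => ((a : ℕ) < k ↔ (b : ℕ) < k) where
  symm h := h.symm
  mem {a b} _ hab hP := typeA_consecutive hab
    (AddSubgroup.closure ((typeA n).simple '' (allBut (n - 1) (k - 1) : Set (Fin (n - 1))))).toAddSubmonoid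
    fun j _ _ => AddSubgroup.subset_closure ⟨j, by
      simp [allBut]; omega, rfl⟩
  kill {a b} hab hP := by
    -- The generator ρ itself is killed by every simple root but the removed one and takes different
    -- values on the two blocks.
    refine ⟨⟨_, hρ⟩, fun j hj => ?_, ?_⟩
    · have hj' : (j : ℕ) ≠ k - 1 := by simpa [allBut] using hj
      rw [typeA_simple_apply]
      simp only [rhoA, Matrix.diagonal_apply_eq]
      split_ifs <;> first | omega | simp
    · have hn : (n : ℂ) ≠ 0 := by exact_mod_cast (by omega : n ≠ 0)
      have h0 : Complex.I * ((n : ℂ) - k) / n ≠ -(Complex.I * k / n) := by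
        intro h
        field_simp at h
        have : (n : ℂ) = 0 := by linear_combination h
        exact hn this
      simp only [rhoA, Matrix.diagonal_apply_eq]
      split_ifs with h1 h2 h2
      · exact absurd (iff_of_true h1 h2) hP
      · exact h0
      · exact h0.symm
      · exact absurd (iff_of_false h1 h2) hP

lemma rhoA_apply {k : ℕ} (hn : n ≠ 0) (a : Fin n) : rhoA n k a a =
    if (a : ℕ) < k then Complex.I * ((n : ℂ) - k) / n
    else Complex.I * ((n : ℂ) - k) / n - Complex.I := by
  have hn : (n : ℂ) ≠ 0 := by exact_mod_cast hn
  simp only [rhoA, Matrix.diagonal_apply_eq]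
  split_ifs
  · rfl
  · field_simp; ring

lemma rhoA_trace {k : ℕ} (hkn : k < n) : Matrix.trace (rhoA n k) = 0 := by
  have hn : (n : ℂ) ≠ 0 := by exact_mod_cast (by omega : n ≠ 0)
  rw [rhoA, Matrix.trace_diagonal]
  have : ∀ a : Fin n, (if (a : ℕ) < k then Complex.I * ((n : ℂ) - k) / n
      else -(Complex.I * k / n)) = (if (a : ℕ) < k then Complex.I else 0) - Complex.I * k / n := by
    intro a
    split_ifs
    · field_simp
    · ring
  simp only [this]
  rw [Finset.sum_sub_distrib, sum_val_lt hkn.le]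
  simp
  field_simp
  simp

lemma rhoA_mem {k : ℕ} (hkn : k < n) : rhoA n k ∈ (typeA n).cartan :=
  diagonal_mem_cartanOf (mem_typeA.2 (rhoA_trace hkn))

lemma rhoA_mem_compact {k : ℕ} (hkn : k < n) : rhoA n k ∈ (typeA n).compact := by
  refine mem_compact.2 ⟨(rhoA_mem hkn).1, star_diagonal_of_skew fun a => ?_⟩
  split_ifs <;> simp <;> ring

lemma rhoA_gen {k : ℕ} (hk : 1 ≤ k) (hkn : k < n) : (typeA n).IsCentralGenerator Finset.univ
    (allBut (n - 1) (k - 1)) ⟨rhoA n k, rhoA_mem hkn⟩ := by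
  refine ⟨rhoA_mem_compact hkn, fun j hj => ?_, fun j hj => ?_, fun H hH => ?_⟩
  · have hj' : (j : ℕ) ≠ k - 1 := by simpa [allBut] using hj
    rw [typeA_simple_apply]
    simp only [rhoA_apply (by omega : n ≠ 0)]
    split_ifs <;> first | omega | simp
  · have hj' : (j : ℕ) = k - 1 := by simpa [allBut] using hj
    rw [typeA_simple_apply]
    simp only [rhoA_apply (by omega : n ≠ 0)]
    rw [if_pos (by omega), if_neg (by omega)]
    ring
  · have hpos : 0 < n := by omega
    have hc := const_of_consecutive (s := n)
      (f := fun a => if h : a < n then (H : Mat n) ⟨a, h⟩ ⟨a, h⟩ else 0) fun j hj => by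
        have := hH ⟨j, by omega⟩ (Finset.mem_univ _)
        rw [typeA_simple_apply] at this
        simp only [show j < n by omega, show j + 1 < n by omega, dif_pos]
        exact sub_eq_zero.1 this
    have h1 : ∀ a : Fin n, (H : Mat n) a a = (H : Mat n) ⟨0, hpos⟩ ⟨0, hpos⟩ := by
      intro a
      have := hc a a.2
      simpa [hpos] using this
    change Matrix.trace (rhoA n k * _) = 0
    have h2 := rhoA_trace hkn
    rw [rhoA, trace_diagonal_mul]
    rw [rhoA, Matrix.trace_diagonal] at h2
    simp only [h1]
    rw [← Finset.sum_mul, h2, zero_mul]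

theorem typeA_theorem {c : ℝ} (hc : c ≠ 0) {k : ℕ} (hk : 1 ≤ k) (hkn : k < n) :
    (typeA n).IsRootData ∧
    (typeA n).IsRep (fund n) ∧
    (typeA n).IsNoncompact Finset.univ (allBut (n - 1) (k - 1)) ∧
    (typeA n).IsMinimal (fund n) Finset.univ (allBut (n - 1) (k - 1)) (rhoA n k)
      (Complex.I * ((n : ℂ) - k) / n) ⊤
      (coordSub fun a => (a : ℕ) < k) (coordSub fun a => k ≤ (a : ℕ)) ∧
    (typeA n).IsThimmChain (n - 1) (rootsA n) (chainA n) ∧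
    wA n 0 = ⊤ ∧
    (typeA n).IsMinimalForChain (fund n) (n - 1) (rootsA n) (wA n) ∧
    ∀ i ≤ n - 1, NijenhuisFormula (typeA n) c (rhoA n k) (fund n) (chainA n i) (wA n i)
      (2 * ((n : ℂ) - k) / n) := by
  have hn : (n : ℂ) ≠ 0 := by exact_mod_cast (by omega : n ≠ 0)
  have htop : wA n 0 = ⊤ := coordSub_eq_top fun a => by simp
  have hgen := rhoA_gen hk hkn
  have hB := typeA_hasBlocks_allBut hk hkn (rhoA_mem hkn)
  have hdiff : ∀ a b : Fin n, rhoA n k a a - rhoA n k b b = 0 ∨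
      rhoA n k a a - rhoA n k b b = Complex.I ∨ rhoA n k a a - rhoA n k b b = -Complex.I := by
    intro a b
    simp only [rhoA_apply (by omega : n ≠ 0)]
    split_ifs <;> simp
  refine ⟨typeA_isStandard.isRootData, isRep_fund, ?_, ?_, typeA_isThimmChain, htop,
    fun i hi => ⟨_, _, _, typeA_isMinimal_step hi⟩, fun i hi => ?_⟩
  -- The blocks of the full algebra are those of the chain at step 0, so the criterion for the chain
  -- applies to the first noncompact root as well.
  · rw [← rootsA_zero]
    refine isNoncompact_of_rho (ρ := ⟨_, rhoA_mem hkn⟩) typeA_isStandard (typeA_hasBlocks_chain 0)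
      hgen.2.1 (by rw [rootsA_zero]; exact hgen.2.2.1) fun a b _ _ => hdiff a b
  · rw [← rootsA_zero] at hgen ⊢
    rw [← htop]
    refine isMinimal_fund typeA_isStandard (typeA_hasBlocks_chain 0) (rhoA_mem hkn) hgen
      (isIrred_wA (by omega)) (isIrred_fund_of_complete typeA_isStandard hB (a0 := ⟨0, by omega⟩)
        (by simp; omega) (fun _ _ h1 h2 => h1.2 h2) fun _ _ h1 h2 hne => ⟨hne, iff_of_true h1 h2⟩)
      (fun x => by omega) (fun x hx => ?_) (fun x hx => ?_) ⟨⟨k, hkn⟩, le_rfl⟩ (a0 := ⟨0, by omega⟩)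
      (by simp; omega) rfl
    · rw [rhoA_apply (by omega), if_pos hx]
    · rw [rhoA_apply (by omega), if_neg (by omega)]
  · rw [show 2 * ((n : ℂ) - k) / n = -2 * Complex.I * (Complex.I * ((n : ℂ) - k) / n) by
      linear_combination (2 * ((n : ℂ) - k) / n) * Complex.I_mul_I]
    refine nijenhuisFormula_fund (A := fun a : Fin n => (a : ℕ) + i < n)
      (P := fun a b : Fin n => (a : ℕ) + i < n ∧ (b : ℕ) + i < n) typeA_isStandard hc (rhoA_mem hkn)
      (rhoA_mem_compact hkn) (fun a b _ hab => ?_) typeA_conj (fun a => ?_)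
      (fun h => ⟨h.2, h.1⟩) (typeA_blk_mem _) (fun _ _ h _ => h.1) (fun _ _ h1 h2 _ => ⟨h2, h1⟩)
      (fun x y hxy hx => by have : (y : ℕ) < x := hxy; omega)
    · have : (a : ℕ) < b := hab
      simp only [rhoA_apply (by omega : n ≠ 0)]
      split_ifs <;> first | omega | simp
    · rw [rhoA_apply (by omega)]
      split_ifs <;> simp

end TypeA

end

end HermSym

/-! ### Lie algebras of an antidiagonal bilinear form (types B, C, D). -/

namespace HermSym

noncomputable section

open Datum

/-- The bilinear form pairing the basis vectors `a` and `N-1-a`, with signs `s`. -/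
def formMat {N : ℕ} (s : Fin N → ℂ) : Mat N := Matrix.of fun a b => if b = a.rev then s a else 0

/-- The root vectors of the Lie algebra of `formMat s`. -/
def formRoot {N : ℕ} (s : Fin N → ℂ) (a b : Fin N) : Mat N :=
  Matrix.single a b 1 - (s a * s b) • Matrix.single b.rev a.rev 1

/-- The pairs `(a, b)` for which `formRoot s a b` is a root vector. -/
def formRp {N : ℕ} (s : Fin N → ℂ) (a b : Fin N) : Prop :=
  a ≠ b ∧ (b = a.rev → s a * s b = -1)

/-- The Lie algebra of `D` is that of the bilinear form `formMat s`. -/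
structure IsFormBase {N l : ℕ} (D : Datum N l) (s : Fin N → ℂ) (ε : ℂ) : Prop where
  g_eq : D.g = skewAdjointMatricesSubmodule (formMat s)
  sq : ∀ a, s a * s a = 1
  star_s : ∀ a, star (s a) = s a
  rev : ∀ a, s a.rev = ε * s a
  ε_sq : ε * ε = 1

/-- The data shared by the types `B`, `C` and `D`. -/
structure IsForm {N l : ℕ} (D : Datum N l) (s : Fin N → ℂ) (ε : ℂ) : Prop
    extends IsFormBase D s ε where
  mem_pos : ∀ p, p ∈ D.pos ↔ p.1 < p.2 ∧ p.2 ≤ p.1.rev ∧ (p.2 = p.1.rev → s p.1 * s p.2 = -1)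
  e_eq : ∀ p, D.e p = formRoot s p.1 p.2
  simple_ex : ∀ i, ∃ a b, a < b ∧ formRp s a b ∧ D.simple i = eps D.g (a : ℕ) - eps D.g (b : ℕ)
  simple_indep : LinearIndependent ℂ D.simple
  closure_mem : ∀ {a b}, formRp s a b → a < b → a.val + b.val < N →
    eps D.g (a : ℕ) - eps D.g (b : ℕ) ∈
    AddSubmonoid.closure (D.simple '' ((Finset.univ : Finset (Fin l)) : Set (Fin l)))

lemma formRoot_apply {N : ℕ} (s : Fin N → ℂ) (a b c d : Fin N) : formRoot s a b c d =
    (if a = c ∧ b = d then 1 else 0) - if b.rev = c ∧ a.rev = d then s a * s b else 0 := by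
  simp [formRoot, Matrix.single_apply]

lemma formRoot_transpose {N : ℕ} (s : Fin N → ℂ) (a b : Fin N) : (formRoot s a b)ᵀ = formRoot s b a := by
  simp [formRoot, Matrix.transpose_sub, Matrix.transpose_single, mul_comm]

lemma formRp_symm {N : ℕ} {s : Fin N → ℂ} {a b : Fin N} (h : formRp s a b) : formRp s b a :=
  ⟨h.1.symm, fun hb => by rw [mul_comm]; exact h.2 (by rw [hb, Fin.rev_rev])⟩

lemma formRoot_self {N : ℕ} {s : Fin N → ℂ} {a b : Fin N} (h : formRp s a b) :
    formRoot s a b a b = if b = a.rev then 2 else 1 := by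
  rw [formRoot_apply]
  by_cases hb : b = a.rev
  · have := h.2 hb
    subst hb
    simp [this]; norm_num
  · have : ¬ (b.rev = a ∧ a.rev = b) := fun h => hb h.2.symm
    simp [hb, this]

lemma rev_lt_of_lt {N : ℕ} {a b : Fin N} (h : a < b) : b.rev < a.rev := Fin.rev_lt_rev.2 h

lemma eq_of_rev_eq {N : ℕ} {a b : Fin N} (ha : a.rev = a) (hb : b.rev = b) : a = b := by
  have h1 := congrArg Fin.val ha
  have h2 := congrArg Fin.val hb
  rw [Fin.val_rev] at h1 h2
  ext; omega

/-- The functional dual to `a`, up to sign, among the antisymmetric diagonal matrices. -/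
def antiInd {N : ℕ} (x a : Fin N) : ℤ := (if a = x then 1 else 0) - if a = x.rev then 1 else 0

lemma antiInd_rev {N : ℕ} (x a : Fin N) : antiInd x a.rev = -antiInd x a := by
  simp only [antiInd, Fin.rev_eq_iff, Fin.rev_rev]
  ring

/-- The only coincidence among the functionals ε_a − ε_b is the one forced by ε_{rev a} = −ε_a.
Testing on x = a, b, c, d is enough. -/
lemma root_eq_of_antiInd {N : ℕ} {a b c d : Fin N} (hab : a ≠ b) (hcd : c ≠ d)
    (h : ∀ x, antiInd x a - antiInd x b = antiInd x c - antiInd x d) :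
    (c = a ∧ d = b) ∨ (c = b.rev ∧ d = a.rev) := by
  have ha := h a
  have hb := h b
  have hc := h c
  have hd := h d
  simp only [antiInd, Fin.ext_iff, Fin.val_rev, ne_eq] at *
  have := a.2
  have := b.2
  have := c.2
  have := d.2
  clear h
  grind (splits := 30)

namespace IsFormBase

variable {N l : ℕ} {D : Datum N l} {s : Fin N → ℂ} {ε : ℂ} (hF : IsFormBase D s ε)
include hF

/-- The skew-adjointness equation read entrywise: each entry is tied to its reflection in the
antidiagonal. The relations s² = 1 and ε² = 1 make the sign the same for both symmetry types. -/
lemma mem_iff {X : Mat N} : X ∈ D.g ↔ ∀ a b, X b.rev a.rev = -(s a * s b) * X a b := by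
  have hε : ε ≠ 0 := left_ne_zero_of_mul (hF.ε_sq.trans_ne one_ne_zero)
  rw [hF.g_eq, mem_skewAdjointMatricesSubmodule]
  have h1 : (formMat s).IsSkewAdjoint X ↔ Xᵀ * formMat s = formMat s * (-X) := Iff.rfl
  have hl : ∀ a b, (Xᵀ * formMat s) a b = X b.rev a * s b.rev := by
    intro a b
    rw [Matrix.mul_apply, Finset.sum_eq_single b.rev]
    · simp [formMat]
    · intro c _ hc
      have : ¬ b = c.rev := fun h => hc (by rw [h, Fin.rev_rev])
      simp [formMat, this]
    · simp
  have hr : ∀ a b, (formMat s * (-X)) a b = -(s a * X a.rev b) := by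
    intro a b
    rw [Matrix.mul_apply, Finset.sum_eq_single a.rev]
    · simp [formMat]
    · intro c _ hc
      simp [formMat, hc]
    · simp
  have h2 : ∀ a b, X b.rev a.rev * s b.rev = -(s a.rev * X a.rev.rev b) ↔
      X b.rev a.rev = -(s a * s b) * X a b := by
    intro a b
    rw [hF.rev, hF.rev, Fin.rev_rev]
    have hb := hF.sq b
    have he := hF.ε_sq
    constructor
    · intro h
      linear_combination (ε * s b) * h - X b.rev a.rev * hb - (X b.rev a.rev * (s b * s b) +
        s a * s b * X a b) * he
    · intro h
      linear_combination (ε * s b) * h - (ε * s a * X a b) * hb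
  rw [h1]
  constructor
  · intro h a b
    have := congrFun (congrFun h a.rev) b
    rw [hl, hr] at this
    exact (h2 a b).1 this
  · intro h
    ext a b
    rw [hl, hr]
    have := (h2 a.rev b).2 (h a.rev b)
    rwa [Fin.rev_rev] at this

lemma diagonal_mem {d : Fin N → ℂ} (h : ∀ a, d a.rev = -d a) : Matrix.diagonal d ∈ D.cartan := by
  refine diagonal_mem_cartanOf (hF.mem_iff.2 fun a b => ?_)
  by_cases hab : a = b
  · subst hab
    rw [Matrix.diagonal_apply_eq, Matrix.diagonal_apply_eq, h, hF.sq]; ring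
  · have : b.rev ≠ a.rev := fun h => hab (Fin.rev_injective h).symm
    rw [Matrix.diagonal_apply_ne _ hab, Matrix.diagonal_apply_ne _ this, mul_zero]

lemma apply_rev {H : Mat N} (hH : H ∈ D.g) (a : Fin N) : H a.rev a.rev = -H a a := by
  rw [hF.mem_iff.1 hH, hF.sq]; ring

lemma antiInd_mem (x : Fin N) : (Matrix.diagonal fun a => (antiInd x a : ℂ)) ∈ D.cartan :=
  hF.diagonal_mem fun a => by rw [antiInd_rev]; push_cast; rfl

lemma eps_rev (a : Fin N) : eps D.g (a.rev : ℕ) = -eps D.g (a : ℕ) := by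
  ext H
  rw [LinearMap.neg_apply, eps_apply, eps_apply, hF.apply_rev H.2.1]

lemma ss_sq (a b : Fin N) : s a * s b * (s a * s b) = 1 := by
  have h1 := hF.sq a
  have h2 := hF.sq b
  linear_combination (s b * s b) * h1 + h2

lemma ss_rev (a b : Fin N) : s b.rev * s a.rev = s a * s b := by
  rw [hF.rev, hF.rev]
  linear_combination (s a * s b) * hF.ε_sq

lemma formRoot_mem (a b : Fin N) : formRoot s a b ∈ D.g := by
  refine hF.mem_iff.2 fun c d => ?_
  rw [formRoot_apply, formRoot_apply]
  simp only [Fin.rev_eq_iff, Fin.rev_rev]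
  have e1 : (a = d.rev ∧ b = c.rev) ↔ (b = c.rev ∧ a = d.rev) := and_comm
  have e2 : (b = d ∧ a = c) ↔ (a = c ∧ b = d) := and_comm
  simp only [e1, e2]
  by_cases h1 : a = c ∧ b = d
  · obtain ⟨rfl, rfl⟩ := h1
    simp only [and_self, if_true]
    split_ifs
    · linear_combination -hF.ss_sq a b
    · ring
  · simp only [h1, if_false]
    by_cases h2 : b = c.rev ∧ a = d.rev
    · obtain ⟨rfl, rfl⟩ := h2
      simp only [and_self, if_true]
      have := hF.ss_rev c d
      rw [this]
      linear_combination -hF.ss_sq c d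
    · simp [h2]

end IsFormBase

namespace IsForm

variable {N l : ℕ} {D : Datum N l} {s : Fin N → ℂ} {ε : ℂ} (hF : IsForm D s ε)
include hF

lemma formRp_rev {a b : Fin N} (h : formRp s a b) : formRp s b.rev a.rev :=
  ⟨fun hb => h.1 (Fin.rev_injective hb).symm, fun hb => by
    rw [hF.ss_rev]; exact h.2 (by rw [hb, Fin.rev_rev])⟩

lemma formRoot_rev (a b : Fin N) : formRoot s b.rev a.rev = (-(s a * s b)) • formRoot s a b := by
  rw [formRoot, formRoot, hF.ss_rev, Fin.rev_rev, Fin.rev_rev, smul_sub, smul_smul,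
    neg_mul, hF.ss_sq]
  simp only [neg_smul, one_smul]
  abel

/-- On the antidiagonal the reflected entry is the entry itself, so it can be nonzero only if s_a
s_b = −1. This is why the long roots 2ε_a occur in type C and are absent in types B and D. -/
lemma of_entry {X : Mat N} (hX : X ∈ D.g) {a b : Fin N} (hab : a ≠ b) (h0 : X a b ≠ 0) :
    formRp s a b := by
  refine ⟨hab, fun hb => ?_⟩
  have := hF.mem_iff.1 hX a b
  rw [show b.rev = a by rw [hb, Fin.rev_rev], ← hb] at this
  have h1 : (s a * s b + 1) * X a b = 0 := by linear_combination this
  have := (mul_eq_zero.1 h1).resolve_right h0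
  linear_combination this

lemma transpose_mem {X : Mat N} (hX : X ∈ D.g) : Xᵀ ∈ D.g := by
  refine hF.mem_iff.2 fun a b => ?_
  rw [Matrix.transpose_apply, Matrix.transpose_apply, hF.mem_iff.1 hX b a]
  ring

/-- Both matrix units of the root vector contribute the same amount, by the reflection symmetry of
X. The factor 2 cancels in the quotients of `upper`. -/
lemma trace_mul_formRoot {X : Mat N} (hX : X ∈ D.g) (a b : Fin N) :
    Matrix.trace (X * formRoot s b a) = 2 * X a b := by
  rw [formRoot, mul_sub, mul_smul_comm, Matrix.trace_sub, Matrix.trace_smul,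
    Matrix.trace_mul_single, Matrix.trace_mul_single, hF.mem_iff.1 hX a b]
  simp only [smul_eq_mul, MulOpposite.op_one, one_smul]
  linear_combination (X a b) * hF.ss_sq a b

lemma decomp {X : Mat N} (hX : X ∈ D.g) : X = Matrix.diagonal X.diag +
    (1 / 2 : ℂ) • ∑ a, ∑ b, (if a = b then 0 else X a b) • formRoot s a b := by
  ext c d
  simp only [Matrix.add_apply, Matrix.smul_apply, Matrix.sum_apply, formRoot_apply, smul_eq_mul,
    mul_sub, Finset.sum_sub_distrib]
  have h1 : ∑ a, ∑ b, (if a = b then 0 else X a b) * (if a = c ∧ b = d then (1 : ℂ) else 0) =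
      if c = d then 0 else X c d := by
    rw [Finset.sum_eq_single c, Finset.sum_eq_single d]
    · simp
    · intro b _ hb; simp [hb]
    · simp
    · intro a _ ha; simp [ha]
    · simp
  have h2 : ∑ a, ∑ b, (if a = b then 0 else X a b) *
      (if b.rev = c ∧ a.rev = d then s a * s b else 0) =
      -if c = d then 0 else X c d := by
    rw [Finset.sum_eq_single d.rev, Finset.sum_eq_single c.rev]
    · simp only [Fin.rev_rev, and_self, if_true, Fin.rev_inj, eq_comm (a := d)]
      split_ifs
      · simp
      · rw [hF.mem_iff.1 hX c d, mul_comm (s d.rev), hF.rev, hF.rev]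
        linear_combination -(s c * s c * s d * s d * X c d) * hF.ε_sq -
          X c d * hF.ss_sq c d
    · intro b _ hb
      have : b.rev ≠ c := fun h => hb (by rw [← h, Fin.rev_rev])
      simp [this]
    · simp
    · intro a _ ha
      have : a.rev ≠ d := fun h => ha (by rw [← h, Fin.rev_rev])
      simp [this]
    · simp
  rw [h1, h2]
  by_cases h : c = d
  · subst h; simp
  · simp [h]; ring

lemma mem_pos_rp {p : Fin N × Fin N} (hp : p ∈ D.pos) : formRp s p.1 p.2 :=
  have h := (hF.mem_pos p).1 hp
  ⟨h.1.ne, h.2.2⟩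

/-- The condition `p.2 ≤ p.1.rev` in `pos` keeps one of the two reflected pairs; if both satisfy it
they coincide. -/
lemma pos_uniq {p q : Fin N × Fin N} (hp : p ∈ D.pos) (hq : q ∈ D.pos)
    (h : formRoot s q.1 q.2 p.1 p.2 ≠ 0) : p = q := by
  rw [formRoot_apply] at h
  by_cases h1 : q.1 = p.1 ∧ q.2 = p.2
  · exact (Prod.ext h1.1 h1.2).symm
  have h2 : q.2.rev = p.1 ∧ q.1.rev = p.2 := by
    by_contra h2
    exact h (by rw [if_neg h1, if_neg h2, sub_zero])
  have hp' := ((hF.mem_pos p).1 hp).2.1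
  have hq' := ((hF.mem_pos q).1 hq).2.1
  rw [← h2.1, ← h2.2, Fin.rev_rev] at hp'
  have := le_antisymm hq' hp'
  refine Prod.ext ?_ ?_
  · rw [← h2.1, this, Fin.rev_rev]
  · rw [← h2.2, this]

lemma pos_or {a b : Fin N} (h : formRp s a b) (hab : a < b) :
    (a, b) ∈ D.pos ∨ (b.rev, a.rev) ∈ D.pos := by
  rcases le_total b a.rev with h1 | h1
  · exact Or.inl ((hF.mem_pos _).2 ⟨hab, h1, h.2⟩)
  · refine Or.inr ((hF.mem_pos _).2 ⟨rev_lt_of_lt hab, ?_, (hF.formRp_rev h).2⟩)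
    rwa [Fin.rev_rev]

lemma upper {X : Mat N} (hX : X ∈ D.g) :
    ∑ p ∈ D.pos, (Matrix.trace (X * (D.e p)ᵀ) / Matrix.trace (D.e p * (D.e p)ᵀ)) • D.e p =
      Matrix.of fun a b => if a < b then X a b else 0 := by
  have hsum : ∑ p ∈ D.pos,
      (Matrix.trace (X * (D.e p)ᵀ) / Matrix.trace (D.e p * (D.e p)ᵀ)) • D.e p =
      ∑ p ∈ D.pos, (X p.1 p.2 / formRoot s p.1 p.2 p.1 p.2) • formRoot s p.1 p.2 := by
    refine Finset.sum_congr rfl fun p _ => ?_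
    rw [hF.e_eq, formRoot_transpose s, hF.trace_mul_formRoot hX,
      hF.trace_mul_formRoot (hF.formRoot_mem _ _), mul_div_mul_left _ _ two_ne_zero]
  rw [hsum]
  ext c d
  rw [Matrix.sum_apply, Matrix.of_apply]
  simp only [Matrix.smul_apply, smul_eq_mul]
  have hself : ∀ p ∈ D.pos, formRoot s p.1 p.2 p.1 p.2 ≠ 0 := by
    intro p hp
    rw [formRoot_self (hF.mem_pos_rp hp)]
    split_ifs <;> norm_num
  by_cases hcd : c < d
  · rw [if_pos hcd]
    by_cases hrp : formRp s c d
    -- Exactly one positive pair q reaches the entry (c, d): the pair itself, with k = 1, or its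
    -- reflection, with k = −s_c s_d. The scalar k relates the two entries for every element of the
    -- algebra.
    · have main : ∀ q ∈ D.pos, ∀ k : ℂ, formRoot s q.1 q.2 c d = k * formRoot s q.1 q.2 q.1 q.2 →
          X c d = k * X q.1 q.2 → (∀ p : Fin N × Fin N, formRoot s p.1 p.2 c d ≠ 0 →
            formRoot s p.1 p.2 q.1 q.2 ≠ 0) →
          ∑ p ∈ D.pos, X p.1 p.2 / formRoot s p.1 p.2 p.1 p.2 * formRoot s p.1 p.2 c d =
            X c d := by
        intro q hq k h1 h2 h3
        rw [Finset.sum_eq_single q]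
        · rw [h1, h2]
          field_simp [hself q hq]
        · intro p hp hpq
          by_cases h0 : formRoot s p.1 p.2 c d = 0
          · rw [h0, mul_zero]
          · exact absurd (hF.pos_uniq hq hp (h3 p h0)).symm hpq
        · exact fun h => absurd hq h
      have hsym : ∀ Y ∈ D.g, Y c d = -(s c * s d) * Y d.rev c.rev := by
        intro Y hY
        rw [hF.mem_iff.1 hY c d]
        linear_combination -(Y c d) * hF.ss_sq c d
      rcases hF.pos_or hrp hcd with h | h
      · exact main (c, d) h 1 (by rw [one_mul]) (by rw [one_mul]) fun p hp => hp
      · exact main (d.rev, c.rev) h (-(s c * s d)) (hsym _ (hF.formRoot_mem _ _)) (hsym _ hX)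
          fun p hp h0 => hp (by rw [hsym _ (hF.formRoot_mem _ _), h0, mul_zero])
    · have : X c d = 0 := by
        by_contra h
        exact hrp (hF.of_entry hX hcd.ne h)
      rw [this]
      refine Finset.sum_eq_zero fun p hp => ?_
      have h0 : formRoot s p.1 p.2 c d = 0 := by
        by_contra h
        exact hrp (hF.of_entry (hF.formRoot_mem _ _) hcd.ne h)
      rw [h0, mul_zero]
  · rw [if_neg hcd]
    refine Finset.sum_eq_zero fun p hp => ?_
    have hlt := ((hF.mem_pos p).1 hp).1
    have h1 : ¬ (p.1 = c ∧ p.2 = d) := fun h => hcd (h.1 ▸ h.2 ▸ hlt)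
    have h2 : ¬ (p.2.rev = c ∧ p.1.rev = d) := fun h => hcd (h.1 ▸ h.2 ▸ rev_lt_of_lt hlt)
    rw [formRoot_apply s p.1 p.2 c d, if_neg h1, if_neg h2]
    ring

lemma lower {X : Mat N} (hX : X ∈ D.g) :
    ∑ p ∈ D.pos, (Matrix.trace (X * D.e p) / Matrix.trace (D.e p * (D.e p)ᵀ)) • (D.e p)ᵀ =
      Matrix.of fun a b => if b < a then X a b else 0 := by
  have h := congrArg Matrix.transpose (hF.upper (hF.transpose_mem hX))
  rw [Matrix.transpose_sum] at h
  refine Eq.trans (Finset.sum_congr rfl fun p _ => ?_) h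
  rw [Matrix.transpose_smul, ← Matrix.transpose_mul, Matrix.trace_transpose, Matrix.trace_mul_comm X]

theorem isStandard : D.IsStandard (formRoot s) (1 / 2) (formRp s) where
  ne h := h.1
  symm h := formRp_symm h
  of_entry hX _ _ hab h := hF.of_entry hX hab h
  diag_mem hX := (hF.diagonal_mem fun a => hF.apply_rev hX a).1
  star_mem {X} hX := hF.mem_iff.2 fun a b => by
    rw [Matrix.star_apply, Matrix.star_apply, hF.mem_iff.1 hX b a]
    simp only [star_mul', star_neg, hF.star_s]
    ring
  comm_mem {X Y} hX hY := by
    rw [hF.g_eq] at *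
    exact Matrix.isSkewAdjoint_bracket _ hX hY
  F_mem _ := hF.formRoot_mem _ _
  F_self h := by rw [formRoot_self h]; split_ifs <;> norm_num
  F_weight {a b} _ H hH c d h0 := by
    rw [formRoot_apply] at h0
    by_cases h1 : a = c ∧ b = d
    · rw [h1.1, h1.2]
    · have h2 : b.rev = c ∧ a.rev = d := by
        by_contra h2
        exact h0 (by rw [if_neg h1, if_neg h2, sub_zero])
      rw [← h2.1, ← h2.2, hF.apply_rev hH.1, hF.apply_rev hH.1]
      ring
  decomp hX := hF.decomp hX
  sep {a b} h := by
    -- The middle index has weight zero, so `antiInd a` vanishes identically there and b must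
    -- separate the pair instead.
    by_cases ha : a.rev = a
    · refine ⟨_, hF.antiInd_mem b, ?_⟩
      have hb : b.rev ≠ b := fun hb => h.1 (eq_of_rev_eq ha hb)
      have h1 : a ≠ b.rev := fun h' => h.1 (by rw [← ha, h', Fin.rev_rev])
      simp [antiInd, h.1, h1, Ne.symm hb]
    · refine ⟨_, hF.antiInd_mem a, ?_⟩
      simp only [Matrix.diagonal_apply_eq, antiInd, Ne.symm ha, Ne.symm h.1, if_false, if_true]
      split_ifs <;> norm_num
  uniq {a b c d} hab hcd h := by
    have h' : ∀ x, antiInd x a - antiInd x b = antiInd x c - antiInd x d := by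
      intro x
      have := h _ (hF.antiInd_mem x)
      simp only [Matrix.diagonal_apply_eq] at this
      exact_mod_cast this
    rcases root_eq_of_antiInd hab.1 hcd.1 h' with ⟨rfl, rfl⟩ | ⟨rfl, rfl⟩
    · exact ⟨1, one_ne_zero, by rw [one_smul]⟩
    · refine ⟨-(s a * s b), ?_, hF.formRoot_rev a b⟩
      exact neg_ne_zero.2 (left_ne_zero_of_mul ((hF.ss_sq a b).trans_ne one_ne_zero))
  e_eq _ := hF.e_eq _
  eT_eq _ := by rw [hF.e_eq, formRoot_transpose]
  pos_rp hp := hF.mem_pos_rp hp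
  pos_lt hp := ((hF.mem_pos _).1 hp).1
  pos_ex {a b} h hab := by
    rcases hF.pos_or h hab with h | h
    · exact ⟨_, h, fun _ _ => rfl⟩
    · refine ⟨_, h, fun H hH => ?_⟩
      rw [hF.apply_rev hH.1, hF.apply_rev hH.1]
      ring
  pos_uniq {p q} hp hq k h := by
    refine hF.pos_uniq hp hq fun h0 => ?_
    have h1 := congrFun (congrFun h p.1) p.2
    rw [Matrix.smul_apply, h0, smul_zero, formRoot_self (hF.mem_pos_rp hp)] at h1
    split_ifs at h1 <;> norm_num at h1
  upper hX := hF.upper hX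
  lower hX := hF.lower hX
  simple_ex := hF.simple_ex
  simple_indep := hF.simple_indep
  closure_mem {a b} h hab := by
    -- A pair below the antidiagonal is replaced by its reflection, which has the same root.
    by_cases h1 : a.val + b.val < N
    · exact hF.closure_mem h hab h1
    · have h2 := hF.closure_mem (hF.formRp_rev h) (rev_lt_of_lt hab) (by
        rw [Fin.val_rev, Fin.val_rev]; omega)
      rwa [hF.eps_rev, hF.eps_rev, neg_sub_neg] at h2
  grading_mem := (hF.diagonal_mem grading_rev).1

lemma blk_mem {P : Fin N → Fin N → Prop} (hP : ∀ a b, P b.rev a.rev ↔ P a b) :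
    ∀ X ∈ D.g, blk P X ∈ D.g := by
  intro X hX
  refine hF.mem_iff.2 fun a b => ?_
  have h1 : (b.rev = a.rev ∨ P b.rev a.rev) ↔ (a = b ∨ P a b) := by
    rw [hP, Fin.rev_inj, eq_comm]
  simp only [blk, Matrix.of_apply]
  by_cases h : a = b ∨ P a b
  · rw [if_pos h, if_pos (h1.2 h)]
    exact hF.mem_iff.1 hX a b
  · rw [if_neg h, if_neg (mt h1.1 h), mul_zero]

/-- With J = `formMat s` and k* the inverse of k, preserving J means kᵀJ = Jk*. Conjugation by k
then carries skew-adjoint matrices to skew-adjoint ones, and so does conjugation by k*. -/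
lemma conj_mem {k : Mat N} (h1 : star k * k = 1) (h2 : k * star k = 1)
    (hk : kᵀ * formMat s * k = formMat s) :
    (∀ X ∈ D.g, k * X * star k ∈ D.g) ∧ ∀ X ∈ D.g, star k * X * k ∈ D.g := by
  have h1' : kᵀ * (star k)ᵀ = 1 := by rw [← Matrix.transpose_mul, h1, Matrix.transpose_one]
  have h2' : (star k)ᵀ * kᵀ = 1 := by rw [← Matrix.transpose_mul, h2, Matrix.transpose_one]
  have e1 : kᵀ * formMat s = formMat s * star k := by
    calc kᵀ * formMat s = (kᵀ * formMat s * k) * star k := by rw [mul_assoc _ k, h2, mul_one]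
      _ = _ := by rw [hk]
  have e2 : (star k)ᵀ * formMat s = formMat s * k := by
    calc (star k)ᵀ * formMat s = ((star k)ᵀ * kᵀ) * formMat s * k := by
          rw [mul_assoc _ kᵀ, mul_assoc, hk]
      _ = _ := by rw [h2', one_mul]
  have hmem : ∀ X : Mat N, X ∈ D.g ↔ Xᵀ * formMat s = formMat s * (-X) := by
    intro X
    rw [hF.g_eq, mem_skewAdjointMatricesSubmodule]
    exact Iff.rfl
  refine ⟨fun X hX => (hmem _).2 ?_, fun X hX => (hmem _).2 ?_⟩
  · rw [Matrix.transpose_mul, Matrix.transpose_mul, mul_assoc, mul_assoc, e1, ← mul_assoc Xᵀ,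
      (hmem X).1 hX, mul_assoc, ← mul_assoc, e2]
    noncomm_ring
  · rw [Matrix.transpose_mul, Matrix.transpose_mul, mul_assoc, mul_assoc, e2, ← mul_assoc Xᵀ,
      (hmem X).1 hX, mul_assoc, ← mul_assoc, e1]
    noncomm_ring

end IsForm

end

end HermSym

/-! ### The chain through U(n), for types C and D. -/

namespace HermSym

noncomputable section

open Datum

lemma eps_add_eq_zero {N l : ℕ} {D : Datum N l} {s : Fin N → ℂ} {ε : ℂ} (hF : IsFormBase D s ε)
    {a b : ℕ} (h : a + b + 1 = N) : eps D.g b = -eps D.g a := by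
  have := hF.eps_rev ⟨a, by omega⟩
  rw [Fin.val_rev] at this
  rw [← this]
  congr 1
  simp only
  omega

/-- The antisymmetric diagonal matrix with entries `u a`, `2 a + 1 < N`. -/
def antiExt (N : ℕ) (u : ℕ → ℂ) (a : Fin N) : ℂ :=
  if 2 * (a : ℕ) + 1 < N then u a else if N < 2 * (a : ℕ) + 1 then -u (N - 1 - a) else 0

lemma antiExt_rev {N : ℕ} (u : ℕ → ℂ) (a : Fin N) : antiExt N u a.rev = -antiExt N u a := by
  have ha := a.2
  simp only [antiExt, Fin.val_rev]
  rcases lt_trichotomy (2 * (a : ℕ) + 1) N with h | h | h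
  · rw [if_neg (by omega), if_pos (by omega), if_pos h]
    congr 2; omega
  · rw [if_neg (by omega), if_neg (by omega), if_neg (by omega), if_neg (by omega), neg_zero]
  · rw [if_pos (by omega), if_neg (by omega), if_pos h, neg_neg]
    congr 1; omega

section FormA

variable {n l : ℕ} {D : Datum (2 * n) l} {s : Fin (2 * n) → ℂ} {ε : ℂ}

/-- The blocks of `𝔨` (for `j = 0`) and of `𝔲(n+1-j) ⊕ 𝔲(1)^(j-1)`. -/
def blocksU (n j : ℕ) (a b : Fin (2 * n)) : Prop :=
  j = 0 ∨ ((a : ℕ) + j < n + 1 ∧ (b : ℕ) + j < n + 1) ∨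
    ((a.rev : ℕ) + j < n + 1 ∧ (b.rev : ℕ) + j < n + 1)

/-- The simple roots of type `C` and `D`. -/
structure IsFormU (D : Datum (2 * n) l) (s : Fin (2 * n) → ℂ) (ε : ℂ) : Prop
    extends IsForm D s ε where
  card : l = n
  simple_lt : ∀ i : Fin l, (i : ℕ) + 1 < n → D.simple i = eps D.g (i : ℕ) - eps D.g ((i : ℕ) + 1)
  simple_last : ∀ i : Fin l, (i : ℕ) + 1 = n → ∃ x < n, D.simple i = eps D.g (i : ℕ) + eps D.g x
  conj : ∀ k ∈ D.K, star k * k = 1 ∧ k * star k = 1 ∧ kᵀ * formMat s * k = formMat s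

/-- The generator of the centre in the step from `𝔲(s)` to `𝔲(s-1) ⊕ 𝔲(1)`. -/
def rhoStepU (n t : ℕ) : Mat (2 * n) :=
  Matrix.diagonal fun a => ((if (a : ℕ) < t then Complex.I / t else 0) -
    if (a : ℕ) + 1 = t then Complex.I else 0) - ((if (a.rev : ℕ) < t then Complex.I / t else 0) -
    if (a.rev : ℕ) + 1 = t then Complex.I else 0)

lemma rootsU_zero (hl : l = n) : (rootsU n 0 : Finset (Fin l)) = Finset.univ := by
  ext j
  simp [rootsU]
  omega

lemma rootsU_one (hl : l = n) : (rootsU n 1 : Finset (Fin l)) = allBut l (n - 1) := by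
  ext j
  simp [rootsU, allBut]
  omega

lemma rhoU_sub (a b : Fin (2 * n)) : rhoU n a a - rhoU n b b = 0 ∨
    rhoU n a a - rhoU n b b = Complex.I ∨ rhoU n a a - rhoU n b b = -Complex.I := by
  simp only [rhoU, Matrix.diagonal_apply_eq]
  split_ifs
  · simp
  · right; left; ring
  · right; right; ring
  · simp

lemma blocksU_inv {j : ℕ} (x y : Fin (2 * n)) (h : blocksU n j y x)
    (hx : j = 0 ∨ (x : ℕ) + j < n + 1) : j = 0 ∨ (y : ℕ) + j < n + 1 := by
  have h1 := Fin.val_rev x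
  rcases h with h | h | h
  · exact Or.inl h
  · exact Or.inr h.1
  · by_cases hj : j = 0
    · exact Or.inl hj
    · omega

namespace IsFormU

variable (hF : IsFormU D s ε)
include hF

lemma conj_mem : ∀ k ∈ D.K, star k * k = 1 ∧ k * star k = 1 ∧
    (∀ X ∈ D.g, k * X * star k ∈ D.g) ∧ ∀ X ∈ D.g, star k * X * k ∈ D.g := by
  intro k hk
  obtain ⟨h1, h2, h3⟩ := hF.conj k hk
  exact ⟨h1, h2, hF.toIsForm.conj_mem h1 h2 h3⟩

lemma simple_lt_apply (i : Fin l) (hi : (i : ℕ) + 1 < n) (H : D.cartan) :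
    D.simple i H = (H : Mat (2 * n)) ⟨i, by omega⟩ ⟨i, by omega⟩ -
      (H : Mat (2 * n)) ⟨i + 1, by omega⟩ ⟨i + 1, by omega⟩ := by
  rw [hF.simple_lt i hi, LinearMap.sub_apply, eps_nat (by omega), eps_nat (by omega)]

lemma first_block_mem (C : AddSubgroup (Module.Dual ℂ D.cartan)) {a b : ℕ} (hab : a < b)
    (hb : b < n) (h : ∀ i : Fin l, (i : ℕ) < b → D.simple i ∈ C) :
    eps D.g a - eps D.g b ∈ C := by
  have hl := hF.card
  refine sub_mem_of_consecutive C.toAddSubmonoid (fun i => eps D.g i) hab.le fun i _ hi => ?_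
  have := h ⟨i, by omega⟩ hi
  rwa [hF.simple_lt ⟨i, by omega⟩ (by simp; omega)] at this

/-- The two blocks of size n + 1 − j are reflections of each other, hence carry the same roots up to
sign. For j = 0 nothing is cut off. -/
lemma hasBlocks (j : ℕ) : D.HasBlocks (formRp s) (rootsU n j) (blocksU n j) where
  symm h := by
    rcases h with h | h | h
    · exact Or.inl h
    · exact Or.inr (Or.inl h.symm)
    · exact Or.inr (Or.inr h.symm)
  mem {a b} hrp hab hP := by
    have hab' : (a : ℕ) < b := hab
    have hl := hF.card
    have hsub : ∀ i : Fin l, (i : ℕ) + j < n → D.simple i ∈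
        AddSubgroup.closure (D.simple '' ((rootsU n j : Finset (Fin l)) : Set (Fin l))) := by
      intro i hi
      have hi' : i ∈ (rootsU n j : Finset (Fin l)) := by simpa [rootsU] using hi
      exact AddSubgroup.subset_closure ⟨i, hi', rfl⟩
    rcases Nat.eq_zero_or_pos j with rfl | hj
    · have hle : AddSubmonoid.closure (D.simple '' ((Finset.univ : Finset (Fin l)) : Set (Fin l))) ≤
          (AddSubgroup.closure
            (D.simple '' ((rootsU n 0 : Finset (Fin l)) : Set (Fin l)))).toAddSubmonoid := by
        rw [rootsU_zero hl]
        exact AddSubmonoid.closure_le.2 AddSubgroup.subset_closure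
      exact hle (hF.isStandard.closure_mem hrp hab)
    rcases hP with h | h | h
    · omega
    · exact hF.first_block_mem _ hab' (by omega) fun i hi => hsub i (by omega)
    · have hlt : (b.rev : ℕ) < a.rev := rev_lt_of_lt hab
      have := hF.first_block_mem (AddSubgroup.closure (D.simple '' ((rootsU n j : Finset (Fin l)) : Set (Fin l))))
        hlt (by omega) fun i hi => hsub i (by omega)
      rwa [hF.eps_rev, hF.eps_rev, neg_sub_neg] at this
  kill {a b} hrp hP := by
    have hj : j ≠ 0 := fun h => hP (Or.inl h)
    have hkill : ∀ d : Fin (2 * n) → ℂ, (∀ c, d c.rev = -d c) →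
        (∀ c e : Fin (2 * n), (c : ℕ) + j < n + 1 → (e : ℕ) + j < n + 1 → d c = d e) →
        d a ≠ d b → ∃ H : D.cartan, (∀ i ∈ rootsU n j, D.simple i H = 0) ∧
          (H : Mat (2 * n)) a a ≠ (H : Mat (2 * n)) b b := by
      intro d hd hc hne
      refine ⟨⟨_, hF.diagonal_mem hd⟩, fun i hi => ?_, by simpa using hne⟩
      have hi' : (i : ℕ) + j < n := by simpa [rootsU] using hi
      rw [hF.simple_lt_apply i (by omega)]
      simp only [Matrix.diagonal_apply_eq]
      rw [hc ⟨i, by omega⟩ ⟨i + 1, by omega⟩ (by simp; omega) (by simp; omega), sub_self]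
    -- An index in neither block is separated from the others by `antiInd`, which vanishes on the
    -- first block and is therefore killed by all remaining simple roots.
    have hout : ∀ x : Fin (2 * n), ¬ (x : ℕ) + j < n + 1 → ¬ (x.rev : ℕ) + j < n + 1 →
        ∀ c e : Fin (2 * n), (c : ℕ) + j < n + 1 → (e : ℕ) + j < n + 1 →
          (antiInd x c : ℂ) = antiInd x e := by
      intro x h1 h2 c e hc he
      have h3 : ∀ y : Fin (2 * n), (y : ℕ) + j < n + 1 → antiInd x y = 0 := by
        intro y hy
        rw [antiInd, if_neg (fun h : y = x => h1 (h ▸ hy)),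
          if_neg (fun h : y = x.rev => h2 (h ▸ hy)), sub_self]
      rw [h3 c hc, h3 e he]
    have hanti : ∀ x c : Fin (2 * n), ((antiInd x c.rev : ℤ) : ℂ) = -(antiInd x c : ℂ) := by
      intro x c
      rw [antiInd_rev]; push_cast; rfl
    have hself : ∀ x y : Fin (2 * n), x ≠ y → antiInd x x ≠ antiInd x y := by
      intro x y hxy
      have h1 : x ≠ x.rev := fun h => by
        have := congrArg Fin.val h
        rw [Fin.val_rev] at this; omega
      simp only [antiInd, if_neg h1, if_neg (Ne.symm hxy), if_true]
      split_ifs <;> norm_num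
    by_cases ha : (a : ℕ) + j < n + 1 ∨ (a.rev : ℕ) + j < n + 1
    · by_cases hb : (b : ℕ) + j < n + 1 ∨ (b.rev : ℕ) + j < n + 1
      · have ha2 := Fin.val_rev a
        have hb2 := Fin.val_rev b
        have hP' : ¬ ((a : ℕ) + j < n + 1 ∧ (b : ℕ) + j < n + 1) ∧
            ¬ ((a.rev : ℕ) + j < n + 1 ∧ (b.rev : ℕ) + j < n + 1) :=
          ⟨fun h => hP (Or.inr (Or.inl h)), fun h => hP (Or.inr (Or.inr h))⟩
        -- The remaining case has a and b in opposite blocks; the centre of 𝔲(n) distinguishes them.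
        refine hkill (fun c => if (c : ℕ) < n then 1 else -1) (fun c => ?_) (fun c e hc he => ?_) ?_
        · have := Fin.val_rev c
          by_cases h : (c : ℕ) < n
          · rw [if_pos h, if_neg (by omega)]
          · rw [if_neg h, if_pos (by omega), neg_neg]
        · rw [if_pos (by omega), if_pos (by omega)]
        · by_cases h : (a : ℕ) < n
          · rw [if_pos h, if_neg (by omega)]; norm_num
          · rw [if_neg h, if_pos (by omega)]; norm_num
      · push Not at hb
        refine hkill _ (hanti b) (hout b (by omega) (by omega)) ?_
        exact_mod_cast (hself b a hrp.1.symm).symm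
    · push Not at ha
      refine hkill _ (hanti a) (hout a (by omega) (by omega)) ?_
      exact_mod_cast hself a b hrp.1

lemma rhoStepU_mem (t : ℕ) : rhoStepU n t ∈ D.cartan :=
  hF.diagonal_mem fun a => by rw [Fin.rev_rev]; ring

lemma const_of_kill {t : ℕ} (ht : t ≤ n) {H : D.cartan}
    (hH : ∀ i : Fin l, (i : ℕ) + 1 < t → D.simple i H = 0) (hn : 0 < 2 * n) (a : Fin (2 * n))
    (ha : (a : ℕ) < t) : (H : Mat (2 * n)) a a = (H : Mat (2 * n)) ⟨0, hn⟩ ⟨0, hn⟩ := by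
  have hl := hF.card
  have hc := const_of_consecutive (s := t)
    (f := fun a => if h : a < 2 * n then (H : Mat (2 * n)) ⟨a, h⟩ ⟨a, h⟩ else 0) (fun i hi => by
      have := hH ⟨i, by omega⟩ hi
      rw [hF.simple_lt_apply _ (by simp; omega)] at this
      simp only [show i < 2 * n by omega, show i + 1 < 2 * n by omega, dif_pos]
      exact sub_eq_zero.1 this) a ha
  have h2 : 0 < n := by omega
  simpa [h2] using hc

/-- Elements of the Cartan subalgebra are antisymmetric under reflection, so the two halves of the
diagonal contribute equally. This reduces orthogonality to the computation `sum_step_mul` of type A.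
-/
lemma trace_anti_mul (v : Fin (2 * n) → ℂ) (H : D.cartan) :
    Matrix.trace ((Matrix.diagonal fun a => v a - v a.rev) * (H : Mat (2 * n))) =
      2 * ∑ a, v a * (H : Mat (2 * n)) a a := by
  rw [trace_diagonal_mul]
  have h := Equiv.sum_comp (Fin.revPerm (n := 2 * n)) fun a => v a * (H : Mat (2 * n)) a a
  simp only [Fin.revPerm_apply, hF.apply_rev H.2.1, mul_neg, Finset.sum_neg_distrib] at h
  simp only [sub_mul, Finset.sum_sub_distrib]
  linear_combination h

lemma rhoStepU_gen {j : ℕ} (hj : 1 ≤ j) (hjn : j < n) : D.IsCentralGenerator (rootsU n j)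
    (rootsU n (j + 1)) ⟨rhoStepU n (n + 1 - j), hF.rhoStepU_mem _⟩ := by
  have hl := hF.card
  have hval : ∀ a : Fin (2 * n), (a : ℕ) + j < n + 1 →
      rhoStepU n (n + 1 - j) a a = Complex.I / ((n + 1 - j : ℕ) : ℂ) -
        if (a : ℕ) + 1 = n + 1 - j then Complex.I else 0 := by
    intro a ha
    have h1 := Fin.val_rev a
    simp only [rhoStepU, Matrix.diagonal_apply_eq]
    rw [if_pos (by omega), if_neg (c := (a.rev : ℕ) < n + 1 - j) (by omega),
      if_neg (c := (a.rev : ℕ) + 1 = n + 1 - j) (by omega), sub_zero, sub_zero]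
  refine ⟨mem_compact.2 ⟨(hF.rhoStepU_mem _).1, star_diagonal_of_skew fun a => ?_⟩, fun i hi => ?_,
    fun i hi => ?_, fun H hH => ?_⟩
  · rw [star_sub, star_sub, star_sub, star_ite_I_div, star_ite_I, star_ite_I_div, star_ite_I]
    ring
  · have hi' : (i : ℕ) + (j + 1) < n := by simpa [rootsU] using hi
    rw [hF.simple_lt_apply i (by omega)]
    dsimp only
    rw [hval _ (by simp; omega), hval _ (by simp; omega), if_neg (by simp; omega),
      if_neg (by simp; omega), sub_self]
  · have hi' : (i : ℕ) + j < n ∧ n ≤ (i : ℕ) + (j + 1) := by simpa [rootsU] using hi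
    rw [hF.simple_lt_apply i (by omega)]
    dsimp only
    rw [hval _ (by simp; omega), hval _ (by simp; omega), if_neg (by simp; omega),
      if_pos (by simp; omega)]
    ring
  · change Matrix.trace (rhoStepU n (n + 1 - j) * _) = 0
    have hn : 0 < 2 * n := by omega
    rw [rhoStepU, hF.trace_anti_mul (fun a => (if (a : ℕ) < n + 1 - j then
      Complex.I / ((n + 1 - j : ℕ) : ℂ) else 0) - if (a : ℕ) + 1 = n + 1 - j then Complex.I else 0),
      sum_step_mul (by omega) (by omega) (x := (H : Mat (2 * n)) ⟨0, hn⟩ ⟨0, hn⟩), mul_zero]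
    exact fun a ha => hF.const_of_kill (t := n + 1 - j) (by omega)
      (fun i hi => hH i (by simp [rootsU]; omega)) hn a ha

lemma rhoU_mem : rhoU n ∈ D.cartan := hF.diagonal_mem fun a => by
  have := Fin.val_rev a
  by_cases h : (a : ℕ) < n
  · rw [if_pos h, if_neg (by omega)]
  · rw [if_neg h, if_pos (by omega), neg_neg]

lemma rhoU_mem_compact : rhoU n ∈ D.compact :=
  mem_compact.2 ⟨hF.rhoU_mem.1, star_diagonal_of_skew fun a => by split_ifs <;> simp [neg_div]⟩

lemma rhoU_gen : D.IsCentralGenerator Finset.univ (rootsU n 1) ⟨rhoU n, hF.rhoU_mem⟩ := by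
  have hl := hF.card
  have hlt : ∀ a : Fin (2 * n), (a : ℕ) < n → rhoU n a a = Complex.I / 2 := fun a ha => by
    simp [rhoU, ha]
  refine ⟨hF.rhoU_mem_compact, fun i hi => ?_, fun i hi => ?_, fun H hH => ?_⟩
  · have hi' : (i : ℕ) + 1 < n := by simpa [rootsU] using hi
    rw [hF.simple_lt_apply i hi']
    dsimp only
    rw [hlt _ (by simp; omega), hlt _ (by simpa using hi'), sub_self]
  · have hi' : n ≤ (i : ℕ) + 1 := by simpa [rootsU] using hi
    obtain ⟨x, hx, h⟩ := hF.simple_last i (by omega)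
    rw [h, LinearMap.add_apply, eps_nat (by omega), eps_nat (by omega)]
    dsimp only
    rw [hlt _ (by simp; omega), hlt _ (by simpa using hx), add_halves]
  · by_cases hn : n = 0
    · subst hn
      simp [Matrix.trace]
    have hn' : 0 < 2 * n := by omega
    have hc := hF.const_of_kill le_rfl (fun i _ => hH i (Finset.mem_univ i)) hn'
    -- The first n entries of H are equal, and the last simple root is a sum of two of them; its
    -- vanishing makes them all zero, so the centre is trivial.
    obtain ⟨x, hx, h⟩ := hF.simple_last ⟨n - 1, by omega⟩ (by simp; omega)
    have h0 := hH ⟨n - 1, by omega⟩ (Finset.mem_univ _)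
    rw [h, LinearMap.add_apply, eps_nat (by simp; omega), eps_nat (by omega),
      hc ⟨n - 1, _⟩ (by simp; omega), hc ⟨x, _⟩ hx, add_self_eq_zero] at h0
    change Matrix.trace (rhoU n * _) = 0
    rw [rhoU, trace_diagonal_mul]
    refine Finset.sum_eq_zero fun a _ => ?_
    by_cases ha : (a : ℕ) < n
    · rw [hc a ha, h0, mul_zero]
    · have := Fin.val_rev a
      have h2 := hF.apply_rev H.2.1 a
      rw [hc a.rev (by omega), h0] at h2
      rw [← neg_eq_zero.1 h2.symm, neg_eq_zero.1 h2.symm, mul_zero]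

lemma isIrred_wU {j : ℕ} (hj : 1 ≤ j) (hjn : j ≤ n) :
    IsIrred (fund (2 * n)) (D.levi (rootsU n j)) (wU n j) := by
  refine isIrred_fund_of_complete hF.isStandard (hF.hasBlocks j) (a0 := ⟨0, by omega⟩)
    (Or.inr (by simp; omega)) blocksU_inv fun x y hx hy hxy => ?_
  have hx' := hx.resolve_left (by omega)
  have hy' := hy.resolve_left (by omega)
  refine ⟨⟨hxy, fun h => ?_⟩, Or.inr (Or.inl ⟨hx', hy'⟩)⟩
  have := Fin.val_rev x
  rw [← h] at this
  omega

lemma isMinimal_step {j : ℕ} (hj : 1 ≤ j) (hjn : j < n) :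
    D.IsMinimal (fund (2 * n)) (rootsU n j) (rootsU n (j + 1)) (rhoStepU n (n + 1 - j))
      (Complex.I / ((n + 1 - j : ℕ) : ℂ)) (wU n j) (wU n (j + 1))
      (coordSub fun a : Fin (2 * n) => (a : ℕ) + 1 = n + 1 - j) := by
  refine isMinimal_fund hF.isStandard (hF.hasBlocks j) _ (hF.rhoStepU_gen hj hjn)
    (hF.isIrred_wU hj hjn.le) (hF.isIrred_wU (by omega) (by omega)) (fun x => by omega)
    (fun x hx => ?_) (fun x hx => ?_) ⟨⟨n - j, by omega⟩, by simp; omega⟩ (a0 := ⟨0, by omega⟩)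
    (by simp; omega) rfl
  · have := Fin.val_rev x
    simp only [rhoStepU, Matrix.diagonal_apply_eq]
    rw [if_pos (by omega), if_neg (by omega), if_neg (by omega), if_neg (by omega)]
    simp
  · have := Fin.val_rev x
    simp only [rhoStepU, Matrix.diagonal_apply_eq]
    rw [if_pos (by omega), if_pos (by omega), if_neg (by omega), if_neg (by omega)]
    simp

lemma isNoncompact_zero : D.IsNoncompact Finset.univ (rootsU n 1) := by
  obtain ⟨-, h0, h1, -⟩ := hF.rhoU_gen
  rw [← rootsU_zero hF.card] at h1 ⊢
  exact isNoncompact_of_rho hF.isStandard (hF.hasBlocks 0) h0 h1 fun a b _ _ => rhoU_sub a b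

lemma isNoncompact_step {j : ℕ} (hj : 1 ≤ j) (hjn : j < n) :
    D.IsNoncompact (rootsU n j) (rootsU n (j + 1)) := by
  obtain ⟨-, h0, h1, -⟩ := hF.rhoStepU_gen hj hjn
  refine isNoncompact_of_rho hF.isStandard (hF.hasBlocks j) h0 h1 fun a b _ hP => ?_
  have ha := Fin.val_rev a
  have hb := Fin.val_rev b
  simp only [rhoStepU, Matrix.diagonal_apply_eq]
  rcases hP with h | h | h
  · omega
  · rw [if_pos (c := (a : ℕ) < n + 1 - j) (by omega), if_pos (c := (b : ℕ) < n + 1 - j) (by omega),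
      if_neg (c := (a.rev : ℕ) < n + 1 - j) (by omega),
      if_neg (c := (b.rev : ℕ) < n + 1 - j) (by omega),
      if_neg (c := (a.rev : ℕ) + 1 = n + 1 - j) (by omega),
      if_neg (c := (b.rev : ℕ) + 1 = n + 1 - j) (by omega)]
    split_ifs <;> simp
  · rw [if_neg (c := (a : ℕ) < n + 1 - j) (by omega), if_neg (c := (b : ℕ) < n + 1 - j) (by omega),
      if_pos (c := (a.rev : ℕ) < n + 1 - j) (by omega),
      if_pos (c := (b.rev : ℕ) < n + 1 - j) (by omega),
      if_neg (c := (a : ℕ) + 1 = n + 1 - j) (by omega),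
      if_neg (c := (b : ℕ) + 1 = n + 1 - j) (by omega), sub_self, zero_sub,
      zero_sub, neg_sub_neg, sub_sub_sub_cancel_left]
    split_ifs <;> simp

theorem isThimmChain : D.IsThimmChain n (rootsU n) (chainU n D.compact) := by
  have hl := hF.card
  refine isThimmChain_of_blocks hF.isStandard (P := blocksU n) (rootsU_zero hl)
    (blockSub_eq_self fun a b => Or.inl rfl) ?_ (fun j _ => hF.hasBlocks j) (fun _ _ => rfl)
    fun j hj => ⟨?_, ?_⟩
  · ext i; simp [rootsU]
  · refine Finset.ssubset_iff_subset_ne.2 ⟨fun i => by simp [rootsU]; omega, fun h => ?_⟩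
    have : (⟨n - 1 - j, by omega⟩ : Fin l) ∈ rootsU n (j + 1) := by
      rw [h]; simp [rootsU]; omega
    simp [rootsU] at this
    omega
  · rcases Nat.eq_zero_or_pos j with rfl | h
    · rw [rootsU_zero hl]; exact hF.isNoncompact_zero
    · exact hF.isNoncompact_step h hj

/-- The families CI and DIII differ only in the irreducibility of ℂ^{2n}, which is fed in as
connectedness of the root graph by `hconn`. -/
theorem theorem_of_connected {c : ℝ} (hc : c ≠ 0) (hn : 1 ≤ n)
    (hconn : ∀ x y : Fin (2 * n), x ≠ y →
      Relation.ReflTransGen (fun x y => formRp s y x) x y) :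
    D.IsRootData ∧
    D.IsRep (fund (2 * n)) ∧
    D.IsNoncompact Finset.univ (allBut l (n - 1)) ∧
    D.IsMinimal (fund (2 * n)) Finset.univ (allBut l (n - 1)) (rhoU n)
      (Complex.I / 2) ⊤ (coordSub fun a => (a : ℕ) < n) (coordSub fun a => n ≤ (a : ℕ)) ∧
    D.IsThimmChain n (rootsU n) (chainU n D.compact) ∧
    wU n 0 = ⊤ ∧
    D.IsMinimalForChain (fund (2 * n)) n (rootsU n) (wU n) ∧
    ∀ j ≤ n, NijenhuisFormula D c (rhoU n) (fund (2 * n)) (chainU n D.compact j) (wU n j) 1 := by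
  have hl := hF.card
  have htop : wU n 0 = ⊤ := coordSub_eq_top fun a => Or.inl rfl
  have hw1 : wU n 1 = coordSub fun a : Fin (2 * n) => (a : ℕ) < n := by
    rw [wU]; congr 1; funext a; simp
  have hirr0 : IsIrred (fund (2 * n)) (D.levi (rootsU n 0)) (wU n 0) := by
    have hedge : ∀ x y : Fin (2 * n),
        Relation.ReflTransGen (D.Edge (blocksU n 0) (fund (2 * n))) x y := by
      intro x y
      by_cases hxy : x = y
      · rw [hxy]
      · exact Relation.ReflTransGen.mono (fun a b h =>
          (hF.hasBlocks 0).edge_fund hF.isStandard h (Or.inl rfl)) _ _ (hconn x y hxy)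
    exact isIrred_fund hF.isStandard (hF.hasBlocks 0) (a0 := ⟨0, by omega⟩) (Or.inl rfl)
      (fun _ _ _ _ => Or.inl rfl) fun x _ => ⟨hedge _ _, hedge _ _⟩
  have hmin : D.IsMinimal (fund (2 * n)) (rootsU n 0) (rootsU n 1) (rhoU n) (Complex.I / 2)
      (wU n 0) (wU n 1) (coordSub fun a => n ≤ (a : ℕ)) := by
    have hgen := hF.rhoU_gen
    rw [← rootsU_zero hl] at hgen
    refine isMinimal_fund hF.isStandard (hF.hasBlocks 0) hF.rhoU_mem hgen hirr0
      (hF.isIrred_wU le_rfl hn) (fun x => by omega) (fun x hx => ?_) (fun x hx => ?_)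
      ⟨⟨n, by omega⟩, le_rfl⟩ (a0 := ⟨0, by omega⟩) (by simp; omega) rfl
    · simp only [rhoU, Matrix.diagonal_apply_eq]
      rw [if_pos (by omega)]
    · simp only [rhoU, Matrix.diagonal_apply_eq]
      rw [if_neg (by omega)]
      ring
  refine ⟨hF.isStandard.isRootData, isRep_fund, ?_, ?_, hF.isThimmChain, htop, fun j hj => ?_,
    fun j hj => ?_⟩
  · rw [← rootsU_one hl]; exact hF.isNoncompact_zero
  · rw [← rootsU_one hl, ← hw1, ← htop, ← rootsU_zero hl]; exact hmin
  · rcases Nat.eq_zero_or_pos j with rfl | h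
    · exact ⟨_, _, _, hmin⟩
    · exact ⟨_, _, _, hF.isMinimal_step h hj⟩
  · rw [show (1 : ℂ) = -2 * Complex.I * (Complex.I / 2) by
      linear_combination Complex.I_mul_I]
    refine nijenhuisFormula_fund (A := fun a : Fin (2 * n) => j = 0 ∨ (a : ℕ) + j < n + 1)
      (P := blocksU n j) hF.isStandard hc hF.rhoU_mem hF.rhoU_mem_compact (fun a b _ hab => ?_)
      hF.conj_mem (fun a => ?_) (hF.hasBlocks j).symm (hF.blk_mem fun a b => ?_) blocksU_inv
      (fun x y hx hy _ => ?_) (fun x y hxy hx => ?_)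
    · have : (a : ℕ) < b := hab
      simp only [rhoU, Matrix.diagonal_apply_eq]
      by_cases h : (b : ℕ) < n
      · rw [if_pos h, if_pos (by omega), sub_self]; exact Or.inl rfl
      · rw [if_neg h]
        split_ifs
        · right; ring
        · simp
    · simp only [rhoU, Matrix.diagonal_apply_eq]
      split_ifs
      · exact Or.inl rfl
      · right; ring
    · simp only [blocksU, Fin.rev_rev]
      tauto
    · rcases hx with h | h
      · exact Or.inl h
      · exact hy.elim Or.inl fun h' => Or.inr (Or.inl ⟨h', h⟩)
    · have : (y : ℕ) < x := hxy
      omega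

end IsFormU

end FormA

end

end HermSym

/-! ### Simple roots and root data of types C, B and D. -/

namespace HermSym

noncomputable section

open Datum

lemma eps_diagonal {N : ℕ} {g : Submodule ℂ (Mat N)} {u : ℕ → ℂ}
    (h : Matrix.diagonal (antiExt N u) ∈ cartanOf g) {a : ℕ} (ha : 2 * a + 1 < N) :
    eps g a ⟨_, h⟩ = u a := by
  rw [eps_nat (by omega)]
  change Matrix.diagonal (antiExt N u) _ _ = _
  rw [Matrix.diagonal_apply_eq, antiExt, if_pos ha]

lemma star_mul_of_mem_specialUnitary {N : ℕ} {k : Mat N}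
    (hk : k ∈ Matrix.specialUnitaryGroup (Fin N) ℂ) : star k * k = 1 ∧ k * star k = 1 :=
  Unitary.mem_iff.1 (Matrix.mem_specialUnitaryGroup_iff.1 hk).1

section TypeC

variable {n : ℕ}

lemma halfSign_rev (a : Fin (2 * n)) : halfSign n a.rev = -1 * halfSign n a := by
  have := Fin.val_rev a
  simp only [halfSign]
  by_cases h : (a : ℕ) < n
  · rw [if_pos h, if_neg (by omega)]; ring
  · rw [if_neg h, if_pos (by omega)]; ring

lemma halfSign_sq (a : Fin (2 * n)) : halfSign n a * halfSign n a = 1 := by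
  simp only [halfSign]; split_ifs <;> ring

lemma halfSign_rp {a b : Fin (2 * n)} (h : b = a.rev) : halfSign n a * halfSign n b = -1 := by
  rw [h, halfSign_rev]
  linear_combination -halfSign_sq a

lemma typeC_mem_pos (p : Fin (2 * n) × Fin (2 * n)) : p ∈ (typeC n).pos ↔
    p.1 < p.2 ∧ p.2 ≤ p.1.rev ∧ (p.2 = p.1.rev → halfSign n p.1 * halfSign n p.2 = -1) := by
  simp only [typeC, Finset.mem_filter, Finset.mem_univ, true_and]
  exact and_congr_right fun _ => ⟨fun h => ⟨h, halfSign_rp⟩, And.left⟩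

lemma typeC_simple_lt {i : Fin n} (hi : (i : ℕ) + 1 < n) : (typeC n).simple i =
    eps (typeC n).g (i : ℕ) - eps (typeC n).g ((i : ℕ) + 1) := if_pos hi

lemma typeC_simple_last {i : Fin n} (hi : (i : ℕ) + 1 = n) : (typeC n).simple i =
    (2 : ℂ) • eps (typeC n).g (i : ℕ) := if_neg (by omega)

lemma typeC_base : IsFormBase (typeC n) (halfSign n) (-1) where
  g_eq := rfl
  sq := halfSign_sq
  star_s a := by simp only [halfSign]; split_ifs <;> simp
  rev := halfSign_rev
  ε_sq := by norm_num

theorem typeC_isForm : IsFormU (typeC n) (halfSign n) (-1) where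
  toIsFormBase := typeC_base
  mem_pos := typeC_mem_pos
  e_eq _ := rfl
  simple_ex i := by
    by_cases hi : (i : ℕ) + 1 < n
    · exact ⟨⟨i, by omega⟩, ⟨i + 1, by omega⟩, by simp, ⟨by simp, halfSign_rp⟩,
        typeC_simple_lt hi⟩
    · refine ⟨⟨i, by omega⟩, ⟨i + 1, by omega⟩, by simp, ⟨by simp, halfSign_rp⟩, ?_⟩
      rw [typeC_simple_last (by omega), two_smul]
      simp only
      rw [eps_add_eq_zero typeC_base (a := i) (b := i + 1) (by omega), sub_neg_eq_add]
  simple_indep := by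
    -- The fundamental coweights of type C; the last one is halved because the last simple root is
    -- 2ε.
    refine linearIndependent_of_apply _ (fun j => ⟨_, typeC_base.diagonal_mem (antiExt_rev
      fun a => if (j : ℕ) + 1 = n then 1 / 2 else if a ≤ j then 1 else 0)⟩) fun i j => ?_
    by_cases hi : (i : ℕ) + 1 < n
    · rw [typeC_simple_lt hi, LinearMap.sub_apply, eps_diagonal _ (by omega),
        eps_diagonal _ (by omega)]
      simp only [Fin.ext_iff]
      grind
    · rw [typeC_simple_last (by omega), LinearMap.smul_apply, eps_diagonal _ (by omega)]
      simp only [Fin.ext_iff, smul_eq_mul]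
      grind
  closure_mem {a b} _ hab hN := by
    have hab' : (a : ℕ) < b := hab
    set C := AddSubmonoid.closure
      ((typeC n).simple '' ((Finset.univ : Finset (Fin n)) : Set (Fin n))) with hC
    have hs : ∀ i, (typeC n).simple i ∈ C := fun i =>
      AddSubmonoid.subset_closure ⟨i, by simp, rfl⟩
    have hsub : ∀ x y : ℕ, x ≤ y → y < n → eps (typeC n).g x - eps (typeC n).g y ∈ C := by
      intro x y hxy hy
      refine sub_mem_of_consecutive C (fun i => eps (typeC n).g i) hxy fun i _ hi => ?_
      have := hs ⟨i, by omega⟩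
      rwa [typeC_simple_lt (by simp; omega)] at this
    by_cases hb : (b : ℕ) < n
    · exact hsub a b hab'.le hb
    · have h1 := hsub a (n - 1) (by omega) (by omega)
      have h2 := hsub (2 * n - 1 - b) (n - 1) (by omega) (by omega)
      -- With b' the reflection of b, ε_a + ε_b' = (ε_a − ε_{n−1}) + (ε_b' − ε_{n−1}) + 2ε_{n−1}.
      have h3 := hs ⟨n - 1, by omega⟩
      rw [typeC_simple_last (by simp; omega)] at h3
      have h4 := C.add_mem (C.add_mem h1 h2) h3
      rw [eps_add_eq_zero typeC_base (a := 2 * n - 1 - b) (b := b) (by omega)]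
      convert h4 using 1
      module
  card := rfl
  simple_lt _ := typeC_simple_lt
  simple_last i hi := ⟨i, by omega, by rw [typeC_simple_last hi, two_smul]⟩
  conj k hk := ⟨(star_mul_of_mem_specialUnitary hk.1).1, (star_mul_of_mem_specialUnitary hk.1).2,
    hk.2⟩

end TypeC

section TypeBD

variable {N : ℕ}

lemma typeBD_base : IsFormBase (typeBD N) (fun _ => 1) 1 where
  g_eq := rfl
  sq _ := by norm_num
  star_s _ := by simp
  rev _ := by norm_num
  ε_sq := by norm_num

lemma formRp_one {a b : Fin N} : formRp (fun _ => 1) a b ↔ a ≠ b ∧ b ≠ a.rev := by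
  simp only [formRp]
  norm_num

lemma typeBD_mem_pos (p : Fin N × Fin N) : p ∈ (typeBD N).pos ↔
    p.1 < p.2 ∧ p.2 ≤ p.1.rev ∧ (p.2 = p.1.rev → (1 : ℂ) * 1 = -1) := by
  simp only [typeBD, Finset.mem_filter, Finset.mem_univ, true_and]
  norm_num
  exact fun _ => lt_iff_le_and_ne

lemma typeBD_e (p : Fin N × Fin N) : (typeBD N).e p = formRoot (fun _ => 1) p.1 p.2 := by
  simp [typeBD, formRoot]

lemma typeBD_simple_lt {i : Fin (N / 2)} (hi : (i : ℕ) + 1 < N / 2) : (typeBD N).simple i =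
    eps (typeBD N).g (i : ℕ) - eps (typeBD N).g ((i : ℕ) + 1) := if_pos hi

lemma typeBD_simple_even {i : Fin (N / 2)} (hi : (i : ℕ) + 1 = N / 2) (hN : Even N) :
    (typeBD N).simple i = eps (typeBD N).g ((i : ℕ) - 1) + eps (typeBD N).g (i : ℕ) :=
  (if_neg (by omega)).trans (if_pos hN)

lemma typeBD_simple_odd {i : Fin (N / 2)} (hi : (i : ℕ) + 1 = N / 2) (hN : Odd N) :
    (typeBD N).simple i = eps (typeBD N).g (i : ℕ) :=
  (if_neg (by omega)).trans (if_neg (Nat.not_even_iff_odd.2 hN))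

lemma eps_mid (hN : Odd N) : eps (typeBD N).g (N / 2) = 0 := by
  have := eps_add_eq_zero (typeBD_base (N := N)) (a := N / 2) (b := N / 2) (by
    obtain ⟨m, rfl⟩ := hN; omega)
  ext H
  have h := LinearMap.congr_fun this H
  rw [LinearMap.neg_apply] at h
  rw [LinearMap.zero_apply]
  linear_combination h / 2

lemma rootsBD_zero (hN : 3 ≤ N) : rootsBD N 0 = Finset.univ := by
  ext i; simp [rootsBD, show 2 < N by omega]

/-- One statement serves both purposes: j = 0 gives the base of the root system, and general j the
roots of the Levi subalgebra. The condition 2j + 2 < N built into `rootsBD` holds automatically as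
soon as such a root exists. -/
lemma eps_sub_mem_closure_rootsBD {j : ℕ} {a b : Fin N} (hab : a < b) (hrev : b ≠ a.rev)
    (hj : j ≤ (a : ℕ)) (hN : (a : ℕ) + b < N) :
    eps (typeBD N).g (a : ℕ) - eps (typeBD N).g (b : ℕ) ∈
      AddSubmonoid.closure ((typeBD N).simple '' (rootsBD N j : Set (Fin (N / 2)))) := by
  have hab' : (a : ℕ) < b := hab
  have hN' : (a : ℕ) + b + 1 < N := by
    have : (b : ℕ) ≠ a.rev := fun h => hrev (Fin.ext h)
    rw [Fin.val_rev] at this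
    omega
  set C := AddSubmonoid.closure ((typeBD N).simple '' (rootsBD N j : Set (Fin (N / 2))))
  have hs : ∀ i : Fin (N / 2), j ≤ (i : ℕ) → (typeBD N).simple i ∈ C := fun i hi =>
    AddSubmonoid.subset_closure ⟨i, by simp [rootsBD]; omega, rfl⟩
  have hsub : ∀ x y : ℕ, j ≤ x → x ≤ y → y < N / 2 →
      eps (typeBD N).g x - eps (typeBD N).g y ∈ C := by
    intro x y hjx hxy hy
    refine sub_mem_of_consecutive C (fun i => eps (typeBD N).g i) hxy fun i hi hi' => ?_
    have := hs ⟨i, by omega⟩ (by simp; omega)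
    rwa [typeBD_simple_lt (by simp; omega)] at this
  by_cases hb : (b : ℕ) < N / 2
  · exact hsub a b hj hab'.le hb
  rcases Nat.even_or_odd N with he | ho
  · have he' : 2 * (N / 2) = N := Nat.two_mul_div_two_of_even he
    rw [eps_add_eq_zero typeBD_base (a := N - 1 - b) (b := b) (by omega)]
    -- With b' the reflection of b and m = N/2, ε_a + ε_b' = (ε_a − ε_{m−2}) + (ε_b' − ε_{m−1}) +
    -- (ε_{m−2} + ε_{m−1}); here b' > a keeps a ≤ m − 2.
    have h1 := hsub a (N / 2 - 2) hj (by omega) (by omega)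
    have h2 := hsub (N - 1 - b) (N / 2 - 1) (by omega) (by omega) (by omega)
    have h3 := hs ⟨N / 2 - 1, by omega⟩ (by simp; omega)
    rw [typeBD_simple_even (by simp; omega) he] at h3
    have h4 := C.add_mem (C.add_mem h1 h2) h3
    convert h4 using 1
    simp only [Nat.sub_sub]
    abel
  · have ho' : 2 * (N / 2) + 1 = N := Nat.two_mul_div_two_add_one_of_odd ho
    have h3 := hs ⟨N / 2 - 1, by omega⟩ (by simp; omega)
    rw [typeBD_simple_odd (by simp; omega) ho] at h3
    have hpos : ∀ x : ℕ, j ≤ x → x < N / 2 → eps (typeBD N).g x ∈ C := by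
      intro x hx hx'
      have := C.add_mem (hsub x (N / 2 - 1) hx (by omega) (by omega)) h3
      simpa using this
    by_cases hb' : (b : ℕ) = N / 2
    · rw [hb', eps_mid ho, sub_zero]
      exact hpos a hj (by omega)
    · rw [eps_add_eq_zero typeBD_base (a := N - 1 - b) (b := b) (by omega), sub_neg_eq_add]
      exact C.add_mem (hpos a hj (by omega)) (hpos _ (by omega) (by omega))

theorem typeBD_isForm (hN : 3 ≤ N) : IsForm (typeBD N) (fun _ => 1) 1 where
  toIsFormBase := typeBD_base
  mem_pos := typeBD_mem_pos
  e_eq := typeBD_e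
  simple_ex i := by
    have := i.2
    by_cases hi : (i : ℕ) + 1 < N / 2
    · refine ⟨⟨i, by omega⟩, ⟨i + 1, by omega⟩, by simp, formRp_one.2 ⟨by simp, fun h => ?_⟩,
        typeBD_simple_lt hi⟩
      have := congrArg Fin.val h
      simp only [Fin.val_rev] at this
      omega
    rcases Nat.even_or_odd N with he | ho
    · have he' : 2 * (N / 2) = N := Nat.two_mul_div_two_of_even he
      refine ⟨⟨i - 1, by omega⟩, ⟨i + 1, by omega⟩, Fin.mk_lt_mk.2 (by omega),
        formRp_one.2 ⟨by simp, fun h => ?_⟩, ?_⟩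
      · have := congrArg Fin.val h
        simp only [Fin.val_rev] at this
        omega
      · simp only
        rw [typeBD_simple_even (by omega) he,
          eps_add_eq_zero typeBD_base (a := i) (b := i + 1) (by omega), sub_neg_eq_add]
    · have ho' : 2 * (N / 2) + 1 = N := Nat.two_mul_div_two_add_one_of_odd ho
      refine ⟨⟨i, by omega⟩, ⟨i + 1, by omega⟩, by simp, formRp_one.2 ⟨by simp, fun h => ?_⟩, ?_⟩
      · have := congrArg Fin.val h
        simp only [Fin.val_rev] at this
        omega
      · simp only
        rw [typeBD_simple_odd (by omega) ho, show (i : ℕ) + 1 = N / 2 by omega, eps_mid ho,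
          sub_zero]
  simple_indep := by
    rcases Nat.even_or_odd N with he | ho
    · have he' : 2 * (N / 2) = N := Nat.two_mul_div_two_of_even he
      -- The fundamental coweights of type D. The two spin nodes give (½, …, ½, −½) and (½, …, ½).
      refine linearIndependent_of_apply _ (fun j => ⟨_, typeBD_base.diagonal_mem (antiExt_rev
        fun a => if (j : ℕ) + 1 = N / 2 then 1 / 2 else if (j : ℕ) + 2 = N / 2 then
          (if a + 1 = N / 2 then -(1 / 2) else 1 / 2) else if a ≤ j then 1 else 0)⟩) fun i j => ?_
      by_cases hi : (i : ℕ) + 1 < N / 2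
      · rw [typeBD_simple_lt hi, LinearMap.sub_apply, eps_diagonal _ (by omega),
          eps_diagonal _ (by omega)]
        simp only [Fin.ext_iff]
        grind
      · rw [typeBD_simple_even (by omega) he, LinearMap.add_apply, eps_diagonal _ (by omega),
          eps_diagonal _ (by omega)]
        simp only [Fin.ext_iff]
        grind
    · have ho' : 2 * (N / 2) + 1 = N := Nat.two_mul_div_two_add_one_of_odd ho
      refine linearIndependent_of_apply _ (fun j => ⟨_, typeBD_base.diagonal_mem (antiExt_rev
        fun a => if a ≤ j then 1 else 0)⟩) fun i j => ?_
      by_cases hi : (i : ℕ) + 1 < N / 2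
      · rw [typeBD_simple_lt hi, LinearMap.sub_apply, eps_diagonal _ (by omega),
          eps_diagonal _ (by omega)]
        simp only [Fin.ext_iff]
        grind
      · rw [typeBD_simple_odd (by omega) ho, eps_diagonal _ (by omega)]
        simp only [Fin.ext_iff]
        grind
  closure_mem {a b} h hab h' := by
    rw [← rootsBD_zero hN]
    exact eps_sub_mem_closure_rootsBD hab (formRp_one.1 h).2 (Nat.zero_le _) h'

lemma typeBD_conj : ∀ k ∈ (typeBD N).K, star k * k = 1 ∧ k * star k = 1 ∧
    kᵀ * formMat (fun _ => 1) * k = formMat fun _ => 1 := fun _ hk =>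
  ⟨(star_mul_of_mem_specialUnitary hk.1).1, (star_mul_of_mem_specialUnitary hk.1).2, hk.2⟩

theorem typeBD_isFormU {n : ℕ} (hn : 2 ≤ n) : IsFormU (typeBD (2 * n)) (fun _ => 1) 1 where
  toIsForm := typeBD_isForm (by omega)
  card := by omega
  simple_lt i hi := typeBD_simple_lt (by omega)
  simple_last i hi := ⟨i - 1, by omega, by
    rw [typeBD_simple_even (by omega) (even_two_mul n), add_comm]⟩
  conj := typeBD_conj

end TypeBD

theorem typeC_theorem {c : ℝ} (hc : c ≠ 0) {n : ℕ} (hn : 1 ≤ n) :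
    (typeC n).IsRootData ∧
    (typeC n).IsRep (fund (2 * n)) ∧
    (typeC n).IsNoncompact Finset.univ (allBut n (n - 1)) ∧
    (typeC n).IsMinimal (fund (2 * n)) Finset.univ (allBut n (n - 1)) (rhoU n)
      (Complex.I / 2) ⊤ (coordSub fun a => (a : ℕ) < n) (coordSub fun a => n ≤ (a : ℕ)) ∧
    (typeC n).IsThimmChain n (rootsU n) (chainU n (typeC n).compact) ∧
    wU n 0 = ⊤ ∧
    (typeC n).IsMinimalForChain (fund (2 * n)) n (rootsU n) (wU n) ∧
    ∀ j ≤ n, NijenhuisFormula (typeC n) c (rhoU n) (fund (2 * n))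
      (chainU n (typeC n).compact j) (wU n j) 1 :=
  typeC_isForm.theorem_of_connected hc hn fun _ _ hxy =>
    Relation.ReflTransGen.single ⟨hxy.symm, halfSign_rp⟩

theorem typeD_theorem {c : ℝ} (hc : c ≠ 0) {n : ℕ} (hn : 2 ≤ n) :
    (typeBD (2 * n)).IsRootData ∧
    (typeBD (2 * n)).IsRep (fund (2 * n)) ∧
    (typeBD (2 * n)).IsNoncompact Finset.univ (allBut (2 * n / 2) (n - 1)) ∧
    (typeBD (2 * n)).IsMinimal (fund (2 * n)) Finset.univ (allBut (2 * n / 2) (n - 1)) (rhoU n)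
      (Complex.I / 2) ⊤ (coordSub fun a => (a : ℕ) < n) (coordSub fun a => n ≤ (a : ℕ)) ∧
    (typeBD (2 * n)).IsThimmChain n (rootsU n) (chainU n (typeBD (2 * n)).compact) ∧
    wU n 0 = ⊤ ∧
    (typeBD (2 * n)).IsMinimalForChain (fund (2 * n)) n (rootsU n) (wU n) ∧
    ∀ j ≤ n, NijenhuisFormula (typeBD (2 * n)) c (rhoU n) (fund (2 * n))
      (chainU n (typeBD (2 * n)).compact j) (wU n j) 1 := by
  refine (typeBD_isFormU hn).theorem_of_connected hc (by omega) fun x y hxy => ?_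
  have hx := Fin.val_rev x
  by_cases hy : y = x.rev
  -- In type D the pair (x, rev x) is not a root, so the path passes through a third index, which
  -- exists since n ≥ 2.
  · obtain ⟨c, hc⟩ : ∃ c : Fin (2 * n), c ≠ x ∧ c ≠ x.rev := by
      by_cases h : (x : ℕ) = 0 ∨ (x.rev : ℕ) = 0
      · exact ⟨⟨1, by omega⟩, fun h' => by simp [← h'] at h hx; omega,
          fun h' => by have := congrArg Fin.val h'; simp only at this; omega⟩
      · exact ⟨⟨0, by omega⟩, fun h' => by simp [← h'] at h,
          fun h' => by have := congrArg Fin.val h'; simp only at this; omega⟩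
    have h1 : formRp (fun _ => (1 : ℂ)) c x := formRp_one.2 ⟨hc.1, fun h => hc.2 (by
      rw [h, Fin.rev_rev])⟩
    have h2 : formRp (fun _ => (1 : ℂ)) y c := formRp_one.2 ⟨fun h => hc.2 (by rw [← h, hy]),
      fun h => hc.1 (by rw [h, hy, Fin.rev_rev])⟩
    have h3 : Relation.ReflTransGen (fun x y => formRp (fun _ => (1 : ℂ)) y x) x c :=
      Relation.ReflTransGen.single h1
    exact h3.tail h2
  · exact Relation.ReflTransGen.single (formRp_one.2 ⟨hxy.symm, fun h => hy (by
      rw [h, Fin.rev_rev])⟩)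

end

end HermSym

/-! ### Fock space and Clifford algebra. -/

namespace HermSym

noncomputable section

section Fock

variable {m : ℕ}

lemma annih_apply (i : Fin m) (f : Fock m) (A : Finset (Fin m)) :
    annih i f A = if i ∈ A then 0 else fockSign A i * f (insert i A) := rfl

lemma create_apply (i : Fin m) (f : Fock m) (A : Finset (Fin m)) :
    create i f A = if i ∈ A then fockSign A i * f (A.erase i) else 0 := rfl

lemma parityOp_apply (f : Fock m) (A : Finset (Fin m)) :
    parityOp m f A = (-1) ^ A.card * f A := rfl

lemma fockSign_sq (A : Finset (Fin m)) (i : Fin m) : fockSign A i * fockSign A i = 1 := by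
  rw [fockSign, ← mul_pow, neg_one_mul, neg_neg, one_pow]

lemma fockSign_ne_zero (A : Finset (Fin m)) (i : Fin m) : fockSign A i ≠ 0 :=
  left_ne_zero_of_mul ((fockSign_sq A i).trans_ne one_ne_zero)

lemma fockSign_insert {A : Finset (Fin m)} {i k : Fin m} (hk : k ∉ A) :
    fockSign (insert k A) i = (if k < i then -1 else 1) * fockSign A i := by
  rw [fockSign, fockSign, Finset.filter_insert]
  split_ifs with h
  · rw [Finset.card_insert_of_notMem fun h' => hk (Finset.mem_filter.1 h').1, pow_succ']
  · rw [one_mul]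

lemma fockSign_erase {A : Finset (Fin m)} {i k : Fin m} (hk : k ∈ A) :
    fockSign (A.erase k) i = (if k < i then -1 else 1) * fockSign A i := by
  have h := fockSign_insert (i := i) (Finset.notMem_erase k A)
  rw [Finset.insert_erase hk] at h
  rw [h, ← mul_assoc]
  split_ifs <;> simp

/-- In one of the two orders the first operator changes the sign seen by the second, and in the
other order it does not. The same comparison governs the two relations that follow. -/
lemma annih_annih (i k : Fin m) : annih i * annih k + annih k * annih i = 0 := by
  refine LinearMap.ext fun f => funext fun A => ?_
  simp only [LinearMap.add_apply, Module.End.mul_apply, Pi.add_apply, annih_apply,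
    LinearMap.zero_apply, Pi.zero_apply, Finset.mem_insert]
  by_cases hik : i = k
  · subst hik; simp
  by_cases hi : i ∈ A
  · simp [hi]
  by_cases hk : k ∈ A
  · simp [hk]
  simp only [hi, hk, Ne.symm hik, hik, or_self, if_false]
  rw [fockSign_insert hi, fockSign_insert hk, Finset.insert_comm k i]
  rcases lt_or_gt_of_ne hik with h | h
  · rw [if_pos h, if_neg h.asymm]; ring
  · rw [if_pos h, if_neg h.asymm]; ring

lemma create_create (i k : Fin m) : create i * create k + create k * create i = 0 := by
  refine LinearMap.ext fun f => funext fun A => ?_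
  simp only [LinearMap.add_apply, Module.End.mul_apply, Pi.add_apply, create_apply,
    LinearMap.zero_apply, Pi.zero_apply, Finset.mem_erase]
  by_cases hik : i = k
  · subst hik; simp
  by_cases hi : i ∈ A
  · by_cases hk : k ∈ A
    · simp only [hi, hk, Ne.symm hik, hik, ne_eq, not_false_eq_true, and_self, if_true]
      rw [fockSign_erase hi, fockSign_erase hk, Finset.erase_right_comm]
      rcases lt_or_gt_of_ne hik with h | h
      · rw [if_pos h, if_neg h.asymm]; ring
      · rw [if_pos h, if_neg h.asymm]; ring
    · simp [hk]
  · simp [hi]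

lemma annih_create (i k : Fin m) :
    annih i * create k + create k * annih i = if i = k then 1 else 0 := by
  refine LinearMap.ext fun f => funext fun A => ?_
  simp only [LinearMap.add_apply, Module.End.mul_apply, Pi.add_apply, create_apply, annih_apply,
    Finset.mem_erase, Finset.mem_insert]
  by_cases hik : i = k
  · subst hik
    by_cases hi : i ∈ A
    · simp only [hi, not_true_eq_false, ne_eq, false_and, if_true, if_false]
      rw [fockSign_erase hi, if_neg (lt_irrefl i), Finset.insert_erase hi, Module.End.one_apply]
      linear_combination f A * fockSign_sq A i
    · simp only [hi, true_or, if_true, if_false]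
      rw [fockSign_insert hi, if_neg (lt_irrefl i), Finset.erase_insert hi, Module.End.one_apply]
      linear_combination f A * fockSign_sq A i
  · rw [if_neg hik, LinearMap.zero_apply, Pi.zero_apply]
    by_cases hi : i ∈ A
    · simp [hi, hik]
    · by_cases hk : k ∈ A
      · simp only [hi, hk, Ne.symm hik, and_false, or_true, if_true, if_false]
        rw [fockSign_erase hk, fockSign_insert hi, Finset.erase_insert_of_ne hik]
        rcases lt_or_gt_of_ne hik with h | h
        · rw [if_pos h, if_neg h.asymm]; ring
        · rw [if_pos h, if_neg h.asymm]; ring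
      · simp [hk, Ne.symm hik]

lemma parityOp_sq : parityOp m * parityOp m = 1 := by
  refine LinearMap.ext fun f => funext fun A => ?_
  simp only [Module.End.mul_apply, parityOp_apply, Module.End.one_apply]
  rw [← mul_assoc, ← mul_pow, neg_one_mul, neg_neg, one_pow, one_mul]

/-- Parity anticommutes with every operator of odd degree. After scaling by 1/√2 it provides the
extra Clifford generator needed for odd N. -/
lemma annih_parityOp (i : Fin m) : annih i * parityOp m + parityOp m * annih i = 0 := by
  refine LinearMap.ext fun f => funext fun A => ?_
  simp only [LinearMap.add_apply, Module.End.mul_apply, Pi.add_apply, annih_apply, parityOp_apply,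
    LinearMap.zero_apply, Pi.zero_apply]
  by_cases hi : i ∈ A
  · simp [hi]
  · rw [if_neg hi, if_neg hi, Finset.card_insert_of_notMem hi]
    ring

lemma create_parityOp (i : Fin m) : create i * parityOp m + parityOp m * create i = 0 := by
  refine LinearMap.ext fun f => funext fun A => ?_
  simp only [LinearMap.add_apply, Module.End.mul_apply, Pi.add_apply, create_apply, parityOp_apply,
    LinearMap.zero_apply, Pi.zero_apply]
  by_cases hi : i ∈ A
  · rw [if_pos hi, if_pos hi, ← Finset.card_erase_add_one hi]
    ring
  · simp [hi]

end Fock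

section Psi

variable {N : ℕ}

lemma psi_lt {a : Fin N} (h : (a : ℕ) < N / 2) : psi N a = annih ⟨a, h⟩ := dif_pos h

lemma psi_rev_lt {a : Fin N} (h : (a.rev : ℕ) < N / 2) : psi N a = create ⟨a.rev, h⟩ := by
  have := Fin.val_rev a
  exact (dif_neg (by omega)).trans (dif_pos h)

lemma psi_mid {a : Fin N} (h : a.rev = a) :
    psi N a = ((Real.sqrt 2 : ℂ)⁻¹) • parityOp (N / 2) := by
  have := congrArg Fin.val h
  rw [Fin.val_rev] at this
  exact (dif_neg (by omega)).trans (dif_neg (by rw [h]; omega))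

lemma trichotomy_rev (a : Fin N) : (a : ℕ) < N / 2 ∨ (a.rev : ℕ) < N / 2 ∨ a.rev = a := by
  have := Fin.val_rev a
  rw [Fin.ext_iff]
  omega

lemma sqrt_two_inv_sq : ((Real.sqrt 2 : ℂ)⁻¹) * ((Real.sqrt 2 : ℂ)⁻¹) = 1 / 2 := by
  rw [← mul_inv, ← Complex.ofReal_mul, Real.mul_self_sqrt (by norm_num)]
  norm_num

/-- The Clifford relations. -/
theorem psi_clifford (a b : Fin N) :
    psi N a * psi N b + psi N b * psi N a = if b = a.rev then 1 else 0 := by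
  have ha := Fin.val_rev a
  have hb := Fin.val_rev b
  rcases trichotomy_rev a with h1 | h1 | h1 <;> rcases trichotomy_rev b with h2 | h2 | h2
  · rw [psi_lt h1, psi_lt h2, annih_annih, if_neg (by rw [Fin.ext_iff]; omega)]
  · rw [psi_lt h1, psi_rev_lt h2, annih_create]
    simp only [Fin.ext_iff]
    congr 1
    rw [eq_iff_iff]
    omega
  · have := congrArg Fin.val h2
    rw [psi_lt h1, psi_mid h2, mul_smul_comm, smul_mul_assoc, ← smul_add, annih_parityOp, smul_zero,
      if_neg (by rw [Fin.ext_iff]; omega)]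
  · rw [psi_rev_lt h1, psi_lt h2, add_comm, annih_create]
    simp only [Fin.ext_iff]
  · rw [psi_rev_lt h1, psi_rev_lt h2, create_create, if_neg (by rw [Fin.ext_iff]; omega)]
  · have := congrArg Fin.val h2
    rw [psi_rev_lt h1, psi_mid h2, mul_smul_comm, smul_mul_assoc, ← smul_add, create_parityOp,
      smul_zero, if_neg (by rw [Fin.ext_iff]; omega)]
  · have := congrArg Fin.val h1
    rw [psi_mid h1, psi_lt h2, mul_smul_comm, smul_mul_assoc, ← smul_add, add_comm, annih_parityOp,
      smul_zero, if_neg (by rw [Fin.ext_iff]; omega)]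
  · have := congrArg Fin.val h1
    rw [psi_mid h1, psi_rev_lt h2, mul_smul_comm, smul_mul_assoc, ← smul_add, add_comm,
      create_parityOp, smul_zero, if_neg (by rw [Fin.ext_iff]; omega)]
  · rw [psi_mid h1, psi_mid h2, smul_mul_smul_comm, parityOp_sq, sqrt_two_inv_sq, ← add_smul,
      if_pos (by rw [h1]; exact eq_of_rev_eq h2 h1)]
    norm_num

end Psi

/-- The Clifford algebra of a hyperbolic plane: UV − VU and UV + VU have equal squares, up to terms
containing U² or V². This makes the square of the spin operator of μ a scalar. -/
lemma sub_mul_self_of_sq {E : Type*} [Ring E] {U V : E} (hU : U * U = 0) (hV : V * V = 0) (hUV : U * V + V * U = 1) :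
    (U * V - V * U) * (U * V - V * U) = 1 := by
  calc (U * V - V * U) * (U * V - V * U) = (U * V + V * U) * (U * V + V * U) -
      (2 : ℕ) • (U * (V * V) * U) - (2 : ℕ) • (V * (U * U) * V) := by noncomm_ring
    _ = 1 := by rw [hU, hV, hUV]; simp

section Clifford

variable {N : ℕ} {E : Type*} [Ring E] [Algebra ℂ E] {ψ : Fin N → E}

/-- The element of degree two of a Clifford algebra attached to a matrix. -/
def cliff (ψ : Fin N → E) (X : Mat N) : E := ∑ a, ∑ b, X a b • (ψ a * ψ b.rev)

/-- The element of degree one of a Clifford algebra attached to a vector. -/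
def cliffVec (ψ : Fin N → E) (u : Fin N → ℂ) : E := ∑ a, u a • ψ a

lemma cliffVec_mul (u v : Fin N → ℂ) :
    cliffVec ψ u * cliffVec ψ v = ∑ a, ∑ b, (u a * v b) • (ψ a * ψ b) := by
  simp only [cliffVec, Finset.sum_mul_sum, smul_mul_smul_comm]

lemma sum_rev {M : Type*} [AddCommMonoid M] (f : Fin N → M) :
    ∑ a : Fin N, f a.rev = ∑ a, f a :=
  Equiv.sum_comp Fin.revPerm f

lemma cliffVec_mul_sub_mul (u v : Fin N → ℂ) :
    cliffVec ψ u * cliffVec ψ v - cliffVec ψ v * cliffVec ψ u =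
      cliff ψ (Matrix.of fun a b => u a * v b.rev - v a * u b.rev) := by
  have hsum : ∀ u v : Fin N → ℂ, cliffVec ψ u * cliffVec ψ v =
      ∑ a, ∑ b : Fin N, (u a * v b.rev) • (ψ a * ψ b.rev) := fun u v => by
    rw [cliffVec_mul]
    exact Finset.sum_congr rfl fun a _ => (sum_rev fun b => (u a * v b) • (ψ a * ψ b)).symm
  simp only [hsum, cliff, Matrix.of_apply, sub_smul, Finset.sum_sub_distrib]

lemma cliff_smul (c : ℂ) (X : Mat N) : cliff ψ (c • X) = c • cliff ψ X := by
  simp only [cliff, Matrix.smul_apply, Finset.smul_sum, smul_smul, smul_eq_mul]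

lemma half_smul_comm {A B C : E} (h : A * B - B * A = (2 : ℂ) • C) : (1 / 2 : ℂ) • C =
    ((1 / 2 : ℂ) • A) * ((1 / 2 : ℂ) • B) - ((1 / 2 : ℂ) • B) * ((1 / 2 : ℂ) • A) := by
  rw [smul_mul_smul_comm, smul_mul_smul_comm, ← smul_sub, h, smul_smul]
  norm_num

variable (hψ : ∀ a b, ψ a * ψ b + ψ b * ψ a = if b = a.rev then 1 else 0)
include hψ

lemma cliffVec_anticomm (u v : Fin N → ℂ) :
    cliffVec ψ u * cliffVec ψ v + cliffVec ψ v * cliffVec ψ u =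
      (∑ a, u a * v a.rev) • (1 : E) := by
  rw [cliffVec_mul, cliffVec_mul, Finset.sum_comm (γ := Fin N) (f := fun a b =>
    (v a * u b) • (ψ a * ψ b)), ← Finset.sum_add_distrib, Finset.sum_smul]
  refine Finset.sum_congr rfl fun a _ => ?_
  rw [← Finset.sum_add_distrib, Finset.sum_eq_single a.rev]
  · rw [mul_comm (v _), ← smul_add, hψ, if_pos rfl]
  · intro b _ hb
    rw [mul_comm (v _), ← smul_add, hψ, if_neg hb, smul_zero]
  · simp

/-- Quadratic elements act on generators by the vector representation. The factor 2 arises because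
each entry and its reflection contribute equally; `spin` removes it with the factor 1/2. -/
lemma cliff_comm_psi {X : Mat N} (hX : ∀ a b, X b.rev a.rev = -X a b) (c : Fin N) :
    cliff ψ X * ψ c - ψ c * cliff ψ X = (2 : ℂ) • cliffVec ψ fun a => X a c := by
  have h1 : ∀ a b, ψ a * ψ b.rev * ψ c - ψ c * (ψ a * ψ b.rev) =
      (if b = c then ψ a else 0) - if a = c.rev then ψ b.rev else 0 := by
    intro a b
    have e1 := hψ b.rev c
    have e2 := hψ c a
    rw [Fin.rev_rev] at e1
    calc ψ a * ψ b.rev * ψ c - ψ c * (ψ a * ψ b.rev) =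
        ψ a * (ψ b.rev * ψ c + ψ c * ψ b.rev) - (ψ c * ψ a + ψ a * ψ c) * ψ b.rev := by
          noncomm_ring
      _ = _ := by
        rw [e1, e2]
        simp only [eq_comm (a := c)]
        split_ifs <;> simp
  simp only [cliff, Finset.sum_mul, Finset.mul_sum, smul_mul_assoc, mul_smul_comm,
    ← Finset.sum_sub_distrib, ← smul_sub, h1]
  simp only [smul_sub, Finset.sum_sub_distrib, smul_ite, smul_zero]
  rw [Finset.sum_comm (f := fun a b => if a = c.rev then X a b • ψ b.rev else 0)]
  simp only [Finset.sum_ite_eq', Finset.mem_univ, if_true]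
  rw [← sum_rev fun b => X c.rev b • ψ b.rev]
  simp only [hX, Fin.rev_rev, neg_smul, Finset.sum_neg_distrib, cliffVec, two_smul]
  abel

/-- Bracketing with `cliff ψ X` is a derivation, applied to both factors of each quadratic monomial.
The left factor gives XY; in the right factor skewness reverses the order and gives −YX. -/
lemma cliff_comm {X Y : Mat N} (hX : ∀ a b, X b.rev a.rev = -X a b) :
    cliff ψ X * cliff ψ Y - cliff ψ Y * cliff ψ X = (2 : ℂ) • cliff ψ (X * Y - Y * X) := by
  have h1 : ∀ a b, cliff ψ X * (ψ a * ψ b) - ψ a * ψ b * cliff ψ X =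
      (2 : ℂ) • (cliffVec ψ (fun c => X c a) * ψ b + ψ a * cliffVec ψ fun c => X c b) := by
    intro a b
    calc cliff ψ X * (ψ a * ψ b) - ψ a * ψ b * cliff ψ X =
        (cliff ψ X * ψ a - ψ a * cliff ψ X) * ψ b + ψ a * (cliff ψ X * ψ b - ψ b * cliff ψ X) := by
          noncomm_ring
      _ = _ := by
        rw [cliff_comm_psi hψ hX, cliff_comm_psi hψ hX, smul_mul_assoc, mul_smul_comm, smul_add]
  have h2 : cliff ψ X * cliff ψ Y - cliff ψ Y * cliff ψ X = ∑ a, ∑ b, Y a b •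
      ((2 : ℂ) • (cliffVec ψ (fun c => X c a) * ψ b.rev +
        ψ a * cliffVec ψ fun c => X c b.rev)) := by
    rw [cliff.eq_1 ψ Y]
    simp only [Finset.sum_mul, Finset.mul_sum, smul_mul_assoc, mul_smul_comm,
      ← Finset.sum_sub_distrib, ← smul_sub, h1]
  have h3 : ∑ a, ∑ b, Y a b • (cliffVec ψ (fun c => X c a) * ψ b.rev) = cliff ψ (X * Y) := by
    simp only [cliff, cliffVec, Finset.sum_mul, Finset.smul_sum, smul_mul_assoc, Matrix.mul_apply,
      Finset.sum_smul, smul_smul]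
    rw [Finset.sum_congr rfl fun a _ => Finset.sum_comm, Finset.sum_comm]
    refine Finset.sum_congr rfl fun c _ => ?_
    rw [Finset.sum_comm]
    exact Finset.sum_congr rfl fun b _ => Finset.sum_congr rfl fun a _ => by rw [mul_comm]
  have h4 : ∑ a, ∑ b, Y a b • (ψ a * cliffVec ψ fun c => X c b.rev) = -cliff ψ (Y * X) := by
    simp only [cliff, cliffVec, Finset.mul_sum, Finset.smul_sum, mul_smul_comm, Matrix.mul_apply,
      Finset.sum_smul, smul_smul, ← Finset.sum_neg_distrib]
    refine Finset.sum_congr rfl fun a _ => ?_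
    rw [Finset.sum_comm, ← sum_rev]
    refine Finset.sum_congr rfl fun c _ => Finset.sum_congr rfl fun b _ => ?_
    rw [hX, mul_neg, neg_smul]
  have h5 : cliff ψ (X * Y - Y * X) = cliff ψ (X * Y) - cliff ψ (Y * X) := by
    simp only [cliff, Matrix.sub_apply, sub_smul, Finset.sum_sub_distrib]
  rw [h2, h5, sub_eq_add_neg, ← h3, ← h4]
  simp only [smul_comm _ (2 : ℂ), ← Finset.smul_sum, smul_add, Finset.sum_add_distrib]

end Clifford

end

end HermSym

/-! ### The spin representation: weights and the quadratic relation. -/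

namespace HermSym

noncomputable section

open Datum

section Spin

variable {N : ℕ}

lemma spin_apply (X : Mat N) : spin N X = ∑ a, ∑ b, X a b •
    ((1 / 4 : ℂ) • (psi N a * psi N b.rev - psi N b.rev * psi N a)) := by
  simp only [spin, LinearMap.sum_apply, LinearMap.smulRight_apply, Matrix.entryLinearMap_apply]

/-- The commutator [ψ_a, ψ_{rev b}] differs from twice the product by a scalar supported on a = b,
and these scalars sum to the trace. -/
lemma spin_eq_cliff {X : Mat N} (hX : Matrix.trace X = 0) :
    spin N X = (1 / 2 : ℂ) • cliff (psi N) X := by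
  have h1 : ∀ a b : Fin N, psi N a * psi N b.rev - psi N b.rev * psi N a =
      (2 : ℂ) • (psi N a * psi N b.rev) - if b = a then 1 else 0 := by
    intro a b
    have := psi_clifford a b.rev
    simp only [Fin.rev_inj] at this
    rw [← this, two_smul]
    abel
  have h2 : ∑ a, ∑ b, X a b • ((1 / 4 : ℂ) • if b = a then (1 : Module.End ℂ (Fock (N / 2))) else 0)
      = 0 := by
    simp only [smul_ite, smul_zero, Finset.sum_ite_eq', Finset.mem_univ, if_true]
    rw [← Finset.sum_smul, show ∑ a, X a a = 0 from hX, zero_smul]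
  simp only [spin_apply, h1, smul_sub, Finset.sum_sub_distrib, h2, sub_zero, cliff,
    Finset.smul_sum]
  refine Finset.sum_congr rfl fun a _ => Finset.sum_congr rfl fun b _ => ?_
  rw [smul_smul, smul_smul, smul_smul]
  congr 1
  ring

lemma mem_typeBD {X : Mat N} : X ∈ (typeBD N).g ↔ ∀ a b, X b.rev a.rev = -X a b := by
  rw [typeBD_base.mem_iff]
  simp

lemma trace_of_mem_typeBD {X : Mat N} (hX : X ∈ (typeBD N).g) : Matrix.trace X = 0 := by
  have h1 : ∑ a : Fin N, X a.rev a.rev = ∑ a, X a a := sum_rev fun a => X a a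
  simp only [mem_typeBD.1 hX, Finset.sum_neg_distrib] at h1
  exact self_eq_neg.1 h1.symm

lemma spin_isRep : (typeBD N).IsRep (spin N) := by
  intro X hX Y hY
  have hXY : Matrix.trace (X * Y - Y * X) = 0 := by
    rw [Matrix.trace_sub, Matrix.trace_mul_comm, sub_self]
  rw [spin_eq_cliff hXY, spin_eq_cliff (trace_of_mem_typeBD hX),
    spin_eq_cliff (trace_of_mem_typeBD hY)]
  exact half_smul_comm (cliff_comm psi_clifford (mem_typeBD.1 hX))

/-- The operator `psi N a` takes the basis vector `x` to a multiple of `y`. -/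
def Hop (a : Fin N) (x y : Finset (Fin (N / 2))) : Prop :=
  (∀ i : Fin (N / 2), (i : ℕ) = a → i ∈ x ∧ i ∉ y) ∧
  (∀ i : Fin (N / 2), (i : ℕ) = a.rev → i ∉ x ∧ i ∈ y) ∧
  ∀ i : Fin (N / 2), (i : ℕ) ≠ a → (i : ℕ) ≠ a.rev → (i ∈ x ↔ i ∈ y)

lemma exists_hop_of_ne_zero {a : Fin N} {f : Fock (N / 2)} {y : Finset (Fin (N / 2))}
    (h : psi N a f y ≠ 0) : ∃ x, Hop a x y ∧ f x ≠ 0 := by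
  have ha := Fin.val_rev a
  rcases trichotomy_rev a with h1 | h1 | h1
  · rw [psi_lt h1, annih_apply] at h
    by_cases hy : (⟨a, h1⟩ : Fin (N / 2)) ∈ y
    · simp [-Fin.val_rev, hy] at h
    · rw [if_neg hy] at h
      refine ⟨_, ⟨fun i hi => ?_, fun i hi => ?_, fun i hi _ => ?_⟩, right_ne_zero_of_mul h⟩
      · have : i = ⟨a, h1⟩ := Fin.ext hi
        subst this
        exact ⟨Finset.mem_insert_self _ _, hy⟩
      · omega
      · have : i ≠ ⟨a, h1⟩ := fun h => hi (congrArg Fin.val h)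
        simp [-Fin.val_rev, this]
  · rw [psi_rev_lt h1, create_apply] at h
    by_cases hy : (⟨a.rev, h1⟩ : Fin (N / 2)) ∈ y
    · rw [if_pos hy] at h
      refine ⟨_, ⟨fun i hi => ?_, fun i hi => ?_, fun i _ hi => ?_⟩, right_ne_zero_of_mul h⟩
      · omega
      · have : i = ⟨a.rev, h1⟩ := Fin.ext hi
        subst this
        exact ⟨Finset.notMem_erase _ _, hy⟩
      · have : i ≠ ⟨a.rev, h1⟩ := fun h => hi (congrArg Fin.val h)
        simp [-Fin.val_rev, this]
    · simp [-Fin.val_rev, hy] at h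
  · have h2 := congrArg Fin.val h1
    rw [psi_mid h1, LinearMap.smul_apply, Pi.smul_apply, parityOp_apply, smul_eq_mul] at h
    exact ⟨y, ⟨fun i hi => by omega, fun i hi => by omega, fun _ _ _ => Iff.rfl⟩,
      right_ne_zero_of_mul (right_ne_zero_of_mul h)⟩

/-- In the basis of subsets each `psi N a` is a monomial matrix: a coordinate of the image comes
from one coordinate of the source, with a nonzero factor. -/
lemma Hop.apply {a : Fin N} {x y : Finset (Fin (N / 2))} (h : Hop a x y) :
    ∃ k : ℂ, k ≠ 0 ∧ ∀ f, psi N a f y = k * f x := by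
  have ha := Fin.val_rev a
  obtain ⟨ha1, ha2, ha3⟩ := h
  rcases trichotomy_rev a with h1 | h1 | h1
  · have hx : x = insert ⟨a, h1⟩ y := by
      ext i
      by_cases hi : i = ⟨a, h1⟩
      · simp [-Fin.val_rev, hi, (ha1 ⟨a, h1⟩ rfl).1]
      · rw [ha3 i (fun h => hi (Fin.ext h)) (by omega)]
        simp [-Fin.val_rev, hi]
    refine ⟨_, fockSign_ne_zero y ⟨a, h1⟩, fun f => ?_⟩
    rw [psi_lt h1, annih_apply, if_neg (ha1 ⟨a, h1⟩ rfl).2, hx]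
  · have hx : x = y.erase ⟨a.rev, h1⟩ := by
      ext i
      by_cases hi : i = ⟨a.rev, h1⟩
      · simp [-Fin.val_rev, hi, (ha2 ⟨a.rev, h1⟩ rfl).1]
      · rw [ha3 i (by omega) (fun h => hi (Fin.ext h))]
        simp [-Fin.val_rev, hi]
    refine ⟨_, fockSign_ne_zero y ⟨a.rev, h1⟩, fun f => ?_⟩
    rw [psi_rev_lt h1, create_apply, if_pos (ha2 ⟨a.rev, h1⟩ rfl).2, hx]
  · have h2 := congrArg Fin.val h1
    have hx : x = y := by
      ext i
      exact ha3 i (by omega) (by omega)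
    refine ⟨(Real.sqrt 2 : ℂ)⁻¹ * (-1) ^ y.card, mul_ne_zero (left_ne_zero_of_mul
      (sqrt_two_inv_sq.trans_ne (by norm_num))) (pow_ne_zero _ (by norm_num)), fun f => ?_⟩
    rw [psi_mid h1, LinearMap.smul_apply, Pi.smul_apply, parityOp_apply, smul_eq_mul, hx, mul_assoc]

lemma exists_hop_of_psi_psi {a c : Fin N} {x y : Finset (Fin (N / 2))}
    (h : (psi N a * psi N c) (Pi.single x 1) y ≠ 0) : ∃ z, Hop c x z ∧ Hop a z y := by
  obtain ⟨z, hz, h1⟩ := exists_hop_of_ne_zero h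
  obtain ⟨x', hx, h2⟩ := exists_hop_of_ne_zero h1
  have : x' = x := by
    by_contra hne
    exact h2 (Pi.single_eq_of_ne hne _)
  exact ⟨z, this ▸ hx, hz⟩

lemma repMat_spin_eq_zero {X : Mat N} (hX : X ∈ (typeBD N).g) {x y : Finset (Fin (N / 2))}
    (h : ∀ a b z, X a b ≠ 0 → Hop b.rev x z → Hop a z y → False) :
    repMat (spin N) X y x = 0 := by
  rw [← apply_single, spin_eq_cliff (trace_of_mem_typeBD hX), cliff]
  simp only [LinearMap.smul_apply, LinearMap.sum_apply, Pi.smul_apply, Finset.sum_apply, smul_eq_mul]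
  refine mul_eq_zero_of_right _ (Finset.sum_eq_zero fun a _ => Finset.sum_eq_zero fun b _ => ?_)
  by_contra h0
  obtain ⟨z, h1, h2⟩ := exists_hop_of_psi_psi (right_ne_zero_of_mul h0)
  exact h a b z (left_ne_zero_of_mul h0) h1 h2

/-- The two matrix units of the root vector give the same product up to order. The generators
anticommute for a ≠ b, so both agree and the factor 1/2 disappears. -/
lemma spin_formRoot {a b : Fin N} (hab : a ≠ b) :
    spin N (formRoot (fun _ => 1) a b) = psi N a * psi N b.rev := by
  have hm := typeBD_base.formRoot_mem a b
  have h1 := psi_clifford a b.rev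
  simp only [Fin.rev_inj, hab.symm, if_false] at h1
  rw [spin_eq_cliff (trace_of_mem_typeBD hm), cliff]
  simp only [formRoot_apply, mul_one, sub_smul, Finset.sum_sub_distrib, ite_smul, one_smul,
    zero_smul, ite_and, Finset.sum_ite_eq, Finset.sum_ite_irrel, Finset.sum_const_zero,
    Finset.mem_univ, if_true, Fin.rev_rev]
  rw [eq_neg_of_add_eq_zero_right h1, sub_neg_eq_add, ← two_smul ℂ, smul_smul]
  norm_num

lemma sum_half {g : Fin N → ℂ} (h : ∀ a, a.rev = a → g a = 0) :
    ∑ a, g a = ∑ i : Fin (N / 2), (g ⟨i, by omega⟩ + g (Fin.rev ⟨i, by omega⟩)) := by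
  have h1 : ∀ g : Fin N → ℂ, ∑ i : Fin (N / 2), g ⟨i, by omega⟩ =
      ∑ a : Fin N, if (a : ℕ) < N / 2 then g a else 0 := by
    intro g
    rw [← Finset.sum_filter]
    refine Finset.sum_bij (fun i _ => ⟨i, by omega⟩) (fun i _ => by simp) (fun i _ k _ hik => ?_)
      (fun a ha => ?_) fun _ _ => rfl
    · simpa [Fin.ext_iff] using hik
    · exact ⟨⟨a, (Finset.mem_filter.1 ha).2⟩, Finset.mem_univ _, rfl⟩
  rw [Finset.sum_add_distrib, h1, h1 fun a => g a.rev,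
    ← sum_rev fun a : Fin N => if (a : ℕ) < N / 2 then g a.rev else 0, ← Finset.sum_add_distrib]
  refine Finset.sum_congr rfl fun a _ => ?_
  have ha := Fin.val_rev a
  rw [Fin.rev_rev]
  rcases trichotomy_rev a with h2 | h2 | h2
  · rw [if_pos h2, if_neg (by omega), add_zero]
  · rw [if_pos h2, if_neg (by omega), zero_add]
  · rw [h a h2]; simp

/-- The weights of the spin representation. -/
def spinWt (H : Mat N) (A : Finset (Fin (N / 2))) : ℂ :=
  ∑ i : Fin (N / 2), (1 / 2 - if i ∈ A then 1 else 0) * H ⟨i, by omega⟩ ⟨i, by omega⟩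

lemma spin_weight : ∀ H ∈ (typeBD N).cartan,
    repMat (spin N) H = Matrix.diagonal (spinWt H) := by
  intro H hH
  have hrev := fun a => typeBD_base.apply_rev hH.1 a
  have happly : ∀ f A, spin N H f A = spinWt H A * f A := by
    intro f A
    have h1 : spin N H f A = ∑ a, (1 / 2) * (H a a * (psi N a * psi N a.rev) f A) := by
      rw [spin_eq_cliff (trace_of_mem_typeBD hH.1), cliff]
      simp only [LinearMap.smul_apply, LinearMap.sum_apply, Pi.smul_apply, Finset.sum_apply,
        smul_eq_mul, Finset.mul_sum]
      refine Finset.sum_congr rfl fun a _ => Finset.sum_eq_single a (fun b _ hb => ?_) (by simp)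
      rw [apply_eq_zero_of_mem_cartanOf hH (Ne.symm hb)]
      ring
    rw [h1, sum_half fun a ha => ?_, spinWt, Finset.sum_mul]
    · refine Finset.sum_congr rfl fun i _ => ?_
      have hi : ((⟨i, by omega⟩ : Fin N) : ℕ) < N / 2 := i.2
      have hr : ((Fin.rev (Fin.rev ⟨i, by omega⟩ : Fin N) : Fin N) : ℕ) < N / 2 := by
        rw [Fin.rev_rev]; exact i.2
      have h2 : psi N ⟨i, by omega⟩ = annih i := psi_lt hi
      have h3 : psi N (Fin.rev ⟨i, by omega⟩) = create i := by
        rw [psi_rev_lt hr]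
        congr 1
        simp [Fin.rev_rev]
      -- The indices i and rev i carry opposite diagonal entries, so together they contribute H_i(½
      -- − n_i), where n_i is the occupation number of i.
      have h4 : annih i * create i = 1 - create i * annih i := by
        rw [eq_sub_iff_add_eq, annih_create, if_pos rfl]
      rw [hrev, Fin.rev_rev, h2, h3, h4, LinearMap.sub_apply, Pi.sub_apply, Module.End.one_apply,
        Module.End.mul_apply, create_apply]
      by_cases hA : i ∈ A
      · rw [if_pos hA, if_pos hA, annih_apply, if_neg (Finset.notMem_erase _ _),
          Finset.insert_erase hA, fockSign_erase hA, if_neg (lt_irrefl i)]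
        linear_combination -(H ⟨i, _⟩ ⟨i, _⟩ * f A) * fockSign_sq A i
      · rw [if_neg hA, if_neg hA]
        ring
    · have := hrev a
      rw [ha] at this
      rw [self_eq_neg.1 this]
      ring
  ext y x
  rw [← apply_single, happly]
  by_cases h : y = x
  · subst h; simp
  · simp [h]

/-- The square of the spin operator of an element of the orbit of `rhoBD`. -/
lemma spin_quadratic {k : Mat N} (hk : k ∈ (typeBD N).K) (hN : 2 ≤ N) :
    spin N (k * rhoBD N * star k) * spin N (k * rhoBD N * star k) = -(1 / 4 : ℂ) • 1 := by
  obtain ⟨h1, h2, h3⟩ := typeBD_conj k hk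
  -- The inverse of k is computed in two ways, by unitarity and by invariance of the reversal form.
  have hinv : ∀ a b, star k a b = k b.rev a.rev := by
    have h4 : formMat (fun _ : Fin N => (1 : ℂ)) * star k = kᵀ * formMat (fun _ => 1) := by
      rw [← mul_one (kᵀ * _), ← h2, ← mul_assoc, h3]
    intro a b
    have h5 := congrFun (congrFun h4 a.rev) b
    rw [Matrix.mul_apply, Finset.sum_eq_single a, Matrix.mul_apply, Finset.sum_eq_single b.rev] at h5
    · simpa [formMat] using h5
    · intro c _ hc
      have : ¬ b = c.rev := fun h => hc (by rw [h, Fin.rev_rev])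
      simp [formMat, this]
    · simp
    · intro c _ hc
      simp [formMat, hc]
    · simp
  set o : Fin N := ⟨0, by omega⟩ with ho
  have hor : o.rev ≠ o := fun h => by
    have := congrArg Fin.val h
    rw [Fin.val_rev] at this
    simp only [ho] at this
    omega
  set u : Fin N → ℂ := fun a => k a o with hu
  set v : Fin N → ℂ := fun a => k a o.rev with hv
  -- The matrix ρ has rank two, so μ is i times the bivector of the columns u and v of k. They are
  -- isotropic with pairing 1, which makes their Clifford elements satisfy `sub_mul_self_of_sq`.
  have hμ : ∀ a b, (k * rhoBD N * star k) a b = Complex.I * (u a * v b.rev - v a * u b.rev) := by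
    intro a b
    rw [Matrix.mul_apply, Finset.sum_eq_add_of_mem o o.rev (Finset.mem_univ _) (Finset.mem_univ _)
      hor.symm fun c _ hc => ?_]
    · rw [hinv, hinv, Fin.rev_rev, rhoBD, Matrix.mul_diagonal, Matrix.mul_diagonal, Fin.rev_rev,
        if_pos rfl, if_neg fun h => hor (Fin.ext h), if_pos rfl]
      simp only [hu, hv]
      ring
    · rw [rhoBD, Matrix.mul_diagonal, if_neg fun h => hc.1 (Fin.ext h), if_neg fun h => hc.2 (by
        rw [← Fin.rev_rev c]; exact congrArg Fin.rev (Fin.ext h))]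
      ring
  have hform : ∀ c d : Fin N, ∑ a, k a c * k a.rev d = if d = c.rev then 1 else 0 := by
    intro c d
    have h5 := congrFun (congrFun h3 c) d
    rw [mul_assoc, Matrix.mul_apply] at h5
    simp only [formMat, Matrix.of_apply] at h5
    rw [← h5]
    refine Finset.sum_congr rfl fun a _ => ?_
    rw [Matrix.mul_apply, Finset.sum_eq_single a.rev]
    · simp
    · intro e _ he
      simp [he]
    · simp
  have huu : cliffVec (psi N) u * cliffVec (psi N) u = 0 := by
    have := cliffVec_anticomm psi_clifford u u
    rw [hform, if_neg hor.symm, zero_smul, ← two_smul ℂ] at this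
    exact (smul_eq_zero.1 this).resolve_left two_ne_zero
  have hvv : cliffVec (psi N) v * cliffVec (psi N) v = 0 := by
    have := cliffVec_anticomm psi_clifford v v
    rw [hform, Fin.rev_rev, if_neg hor, zero_smul, ← two_smul ℂ] at this
    exact (smul_eq_zero.1 this).resolve_left two_ne_zero
  have huv : cliffVec (psi N) u * cliffVec (psi N) v + cliffVec (psi N) v * cliffVec (psi N) u = 1 := by
    have := cliffVec_anticomm psi_clifford u v
    rwa [hform, if_pos rfl, one_smul] at this
  have hspin : spin N (k * rhoBD N * star k) = (Complex.I / 2) •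
      (cliffVec (psi N) u * cliffVec (psi N) v - cliffVec (psi N) v * cliffVec (psi N) u) := by
    have htr : Matrix.trace (k * rhoBD N * star k) = 0 := by
      rw [Matrix.trace_mul_comm, ← mul_assoc, h1, one_mul, rhoBD, Matrix.trace_diagonal]
      refine self_eq_neg.1 ?_
      conv_lhs => rw [← sum_rev]
      rw [← Finset.sum_neg_distrib]
      refine Finset.sum_congr rfl fun a _ => ?_
      have := Fin.val_rev a
      rw [Fin.rev_rev]
      split_ifs <;> first | omega | simp
    rw [spin_eq_cliff htr, cliffVec_mul_sub_mul, ← cliff_smul, ← cliff_smul]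
    congr 1
    ext a b
    rw [Matrix.smul_apply, Matrix.smul_apply, hμ, Matrix.of_apply, smul_eq_mul, smul_eq_mul]
    ring
  rw [hspin, smul_mul_smul_comm, sub_mul_self_of_sq huu hvv huv]
  congr 1
  linear_combination (1 / 4 : ℂ) * Complex.I_mul_I

end Spin

end

end HermSym

/-! ### The chain of 𝔰𝔬(N − 2j) and its action on the spin module. -/

namespace HermSym

noncomputable section

open Datum

section BD

variable {N : ℕ}

/-- The blocks of `𝔰𝔬(N-2j) ⊕ 𝔰𝔬(2)^j`. -/
def blocksBD (N j : ℕ) (a b : Fin N) : Prop :=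
  (j ≤ (a : ℕ) ∧ (a : ℕ) + j < N) ∧ (j ≤ (b : ℕ) ∧ (b : ℕ) + j < N)

lemma blocksBD_rev {j : ℕ} (a b : Fin N) : blocksBD N j b.rev a.rev ↔ blocksBD N j a b := by
  have := Fin.val_rev a
  have := Fin.val_rev b
  simp only [blocksBD]
  omega

lemma mem_rootsBD {j : ℕ} {i : Fin (N / 2)} :
    i ∈ rootsBD N j ↔ j ≤ (i : ℕ) ∧ 2 * j + 2 < N := by simp [rootsBD]

lemma typeBD_simple_apply (i : Fin (N / 2)) (H : (typeBD N).cartan) : (typeBD N).simple i H =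
    if h : (i : ℕ) + 1 < N / 2 then (H : Mat N) ⟨i, by omega⟩ ⟨i, by omega⟩ -
      (H : Mat N) ⟨i + 1, by omega⟩ ⟨i + 1, by omega⟩
    else if Even N then (H : Mat N) ⟨i - 1, by omega⟩ ⟨i - 1, by omega⟩ +
      (H : Mat N) ⟨i, by omega⟩ ⟨i, by omega⟩
    else (H : Mat N) ⟨i, by omega⟩ ⟨i, by omega⟩ := by
  have := i.2
  by_cases h : (i : ℕ) + 1 < N / 2
  · rw [dif_pos h, typeBD_simple_lt h, LinearMap.sub_apply, eps_nat (by omega), eps_nat (by omega)]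
  · rw [dif_neg h]
    by_cases he : Even N
    · rw [if_pos he, typeBD_simple_even (by omega) he, LinearMap.add_apply, eps_nat (by omega),
        eps_nat (by omega)]
    · rw [if_neg he, typeBD_simple_odd (by omega) (Nat.not_even_iff_odd.1 he), eps_nat (by omega)]

theorem typeBD_hasBlocks {j : ℕ} (hj : 2 * j < N) :
    (typeBD N).HasBlocks (formRp fun _ => 1) (rootsBD N j) (blocksBD N j) where
  symm h := ⟨h.2, h.1⟩
  mem {a b} hrp hab hP := by
    have hle : AddSubmonoid.closure ((typeBD N).simple '' (rootsBD N j : Set (Fin (N / 2)))) ≤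
        (AddSubgroup.closure
          ((typeBD N).simple '' (rootsBD N j : Set (Fin (N / 2))))).toAddSubmonoid :=
      AddSubmonoid.closure_le.2 AddSubgroup.subset_closure
    by_cases h : (a : ℕ) + b < N
    · exact hle (eps_sub_mem_closure_rootsBD hab (formRp_one.1 hrp).2 hP.1.1 h)
    · have h1 := eps_sub_mem_closure_rootsBD (j := j) (rev_lt_of_lt hab)
        (fun h => (formRp_one.1 hrp).2 (by rw [h, Fin.rev_rev]))
        (by have := Fin.val_rev b; have := hP.2.2; omega)
        (by rw [Fin.val_rev, Fin.val_rev]; omega)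
      rw [typeBD_base.eps_rev, typeBD_base.eps_rev, neg_sub_neg] at h1
      exact hle h1
  kill {a b} hrp hP := by
    obtain ⟨hab, hrev⟩ := formRp_one.1 hrp
    -- The window of indices is stable under reflection, so `antiInd x` vanishes on it whenever x
    -- lies outside.
    have hkill : ∀ x : Fin N, ¬ (j ≤ (x : ℕ) ∧ (x : ℕ) + j < N) → ∀ i ∈ rootsBD N j,
        (typeBD N).simple i ⟨_, typeBD_base.antiInd_mem x⟩ = 0 := by
      intro x hx i hi
      obtain ⟨hi1, hi2⟩ := mem_rootsBD.1 hi
      have hx' := Fin.val_rev x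
      have hz : ∀ c : Fin N, j ≤ (c : ℕ) → (c : ℕ) + j < N → antiInd x c = 0 := by
        intro c hc hc'
        rw [antiInd, if_neg (fun h : c = x => hx (h ▸ ⟨hc, hc'⟩)),
          if_neg (fun h : c = x.rev => ?_), sub_self]
        rw [h] at hc hc'
        omega
      rw [typeBD_simple_apply]
      simp only [Matrix.diagonal_apply_eq]
      split_ifs with h1 h2
      · rw [hz _ hi1 (by simp only; omega), hz _ (by simp only; omega) (by simp only; omega)]; simp
      · obtain ⟨r, rfl⟩ := h2
        rw [hz _ (by simp only; omega) (by simp only; omega), hz _ hi1 (by simp only; omega)]; simp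
      · rw [hz _ hi1 (by simp only; omega)]; simp
    have hmid : ∀ x y : Fin N, x ≠ y → y ≠ x.rev → ¬ (j ≤ (x : ℕ) ∧ (x : ℕ) + j < N) →
        antiInd x x ≠ antiInd x y := by
      intro x y h1 h2 h3
      have : x ≠ x.rev := fun h => by
        have := congrArg Fin.val h
        rw [Fin.val_rev] at this
        omega
      rw [antiInd, antiInd, if_pos rfl, if_neg this, if_neg h1.symm, if_neg h2]
      norm_num
    by_cases ha : j ≤ (a : ℕ) ∧ (a : ℕ) + j < N
    · have hb : ¬ (j ≤ (b : ℕ) ∧ (b : ℕ) + j < N) := fun hb => hP ⟨ha, hb⟩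
      refine ⟨_, hkill b hb, ?_⟩
      simp only [Matrix.diagonal_apply_eq]
      exact_mod_cast (hmid b a hab.symm (fun h => hrev (by rw [h, Fin.rev_rev])) hb).symm
    · refine ⟨_, hkill a ha, ?_⟩
      simp only [Matrix.diagonal_apply_eq]
      exact_mod_cast hmid a b hab hrev ha

/-- The generator of the `j`-th factor `𝔰𝔬(2)`. -/
def rhoSO (N j : ℕ) : Mat N :=
  Matrix.diagonal fun a =>
    if (a : ℕ) = j then Complex.I else if (a.rev : ℕ) = j then -Complex.I else 0

lemma rhoSO_mem {j : ℕ} (hj : 2 * j + 1 < N) : rhoSO N j ∈ (typeBD N).cartan :=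
  typeBD_base.diagonal_mem fun a => by
    have := Fin.val_rev a
    rw [Fin.rev_rev]
    split_ifs <;> first | omega | simp

lemma rhoSO_apply_lt {j : ℕ} (hj : j < N / 2) {a : ℕ} (ha : a < N / 2) (h : a < N) :
    rhoSO N j ⟨a, h⟩ ⟨a, h⟩ = if a = j then Complex.I else 0 := by
  rw [rhoSO, Matrix.diagonal_apply_eq]
  rw [if_neg (c := (Fin.rev (⟨a, h⟩ : Fin N) : ℕ) = j) (by rw [Fin.val_rev]; simp only; omega)]

lemma rhoSO_gen {j : ℕ} (hj : 2 * j + 2 < N) : (typeBD N).IsCentralGenerator (rootsBD N j)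
    (rootsBD N (j + 1)) ⟨rhoSO N j, rhoSO_mem (by omega)⟩ := by
  have hj' : j < N / 2 := by omega
  refine ⟨mem_compact.2 ⟨(rhoSO_mem (by omega)).1, star_diagonal_of_skew fun a => ?_⟩,
    fun i hi => ?_, fun i hi => ?_, fun H hH => ?_⟩
  · split_ifs <;> simp
  · obtain ⟨h1, h2⟩ := mem_rootsBD.1 hi
    rw [typeBD_simple_apply]
    split_ifs with h3 h4
    · dsimp only
      rw [rhoSO_apply_lt hj' (by omega), rhoSO_apply_lt hj' (by omega), if_neg (by omega),
        if_neg (by omega), sub_self]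
    · obtain ⟨r, rfl⟩ := h4
      dsimp only
      rw [rhoSO_apply_lt hj' (by omega), rhoSO_apply_lt hj' (by omega), if_neg (by omega),
        if_neg (by omega), add_zero]
    · dsimp only
      rw [rhoSO_apply_lt hj' (by omega), if_neg (by omega)]
  · rw [Finset.mem_sdiff, mem_rootsBD, mem_rootsBD] at hi
    rw [typeBD_simple_apply]
    split_ifs with h3 h4
    · dsimp only
      rw [rhoSO_apply_lt hj' (by omega), rhoSO_apply_lt hj' (by omega), if_pos (by omega),
        if_neg (by omega), sub_zero]
    · obtain ⟨r, rfl⟩ := h4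
      dsimp only
      rw [rhoSO_apply_lt hj' (by omega), rhoSO_apply_lt hj' (by omega)]
      -- The last root ε_{i−1} + ε_i leaves together with the root numbered j only at the end, when
      -- i = j + 1 and the block is 𝔰𝔬(4); both simple ideals lose their root at that step.
      by_cases h : (i : ℕ) = j
      · omega
      · rw [if_pos (by omega), if_neg h, add_zero]
    · have := Nat.not_even_iff_odd.1 h4
      obtain ⟨r, rfl⟩ := this
      dsimp only
      rw [rhoSO_apply_lt hj' (by omega), if_pos (by omega)]
  · set C := AddSubmonoid.closure ((typeBD N).simple '' (rootsBD N j : Set (Fin (N / 2))))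
    have hC : ∀ α ∈ C, α H = 0 := by
      intro α hα
      induction hα using AddSubmonoid.closure_induction with
      | mem α h => obtain ⟨i, hi, rfl⟩ := h; exact hH i hi
      | zero => rfl
      | add α β _ _ h1 h2 => rw [LinearMap.add_apply, h1, h2, add_zero]
    set o : Fin N := ⟨j, by omega⟩ with ho
    set p : Fin N := ⟨j + 1, by omega⟩ with hp
    have hor := Fin.val_rev o
    have hpr := Fin.val_rev p
    simp only [ho] at hor
    simp only [hp] at hpr
    -- Both ε_j − ε_{j+1} and ε_j + ε_{j+1} vanish on H, hence so does ε_j; this is the only entry,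
    -- up to reflection, that ρ sees.
    have h1 := hC _ (eps_sub_mem_closure_rootsBD (j := j) (a := o) (b := p) (by simp [ho, hp])
      (fun h => by rw [Fin.ext_iff, hor] at h; simp only [hp] at h; omega) le_rfl
      (by simp only [ho, hp]; omega))
    have h2 := hC _ (eps_sub_mem_closure_rootsBD (j := j) (a := o) (b := p.rev)
      (by rw [Fin.lt_def, hpr]; simp only [ho]; omega)
      (fun h => by rw [Fin.rev_inj, Fin.ext_iff] at h; simp [ho, hp] at h) le_rfl
      (by rw [hpr]; simp only [ho]; omega))
    rw [LinearMap.sub_apply, eps_apply, eps_apply] at h1 h2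
    rw [typeBD_base.apply_rev H.2.1] at h2
    have h0 : (H : Mat N) o o = 0 := by linear_combination (1 / 2 : ℂ) * (h1 + h2)
    change Matrix.trace (rhoSO N j * _) = 0
    rw [rhoSO, trace_diagonal_mul]
    refine Finset.sum_eq_zero fun a _ => ?_
    split_ifs with h3 h4
    · rw [show a = o from Fin.ext h3, h0, mul_zero]
    · have : (H : Mat N) a a = 0 := by
        rw [← Fin.rev_rev a, typeBD_base.apply_rev H.2.1, show a.rev = o from Fin.ext h4, h0, neg_zero]
      rw [this, mul_zero]
    · rw [zero_mul]

/-- The value ±2i would require the pair of j and its reflection, which is not a root of an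
orthogonal algebra. -/
lemma rhoSO_sub {j : ℕ} (a b : Fin N) (h : formRp (fun _ => 1) a b) :
    rhoSO N j a a - rhoSO N j b b = 0 ∨ rhoSO N j a a - rhoSO N j b b = Complex.I ∨
      rhoSO N j a a - rhoSO N j b b = -Complex.I := by
  obtain ⟨h1, h2⟩ := formRp_one.1 h
  rw [ne_eq, Fin.ext_iff] at h1 h2
  have ha := Fin.val_rev a
  have hb := Fin.val_rev b
  simp only [rhoSO, Matrix.diagonal_apply_eq]
  split_ifs <;> first | omega | simp

lemma typeBD_isNoncompact (hN : 3 ≤ N) {j : ℕ} (hj : 2 * j + 2 < N) :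
    (typeBD N).IsNoncompact (rootsBD N j) (rootsBD N (j + 1)) := by
  obtain ⟨-, h0, h1, -⟩ := rhoSO_gen hj
  exact isNoncompact_of_rho (typeBD_isForm hN).isStandard (typeBD_hasBlocks (by omega)) h0 h1
    fun a b hab _ => rhoSO_sub a b hab

/-- For N = 4 the first step of the chain removes both simple roots, so the equality fails there. -/
lemma rootsBD_one (hN : 3 ≤ N) (hN4 : N ≠ 4) : rootsBD N 1 = allBut (N / 2) 0 := by
  ext i
  have := i.2
  simp only [mem_rootsBD, allBut, Finset.mem_filter, Finset.mem_univ, true_and]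
  omega

theorem typeBD_isThimmChain (hN : 3 ≤ N) :
    (typeBD N).IsThimmChain ((N - 1) / 2) (rootsBD N) (chainBD N) := by
  refine isThimmChain_of_blocks (typeBD_isForm hN).isStandard (P := blocksBD N) (rootsBD_zero hN)
    (blockSub_eq_self fun a b => by omega) ?_ (fun j hj => typeBD_hasBlocks (by omega)) (fun _ _ => rfl)
    fun j hj => ⟨?_, typeBD_isNoncompact hN (by omega)⟩
  · ext i
    simp only [mem_rootsBD, Finset.notMem_empty, iff_false]
    omega
  · refine Finset.ssubset_iff_subset_ne.2 ⟨fun i hi => ?_, fun h => ?_⟩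
    · rw [mem_rootsBD] at *
      omega
    · have : (⟨j, by omega⟩ : Fin (N / 2)) ∈ rootsBD N (j + 1) := by
        rw [h, mem_rootsBD]; simp only; omega
      rw [mem_rootsBD] at this
      simp only at this
      omega

/-- The basis forms of degree in `P` in the last generators, from number `j` on. -/
def spinSet (P : ℕ → Prop) (j : ℕ) (A : Finset (Fin (N / 2))) : Prop :=
  P A.card ∧ ∀ i ∈ A, j ≤ (i : ℕ)

/-- `P` is preserved by even elements of the Clifford algebra. -/
def EvenInvariant (N : ℕ) (P : ℕ → Prop) : Prop :=
  ∀ (a c : Fin N) (x z y : Finset (Fin (N / 2))), Hop c x z → Hop a z y → (P x.card ↔ P y.card)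

lemma evenInvariant_true : EvenInvariant N fun _ => True := fun _ _ _ _ _ _ _ => Iff.rfl

/-- For even N there is no middle index, so every generator adds or removes exactly one element. -/
lemma Hop.even_card {a : Fin N} {x y : Finset (Fin (N / 2))} (h : Hop a x y) (hN : Even N) :
    Even y.card ↔ ¬ Even x.card := by
  have ha := Fin.val_rev a
  obtain ⟨h1, h2, h3⟩ := h
  rcases trichotomy_rev a with h4 | h4 | h4
  · have hx : x = insert ⟨a, h4⟩ y := by
      ext i
      by_cases hi : i = ⟨a, h4⟩
      · simp [hi, (h1 ⟨a, h4⟩ rfl).1]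
      · rw [h3 i (fun h => hi (Fin.ext h)) (by omega)]
        simp [hi]
    rw [hx, Finset.card_insert_of_notMem (h1 ⟨a, h4⟩ rfl).2, Nat.even_add_one, not_not]
  · have hy : y = insert ⟨a.rev, h4⟩ x := by
      ext i
      by_cases hi : i = ⟨a.rev, h4⟩
      · rw [hi]; exact iff_of_true (h2 ⟨a.rev, h4⟩ rfl).2 (Finset.mem_insert_self _ _)
      · rw [← h3 i (by omega) (fun h => hi (Fin.ext h))]
        simp [-Fin.val_rev, hi]
    rw [hy, Finset.card_insert_of_notMem (h2 ⟨a.rev, h4⟩ rfl).1, Nat.even_add_one]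
  · have := congrArg Fin.val h4
    obtain ⟨r, rfl⟩ := hN
    omega

lemma IsSpinParity.evenInvariant {P : ℕ → Prop} (hP : IsSpinParity N P) : EvenInvariant N P := by
  rcases hP with ⟨-, rfl⟩ | ⟨hN, rfl | rfl⟩
  · exact evenInvariant_true
  · intro a c x z y h1 h2
    rw [h2.even_card hN, h1.even_card hN, not_not]
  · intro a c x z y h1 h2
    rw [← Nat.not_even_iff_odd, ← Nat.not_even_iff_odd, h2.even_card hN, h1.even_card hN, not_not]

section Invariance

variable {P : ℕ → Prop} {j : ℕ} {x y : Finset (Fin (N / 2))}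

/-- An off-diagonal entry in the window touches only generators numbered j or more. A diagonal entry
hops away and back, leaving the set unchanged. -/
lemma repMat_spin_block (hP : EvenInvariant N P) {X : Mat N} (hX : X ∈ (typeBD N).g)
    (hXP : ∀ a b, a ≠ b → ¬ blocksBD N j a b → X a b = 0) (hx : spinSet P j x)
    (hy : ¬ spinSet P j y) : repMat (spin N) X y x = 0 := by
  refine repMat_spin_eq_zero hX fun a b z h0 h1 h2 => hy ⟨(hP _ _ _ _ _ h1 h2).1 hx.1, fun i hi => ?_⟩
  by_contra hij
  obtain ⟨p1, p2, p3⟩ := h1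
  obtain ⟨q1, q2, q3⟩ := h2
  have ha := Fin.val_rev a
  have hb := Fin.val_rev b
  rw [Fin.rev_rev] at p2 p3
  have hix : i ∉ x := fun h => hij (hx.2 i h)
  by_cases hab : a = b
  · subst hab
    have e1 := p1 i
    have e2 := p2 i
    have e3 := p3 i
    have e4 := q1 i
    have e5 := q2 i
    have e6 := q3 i
    tauto
  · have hblk : blocksBD N j a b := by
      by_contra h
      exact h0 (hXP a b hab h)
    obtain ⟨⟨c1, c2⟩, c3, c4⟩ := hblk
    exact hix ((p3 i (by omega) (by omega)).2 ((q3 i (by omega) (by omega)).2 hi))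

/-- Off the blocks, some generator numbered below j is moved by one hop and not restored by the
other. Hence the compression to W does not see this part of X. -/
lemma repMat_spin_offBlock (hj : 2 * j < N) {X : Mat N} (hX : X ∈ (typeBD N).g)
    (hXP : ∀ a b, a = b ∨ blocksBD N j a b → X a b = 0) (hx : spinSet P j x)
    (hy : spinSet P j y) : repMat (spin N) X y x = 0 := by
  refine repMat_spin_eq_zero hX fun a b z h0 h1 h2 => ?_
  have hab : ¬ (a = b ∨ blocksBD N j a b) := fun h => h0 (hXP a b h)
  obtain ⟨p1, p2, p3⟩ := h1
  obtain ⟨q1, q2, q3⟩ := h2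
  have ha := Fin.val_rev a
  have hb := Fin.val_rev b
  rw [Fin.rev_rev] at p2 p3
  rw [blocksBD, Fin.ext_iff] at hab
  have hx' : ∀ i : Fin (N / 2), (i : ℕ) < j → i ∉ x := fun i hi h => by have := hx.2 i h; omega
  have hy' : ∀ i : Fin (N / 2), (i : ℕ) < j → i ∉ y := fun i hi h => by have := hy.2 i h; omega
  have hcases : (a : ℕ) < j ∨ (a.rev : ℕ) < j ∨ (b : ℕ) < j ∨ (b.rev : ℕ) < j := by omega
  rcases hcases with h | h | h | h
  · have hz := (q1 ⟨a, by omega⟩ rfl).1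
    by_cases e1 : (a : ℕ) = b.rev
    · exact hx' _ h (p1 ⟨a, by omega⟩ e1).1
    · exact hx' _ h ((p3 ⟨a, by omega⟩ e1 fun e => hab (Or.inl e)).2 hz)
  · exact hy' _ h (q2 ⟨a.rev, by omega⟩ rfl).2
  · have hz := (p2 ⟨b, by omega⟩ rfl).2
    by_cases e1 : (b : ℕ) = a.rev
    · exact hy' _ h (q2 ⟨b, by omega⟩ e1).2
    · exact hy' _ h ((q3 ⟨b, by omega⟩ (fun e => hab (Or.inl e.symm)) e1).1 hz)
  · exact hx' _ h (p1 ⟨b.rev, by omega⟩ rfl).1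

/-- Creating a generator i < j with an entry a ≤ b would force the other hop to annihilate a
generator numbered at most i, and x contains none. The lower triangular case is the mirror image. -/
lemma repMat_spin_upper (hP : EvenInvariant N P) {X : Mat N} (hX : X ∈ (typeBD N).g)
    (hXP : ∀ a b, b < a → X a b = 0) (hx : spinSet P j x)
    (hy : ¬ spinSet P j y) : repMat (spin N) X y x = 0 := by
  refine repMat_spin_eq_zero hX fun a b z h0 h1 h2 => hy ⟨(hP _ _ _ _ _ h1 h2).1 hx.1, fun i hi => ?_⟩
  by_contra hij
  have hab : (a : ℕ) ≤ b := by
    by_contra h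
    exact h0 (hXP a b (by rw [Fin.lt_def]; omega))
  obtain ⟨p1, p2, p3⟩ := h1
  obtain ⟨q1, q2, q3⟩ := h2
  have ha := Fin.val_rev a
  have hb := Fin.val_rev b
  rw [Fin.rev_rev] at p2 p3
  have hx' : ∀ i : Fin (N / 2), (i : ℕ) < j → i ∉ x := fun i hi h => by have := hx.2 i h; omega
  by_cases e1 : (i : ℕ) = a.rev
  · exact hx' ⟨b.rev, by omega⟩ (by simp only; omega) (p1 ⟨b.rev, by omega⟩ rfl).1
  by_cases e2 : (i : ℕ) = a
  · exact (q1 i e2).2 hi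
  have hz := (q3 i e2 e1).2 hi
  by_cases e3 : (i : ℕ) = b.rev
  · exact (p1 i e3).2 hz
  by_cases e4 : (i : ℕ) = b
  · have hk := (q1 ⟨a, by omega⟩ rfl).1
    by_cases e5 : (a : ℕ) = b.rev
    · exact hx' ⟨a, by omega⟩ (by simp only; omega) (p1 ⟨a, by omega⟩ e5).1
    · exact hx' ⟨a, by omega⟩ (by simp only; omega)
        ((p3 ⟨a, by omega⟩ e5 (by simp only; omega)).2 hk)
  · exact hx' i (by omega) ((p3 i e3 e4).2 hz)

lemma repMat_spin_lower (hP : EvenInvariant N P) {X : Mat N} (hX : X ∈ (typeBD N).g)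
    (hXP : ∀ a b, a < b → X a b = 0) (hx : ¬ spinSet P j x)
    (hy : spinSet P j y) : repMat (spin N) X y x = 0 := by
  refine repMat_spin_eq_zero hX fun a b z h0 h1 h2 => hx ⟨(hP _ _ _ _ _ h1 h2).2 hy.1, fun i hi => ?_⟩
  by_contra hij
  have hab : (b : ℕ) ≤ a := by
    by_contra h
    exact h0 (hXP a b (by rw [Fin.lt_def]; omega))
  obtain ⟨p1, p2, p3⟩ := h1
  obtain ⟨q1, q2, q3⟩ := h2
  have ha := Fin.val_rev a
  have hb := Fin.val_rev b
  rw [Fin.rev_rev] at p2 p3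
  have hy' : ∀ i : Fin (N / 2), (i : ℕ) < j → i ∉ y := fun i hi h => by have := hy.2 i h; omega
  by_cases e1 : (i : ℕ) = b.rev
  · exact hy' ⟨a.rev, by omega⟩ (by simp only; omega) (q2 ⟨a.rev, by omega⟩ rfl).2
  by_cases e2 : (i : ℕ) = b
  · exact (p2 i e2).1 hi
  have hz := (p3 i e1 e2).1 hi
  by_cases e3 : (i : ℕ) = a.rev
  · exact (q2 i e3).1 hz
  by_cases e4 : (i : ℕ) = a
  · have hk := (p2 ⟨b, by omega⟩ rfl).2
    by_cases e5 : (b : ℕ) = a.rev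
    · exact hy' ⟨b, by omega⟩ (by simp only; omega) (q2 ⟨b, by omega⟩ e5).2
    · exact hy' ⟨b, by omega⟩ (by simp only; omega)
        ((q3 ⟨b, by omega⟩ (by simp only; omega) e5).1 hk)
  · exact hy' i (by omega) ((q3 i e4 e3).1 hz)

end Invariance

end BD

end

end HermSym

/-! ### Minimality of spin modules and the BDI recursion. -/

namespace HermSym

noncomputable section

open Datum

section BDI

variable {N : ℕ} {P : ℕ → Prop} {j : ℕ}

/-- Only parity invariance enters, not irreducibility, so the argument also covers the full spin
module for even N. -/
theorem typeBD_nijenhuis {c : ℝ} (hc : c ≠ 0) (hN : 3 ≤ N) (hP : EvenInvariant N P)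
    (hj : 2 * j < N) : NijenhuisFormula (typeBD N) c (rhoBD N) (spin N) (chainBD N j)
      (wSpin N P j) 1 := by
  have hblk := (typeBD_isForm hN).blk_mem (P := blocksBD N j) fun a b => blocksBD_rev a b
  rw [show (1 : ℂ) = -2 * Complex.I * (Complex.I / 2) by linear_combination Complex.I_mul_I]
  -- `rhoBD N` unfolds to `rhoSO N 0`, so the facts about the chain generators apply to it.
  refine nijenhuisFormula_of_quadratic (P := blocksBD N j) (A := spinSet P j)
    (ρ := rhoSO N 0) (typeBD_isForm hN).isStandard hc (rhoSO_mem (j := 0) (by omega))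
    (rhoSO_gen (j := 0) (by omega)).1 (fun a b hab hlt => ?_) (fun k hk => ?_) spin_isRep
    (fun k hk => ?_) (fun h => ⟨h.2, h.1⟩) hblk
    (fun X hX x y hx hy => repMat_spin_block hP (hblk X hX) (fun a b hab h => ?_) hx hy)
    (fun X hX x y hx hy => ?_) (fun X hX h x y hx hy => repMat_spin_upper hP hX h hx hy)
    (fun X hX h x y hx hy => repMat_spin_lower hP hX h hx hy)
  · obtain ⟨-, h2⟩ := formRp_one.1 hab
    rw [Fin.lt_def] at hlt
    rw [ne_eq, Fin.ext_iff] at h2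
    have ha := Fin.val_rev a
    have hb := Fin.val_rev b
    simp only [rhoSO, Matrix.diagonal_apply_eq]
    split_ifs <;> first | omega | simp
  · obtain ⟨h1, h2, h3⟩ := typeBD_conj k hk
    exact ⟨h1, h2, (typeBD_isForm hN).conj_mem h1 h2 h3⟩
  · have h := congrArg (LinearMap.toMatrix' (R := ℂ)) (spin_quadratic hk (by omega))
    rw [LinearMap.toMatrix'_mul, map_smul, LinearMap.toMatrix'_one] at h
    refine h.trans ?_
    rw [show 2 * (Complex.I / 2) - Complex.I = 0 by ring, zero_smul, zero_sub, ← neg_smul]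
    congr 1
    linear_combination (-1 / 4 : ℂ) * Complex.I_mul_I
  · simp [blk, hab, h]
  · rw [← sub_eq_zero, ← Matrix.sub_apply, ← map_sub]
    refine repMat_spin_offBlock hj (Submodule.sub_mem _ (hblk X hX) hX) (fun a b h => ?_) hx hy
    rw [Matrix.sub_apply, blk, Matrix.of_apply, if_pos h, sub_self]

lemma hop_erase {i : Fin (N / 2)} {x : Finset (Fin (N / 2))} (hi : i ∈ x) :
    Hop (⟨i, by omega⟩ : Fin N) x (x.erase i) := by
  refine ⟨fun k hk => ?_, fun k hk => ?_, fun k hk _ => ?_⟩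
  · obtain rfl : k = i := Fin.ext hk
    exact ⟨hi, Finset.notMem_erase _ _⟩
  · rw [Fin.val_rev] at hk
    simp only at hk
    omega
  · have : k ≠ i := fun h => hk (congrArg Fin.val h)
    simp [this]

lemma hop_insert {i : Fin (N / 2)} {x : Finset (Fin (N / 2))} (hi : i ∉ x) :
    Hop (Fin.rev ⟨i, by omega⟩ : Fin N) x (insert i x) := by
  refine ⟨fun k hk => ?_, fun k hk => ?_, fun k _ hk => ?_⟩
  · rw [Fin.val_rev] at hk
    simp only at hk
    omega
  · rw [Fin.rev_rev] at hk
    obtain rfl : k = i := Fin.ext hk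
    exact ⟨hi, Finset.mem_insert_self _ _⟩
  · rw [Fin.rev_rev] at hk
    have : k ≠ i := fun h => hk (congrArg Fin.val h)
    simp [this]

lemma hop_mid {a : Fin N} (ha : a.rev = a) (x : Finset (Fin (N / 2))) : Hop a x x := by
  have h := congrArg Fin.val ha
  rw [Fin.val_rev] at h
  exact ⟨fun i hi => by omega, fun i hi => by rw [ha] at hi; omega, fun _ _ _ => Iff.rfl⟩

lemma edge_spin {a b : Fin N} {x y z : Finset (Fin (N / 2))} (hab : a ≠ b)
    (hP : blocksBD N j a b) (h1 : Hop b.rev x z) (h2 : Hop a z y) :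
    (typeBD N).Edge (blocksBD N j) (spin N) x y := by
  refine ⟨_, typeBD_base.formRoot_mem a b, fun c d _ hcd => ?_, ?_⟩
  · have h3 : ¬ (a = c ∧ b = d) := fun h => hcd (h.1 ▸ h.2 ▸ hP)
    have h4 : ¬ (b.rev = c ∧ a.rev = d) := fun h => hcd (h.1 ▸ h.2 ▸ (blocksBD_rev a b).2 hP)
    rw [formRoot_apply, if_neg h3, if_neg h4, sub_zero]
  · rw [← apply_single, spin_formRoot hab]
    obtain ⟨r1, hr1, e1⟩ := h1.apply
    obtain ⟨r2, hr2, e2⟩ := h2.apply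
    rw [Module.End.mul_apply, e2, e1, Pi.single_eq_same, mul_one]
    exact mul_ne_zero hr2 hr1

/-- `x` and `y` generate the same submodule for the blocks `j`. -/
def SpinConn (j : ℕ) (x y : Finset (Fin (N / 2))) : Prop :=
  Relation.ReflTransGen ((typeBD N).Edge (blocksBD N j) (spin N)) x y ∧
  Relation.ReflTransGen ((typeBD N).Edge (blocksBD N j) (spin N)) y x

lemma SpinConn.refl (x : Finset (Fin (N / 2))) : SpinConn j x x :=
  ⟨Relation.ReflTransGen.refl, Relation.ReflTransGen.refl⟩

lemma SpinConn.trans {x y z : Finset (Fin (N / 2))} (h1 : SpinConn j x y) (h2 : SpinConn j y z) :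
    SpinConn j x z := ⟨h1.1.trans h2.1, h2.2.trans h1.2⟩

/-- For odd N the middle generator acts by a nonzero scalar on each basis vector; paired with
another generator it changes a single element. -/
lemma spinConn_insert (hN : Odd N) (hj : 2 * j < N) {i : Fin (N / 2)} (hi : j ≤ (i : ℕ))
    {x : Finset (Fin (N / 2))} (hx : i ∉ x) : SpinConn j x (insert i x) := by
  have hN' : 2 * (N / 2) + 1 = N := Nat.two_mul_div_two_add_one_of_odd hN
  have hmid : Fin.rev (⟨N / 2, by omega⟩ : Fin N) = ⟨N / 2, by omega⟩ := by
    ext; rw [Fin.val_rev]; simp only; omega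
  refine ⟨Relation.ReflTransGen.single (edge_spin (a := ⟨N / 2, by omega⟩) (b := ⟨i, by omega⟩)
    (fun h => by rw [Fin.mk.injEq] at h; omega) (by simp only [blocksBD]; omega) (hop_insert hx)
    (hop_mid hmid _)), Relation.ReflTransGen.single (edge_spin (a := ⟨N / 2, by omega⟩)
    (b := Fin.rev ⟨i, by omega⟩) (fun h => ?_) ?_ (z := x) ?_ (hop_mid hmid _))⟩
  · rw [Fin.ext_iff, Fin.val_rev] at h; simp only at h; omega
  · simp only [blocksBD, Fin.val_rev]; omega
  · rw [Fin.rev_rev]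
    simpa [hx] using hop_erase (Finset.mem_insert_self i x)

lemma spinConn_insert_insert {i k : Fin (N / 2)} (hik : i ≠ k) (hi : j ≤ (i : ℕ))
    (hk : j ≤ (k : ℕ)) {x : Finset (Fin (N / 2))} (hxi : i ∉ x) (hxk : k ∉ x) :
    SpinConn j x (insert i (insert k x)) := by
  have hi' : i ∉ insert k x := by simp [hik, hxi]
  refine ⟨Relation.ReflTransGen.single (edge_spin (a := Fin.rev ⟨i, by omega⟩) (b := ⟨k, by omega⟩)
    (fun h => ?_) ?_ (hop_insert hxk) (hop_insert hi')), Relation.ReflTransGen.single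
    (edge_spin (a := ⟨k, by omega⟩) (b := Fin.rev ⟨i, by omega⟩) (fun h => ?_) ?_
      (z := insert k x) ?_ ?_)⟩
  · rw [Fin.ext_iff, Fin.val_rev] at h; simp only at h; omega
  · simp only [blocksBD, Fin.val_rev]; omega
  · rw [Fin.ext_iff, Fin.val_rev] at h; simp only at h; omega
  · simp only [blocksBD, Fin.val_rev]; omega
  · rw [Fin.rev_rev]
    have := hop_erase (Finset.mem_insert_self i (insert k x))
    rwa [Finset.erase_insert hi'] at this
  · have := hop_erase (Finset.mem_insert_self k x)
    rwa [Finset.erase_insert hxk] at this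

lemma edge_singleton {i k : Fin (N / 2)} (hik : i ≠ k) (hi : j ≤ (i : ℕ)) (hk : j ≤ (k : ℕ)) :
    (typeBD N).Edge (blocksBD N j) (spin N) {i} {k} := by
  refine edge_spin (a := Fin.rev ⟨k, by omega⟩) (b := Fin.rev ⟨i, by omega⟩) (z := ∅) (fun h => ?_)
    ?_ ?_ (hop_insert (Finset.notMem_empty k))
  · rw [Fin.rev_inj, Fin.mk.injEq] at h
    exact hik (Fin.ext h.symm)
  · simp only [blocksBD, Fin.val_rev]; omega
  · rw [Fin.rev_rev]
    simpa using hop_erase (Finset.mem_singleton_self i)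

lemma spinConn_of_odd (hN : Odd N) (hj : 2 * j < N) (x : Finset (Fin (N / 2)))
    (hx : ∀ i ∈ x, j ≤ (i : ℕ)) : SpinConn j ∅ x := by
  induction x using Finset.induction_on with
  | empty => exact SpinConn.refl _
  | insert i s hi ih =>
    exact (ih fun k hk => hx k (Finset.mem_insert_of_mem hk)).trans
      (spinConn_insert hN hj (hx i (Finset.mem_insert_self i s)) hi)

/-- Root vectors insert or remove pairs, so induction on the degree ends at ∅ or at a singleton;
singletons are linked to one another by moving the element. -/
lemma spinConn_of_even {l : Fin (N / 2)} (hl : j ≤ (l : ℕ)) (n : ℕ) :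
    ∀ x : Finset (Fin (N / 2)), x.card = n → (∀ i ∈ x, j ≤ (i : ℕ)) →
      SpinConn j (if Even n then ∅ else {l}) x := by
  induction n using Nat.strong_induction_on with
  | _ n ih =>
    intro x hn hx
    rcases Nat.lt_trichotomy n 1 with h | h | h
    · obtain rfl : n = 0 := by omega
      rw [Finset.card_eq_zero.1 hn]
      exact SpinConn.refl _
    · subst h
      obtain ⟨i, rfl⟩ := Finset.card_eq_one.1 hn
      have hi := hx i (Finset.mem_singleton_self i)
      rw [if_neg Nat.not_even_one]
      by_cases hil : i = l
      · rw [hil]; exact SpinConn.refl _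
      · exact ⟨Relation.ReflTransGen.single (edge_singleton (Ne.symm hil) hl hi),
          Relation.ReflTransGen.single (edge_singleton hil hi hl)⟩
    · obtain ⟨i, hi, k, hk, hik⟩ := Finset.one_lt_card.1 (hn ▸ h)
      have hki : k ∈ x.erase i := Finset.mem_erase.2 ⟨hik.symm, hk⟩
      have hcard : ((x.erase i).erase k).card = n - 2 := by
        rw [Finset.card_erase_of_mem hki, Finset.card_erase_of_mem hi, hn]
        omega
      have h1 := ih (n - 2) (by omega) _ hcard fun p hp =>
        hx p (Finset.mem_of_mem_erase (Finset.mem_of_mem_erase hp))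
      have h2 := spinConn_insert_insert hik (hx i hi) (hx k hk) (x := (x.erase i).erase k)
        (by simp) (by simp)
      rw [Finset.insert_erase hki, Finset.insert_erase hi] at h2
      have heven : Even n ↔ Even (n - 2) := by rw [Nat.even_sub (by omega)]; simp
      simp only [heven]
      exact h1.trans h2

/-- The highest weight vector. -/
lemma exists_spinTop (hN : 3 ≤ N) (hP : IsSpinParity N P) (hj : 2 * j < N) :
    ∃ A : Finset (Fin (N / 2)), spinSet P j A ∧ (∀ x, spinSet P j x → SpinConn j A x) ∧
      (A = ∅ ∨ ∃ l : Fin (N / 2), (l : ℕ) + 1 = N / 2 ∧ Even N ∧ A = {l} ∧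
        ∀ x : Finset (Fin (N / 2)), spinSet P j x → x.Nonempty) := by
  rcases hP with ⟨hN', rfl⟩ | ⟨hN', rfl | rfl⟩
  · exact ⟨∅, ⟨trivial, by simp⟩, fun x hx => spinConn_of_odd hN' hj x hx.2, Or.inl rfl⟩
  · have hN2 : 2 * (N / 2) = N := Nat.two_mul_div_two_of_even hN'
    refine ⟨∅, ⟨by simp, by simp⟩, fun x hx => ?_, Or.inl rfl⟩
    have := spinConn_of_even (j := j) (l := ⟨N / 2 - 1, by omega⟩) (by simp only; omega) _ x rfl hx.2
    rwa [if_pos hx.1] at this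
  · have hN2 : 2 * (N / 2) = N := Nat.two_mul_div_two_of_even hN'
    -- The last generator has the smallest grading, so its singleton is the highest weight among the
    -- sets of odd degree.
    refine ⟨{⟨N / 2 - 1, by omega⟩}, ⟨by simp, by simp; omega⟩, fun x hx => ?_,
      Or.inr ⟨_, by simp only; omega, hN', rfl, fun x hx => ?_⟩⟩
    · have := spinConn_of_even (j := j) (l := ⟨N / 2 - 1, by omega⟩) (by simp only; omega) _ x rfl
        hx.2
      rwa [if_neg (Nat.not_even_iff_odd.2 hx.1)] at this
    · exact Finset.card_pos.1 hx.1.pos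

lemma spinWt_rhoSO {i : Fin (N / 2)} (A : Finset (Fin (N / 2))) :
    spinWt (rhoSO N i) A = Complex.I / 2 - if i ∈ A then Complex.I else 0 := by
  rw [spinWt, Finset.sum_eq_single i]
  · rw [rhoSO_apply_lt i.2 i.2, if_pos rfl]
    split_ifs <;> ring
  · intro k _ hk
    rw [rhoSO_apply_lt i.2 k.2, if_neg fun h => hk (Fin.ext h), mul_zero]
  · simp

lemma spinWt_eq (H : Mat N) (A : Finset (Fin (N / 2))) :
    spinWt H A = spinWt H ∅ - ∑ i ∈ A, H ⟨i, by omega⟩ ⟨i, by omega⟩ := by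
  have h : ∑ i ∈ A, H ⟨i, by omega⟩ ⟨i, by omega⟩ = ∑ i : Fin (N / 2),
      (if i ∈ A then 1 else 0) * H ⟨i, by omega⟩ ⟨i, by omega⟩ := by
    simp only [ite_mul, one_mul, zero_mul, Finset.sum_ite_mem, Finset.univ_inter]
  rw [h, spinWt, spinWt, ← Finset.sum_sub_distrib]
  refine Finset.sum_congr rfl fun i _ => ?_
  rw [if_neg (Finset.notMem_empty i)]
  ring

theorem isIrred_wSpin (hN : 3 ≤ N) (hP : IsSpinParity N P) (hj : 2 * j < N) :
    IsIrred (spin N) ((typeBD N).levi (rootsBD N j)) (wSpin N P j) := by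
  obtain ⟨A, hA, hconn, -⟩ := exists_spinTop hN hP hj
  refine isIrred_coordSub (A := spinSet P j) (typeBD_isForm hN).isStandard (typeBD_hasBlocks hj)
    spin_weight hA (fun X hX hXP x y hx hy => repMat_spin_block hP.evenInvariant hX hXP hx hy)
    (fun x y hx hy hxy => ?_) hconn
  have : ∃ i, ¬ (i ∈ x ↔ i ∈ y) := by
    by_contra! h
    exact hxy (Finset.ext h)
  obtain ⟨i, hi⟩ := this
  -- The generator of the i-th 𝔰𝔬(2) tests whether i belongs to a set, so distinct sets have
  -- distinct weights.
  refine ⟨_, rhoSO_mem (j := i) (by omega), ?_⟩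
  rw [spinWt_rhoSO, spinWt_rhoSO]
  by_cases h1 : i ∈ x
  · have h2 : i ∉ y := fun h => hi (iff_of_true h1 h)
    simp [h1, h2]
  · have h2 : i ∈ y := by
      by_contra h
      exact hi (iff_of_false h1 h)
    rw [if_neg h1, if_pos h2]
    exact fun h => Complex.I_ne_zero (by linear_combination h)

theorem isMinimal_wSpin (hN : 3 ≤ N) (hP : IsSpinParity N P) (hj : 2 * j + 2 < N) :
    (typeBD N).IsMinimal (spin N) (rootsBD N j) (rootsBD N (j + 1)) (rhoSO N j) (Complex.I / 2)
      (wSpin N P j) (wSpin N P (j + 1))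
      (coordSub fun A => spinSet P j A ∧ ∃ i ∈ A, (i : ℕ) = j) := by
  obtain ⟨A, hA, -, htop⟩ := exists_spinTop hN hP (j := j) (by omega)
  set o : Fin (N / 2) := ⟨j, by omega⟩ with ho
  have hwt : ∀ x, spinWt (rhoSO N j) x = Complex.I / 2 - if o ∈ x then Complex.I else 0 :=
    fun x => spinWt_rhoSO (i := o) x
  have hex : ∀ x : Finset (Fin (N / 2)), (∃ i ∈ x, (i : ℕ) = j) ↔ o ∈ x := fun x =>
    ⟨fun ⟨i, hi, h⟩ => (Fin.ext h : i = o) ▸ hi, fun h => ⟨o, h, rfl⟩⟩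
  simp only [hex]
  refine isMinimal_coordSub (A := spinSet P j) (Ap := spinSet P (j + 1))
    (Am := fun A => spinSet P j A ∧ o ∈ A) (typeBD_isForm hN).isStandard
    (typeBD_hasBlocks (by omega)) spin_isRep spin_weight (rhoSO_mem (by omega)) (rhoSO_gen hj)
    (isIrred_wSpin hN hP (by omega)) (isIrred_wSpin hN hP (by omega)) (fun x => ?_) (fun x hx => ?_)
    (fun x hx => ?_) ?_ hA ?_ fun x hx => ?_
  · constructor
    · intro hx
      by_cases h : o ∈ x
      · exact Or.inr ⟨hx, h⟩
      · refine Or.inl ⟨hx.1, fun i hi => ?_⟩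
        have h1 := hx.2 i hi
        have h2 : (i : ℕ) ≠ j := fun h' => h ((hex x).1 ⟨i, hi, h'⟩)
        omega
    · rintro (hx | hx)
      · exact ⟨hx.1, fun i hi => by have := hx.2 i hi; omega⟩
      · exact hx.1
  · rw [hwt, if_neg fun h => by have := hx.2 o h; simp only [ho] at this; omega, sub_zero]
  · rw [hwt, if_pos hx.2]
  -- The lower eigenspace is nonzero: {j} lies in it unless even degree is required, and then {j, j
  -- + 1} does, which fits because 2j + 2 < N.
  · rcases hP with ⟨hN', rfl⟩ | ⟨hN', rfl | rfl⟩
    · exact ⟨{o}, ⟨trivial, by simp [ho]⟩, by simp⟩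
    · have hN2 : 2 * (N / 2) = N := Nat.two_mul_div_two_of_even hN'
      refine ⟨{o, ⟨j + 1, by omega⟩}, ⟨?_, by simp [ho]⟩, by simp⟩
      rw [Finset.card_pair (by simp [ho])]
      exact even_two
    · exact ⟨{o}, ⟨by simp, by simp [ho]⟩, by simp⟩
  · rw [hwt, if_neg, sub_zero]
    rcases htop with rfl | ⟨l, hl, hN', rfl, -⟩
    · simp
    · have hN2 : 2 * (N / 2) = N := Nat.two_mul_div_two_of_even hN'
      rw [Finset.mem_singleton, Fin.ext_iff]
      simp only [ho]
      omega
  -- Each element of a set lowers the grading weight by a nonnegative amount, smallest for the last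
  -- generator. The maximum is at ∅, or at the last singleton if ∅ is excluded by parity.
  · have hg : ∀ (s : Finset (Fin (N / 2))), (spinWt (Matrix.diagonal fun a : Fin N =>
        ((N : ℂ) - 1) / 2 - (a : ℕ)) s).re = (spinWt (Matrix.diagonal fun a : Fin N =>
        ((N : ℂ) - 1) / 2 - (a : ℕ)) ∅).re - ∑ i ∈ s, (((N : ℝ) - 1) / 2 - (i : ℕ)) := by
      intro s
      rw [spinWt_eq, Complex.sub_re, Complex.re_sum]
      congr 1
      refine Finset.sum_congr rfl fun i _ => ?_
      simp
    have hpos : ∀ i : Fin (N / 2), 0 ≤ ((N : ℝ) - 1) / 2 - (i : ℕ) := by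
      intro i
      have h1 : 2 * (i : ℕ) + 1 ≤ N := by omega
      have h2 : 2 * ((i : ℕ) : ℝ) + 1 ≤ N := by exact_mod_cast h1
      linarith
    rw [hg x, hg A]
    refine sub_le_sub_left ?_ _
    rcases htop with rfl | ⟨l, hl, hN', rfl, hne⟩
    · rw [Finset.sum_empty]
      exact Finset.sum_nonneg fun i _ => hpos i
    · obtain ⟨i, hi⟩ := hne x hx
      rw [Finset.sum_singleton]
      refine le_trans ?_ (Finset.single_le_sum (fun i _ => hpos i) hi)
      have h1 : (i : ℕ) ≤ l := by omega
      have h2 : ((i : ℕ) : ℝ) ≤ (l : ℕ) := by exact_mod_cast h1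
      linarith

theorem typeBD_spin_theorem {c : ℝ} (hc : c ≠ 0) (hN : 3 ≤ N) (hN4 : N ≠ 4) :
    (typeBD N).IsRootData ∧
    (typeBD N).IsRep (spin N) ∧
    (typeBD N).IsNoncompact Finset.univ (allBut (N / 2) 0) ∧
    (typeBD N).IsThimmChain ((N - 1) / 2) (rootsBD N) (chainBD N) ∧
    (∀ P : ℕ → Prop, IsSpinParity N P →
      (typeBD N).IsMinimal (spin N) Finset.univ (allBut (N / 2) 0) (rhoBD N)
        (Complex.I / 2) (wSpin N P 0) (wSpin N P 1) (wSpinLow N P) ∧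
      (typeBD N).IsMinimalForChain (spin N) ((N - 1) / 2) (rootsBD N) (wSpin N P) ∧
      ∀ j ≤ (N - 1) / 2, NijenhuisFormula (typeBD N) c (rhoBD N) (spin N) (chainBD N j)
        (wSpin N P j) 1) ∧
    ∀ j ≤ (N - 1) / 2, NijenhuisFormula (typeBD N) c (rhoBD N) (spin N) (chainBD N j)
      (wSpin N (fun _ => True) j) 1 := by
  refine ⟨(typeBD_isForm hN).isStandard.isRootData, spin_isRep, ?_, typeBD_isThimmChain hN,
    fun P hP => ⟨?_, fun j hj => ⟨_, _, _, isMinimal_wSpin hN hP (by omega)⟩,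
      fun j hj => typeBD_nijenhuis hc hN hP.evenInvariant (by omega)⟩,
    fun j hj => typeBD_nijenhuis hc hN evenInvariant_true (by omega)⟩
  · rw [← rootsBD_one hN hN4, ← rootsBD_zero hN]
    exact typeBD_isNoncompact hN (by omega)
  · rw [← rootsBD_one hN hN4, ← rootsBD_zero hN,
      show wSpinLow N P = coordSub fun A => spinSet P 0 A ∧ ∃ i ∈ A, (i : ℕ) = 0 by
        simp [wSpinLow, spinSet]]
    exact isMinimal_wSpin hN hP (by omega)

end BDI

end

end HermSym

/-! ### The four families together. -/

theorem mainTheorem6 (c : ℝ) (hc : c ≠ 0) :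
    -- AIII: SU(n) / S(U(k) × U(n-k)), fundamental representation
    (∀ n k : ℕ, 2 ≤ n → 1 ≤ k → k < n →
      (typeA n).IsRootData ∧
      (typeA n).IsRep (fund n) ∧
      (typeA n).IsNoncompact Finset.univ (allBut (n - 1) (k - 1)) ∧
      (typeA n).IsMinimal (fund n) Finset.univ (allBut (n - 1) (k - 1)) (rhoA n k)
        (Complex.I * ((n : ℂ) - k) / n) ⊤
        (coordSub fun a => (a : ℕ) < k) (coordSub fun a => k ≤ (a : ℕ)) ∧
      (typeA n).IsThimmChain (n - 1) (rootsA n) (chainA n) ∧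
      wA n 0 = ⊤ ∧
      (typeA n).IsMinimalForChain (fund n) (n - 1) (rootsA n) (wA n) ∧
      ∀ i ≤ n - 1, NijenhuisFormula (typeA n) c (rhoA n k) (fund n) (chainA n i) (wA n i)
        (2 * ((n : ℂ) - k) / n)) ∧
    -- BDI: SO(N) / SO(N-2) × SO(2), spin representation
    (∀ N : ℕ, 3 ≤ N → N ≠ 4 →
      (typeBD N).IsRootData ∧
      (typeBD N).IsRep (spin N) ∧
      (typeBD N).IsNoncompact Finset.univ (allBut (N / 2) 0) ∧
      (typeBD N).IsThimmChain ((N - 1) / 2) (rootsBD N) (chainBD N) ∧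
      (∀ P : ℕ → Prop, IsSpinParity N P →
        (typeBD N).IsMinimal (spin N) Finset.univ (allBut (N / 2) 0) (rhoBD N)
          (Complex.I / 2) (wSpin N P 0) (wSpin N P 1) (wSpinLow N P) ∧
        (typeBD N).IsMinimalForChain (spin N) ((N - 1) / 2) (rootsBD N) (wSpin N P) ∧
        ∀ j ≤ (N - 1) / 2, NijenhuisFormula (typeBD N) c (rhoBD N) (spin N) (chainBD N j)
          (wSpin N P j) 1) ∧
      ∀ j ≤ (N - 1) / 2, NijenhuisFormula (typeBD N) c (rhoBD N) (spin N) (chainBD N j)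
        (wSpin N (fun _ => True) j) 1) ∧
    -- DIII: SO(2n) / U(n), fundamental representation
    (∀ n : ℕ, 2 ≤ n →
      (typeBD (2 * n)).IsRootData ∧
      (typeBD (2 * n)).IsRep (fund (2 * n)) ∧
      (typeBD (2 * n)).IsNoncompact Finset.univ (allBut (2 * n / 2) (n - 1)) ∧
      (typeBD (2 * n)).IsMinimal (fund (2 * n)) Finset.univ (allBut (2 * n / 2) (n - 1)) (rhoU n)
        (Complex.I / 2) ⊤ (coordSub fun a => (a : ℕ) < n) (coordSub fun a => n ≤ (a : ℕ)) ∧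
      (typeBD (2 * n)).IsThimmChain n (rootsU n)
        (chainU n (typeBD (2 * n)).compact) ∧
      wU n 0 = ⊤ ∧
      (typeBD (2 * n)).IsMinimalForChain (fund (2 * n)) n
        (rootsU n) (wU n) ∧
      ∀ j ≤ n, NijenhuisFormula (typeBD (2 * n)) c (rhoU n) (fund (2 * n))
        (chainU n (typeBD (2 * n)).compact j) (wU n j) 1) ∧
    -- CI: Sp(2n) / U(n), fundamental representation
    (∀ n : ℕ, 1 ≤ n →
      (typeC n).IsRootData ∧
      (typeC n).IsRep (fund (2 * n)) ∧
      (typeC n).IsNoncompact Finset.univ (allBut n (n - 1)) ∧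
      (typeC n).IsMinimal (fund (2 * n)) Finset.univ (allBut n (n - 1)) (rhoU n)
        (Complex.I / 2) ⊤ (coordSub fun a => (a : ℕ) < n) (coordSub fun a => n ≤ (a : ℕ)) ∧
      (typeC n).IsThimmChain n (rootsU n) (chainU n (typeC n).compact) ∧
      wU n 0 = ⊤ ∧
      (typeC n).IsMinimalForChain (fund (2 * n)) n (rootsU n) (wU n) ∧
      ∀ j ≤ n, NijenhuisFormula (typeC n) c (rhoU n) (fund (2 * n))
        (chainU n (typeC n).compact j) (wU n j) 1) :=
  ⟨fun _ _ _ hk hkn => typeA_theorem hc hk hkn, fun _ hN hN4 => typeBD_spin_theorem hc hN hN4,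
    fun _ hn => typeD_theorem hc hn, fun _ hn => typeC_theorem hc hn⟩
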